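/- **Setting.** Let $\Omega=\mathbb T^d=\mathbb R^d/\mathbb Z^d$, $(u,w)=\int_\Omega u\cdot w\,dx$, and let $A:B$ be the Frobenius product (also used in $(\cdot,\cdot)$ for matrix fields). Let $\mathbf F:\mathbb R^n\to\mathbb R^{N\times N}_s$ be a $C^2$ function with values in the symmetric matrices, let $L(\Xi)_i=\sum_{j\le\nu}\sum_{l,m}\sum_{|\alpha|=j}b_{ilm\alpha}\partial_\alpha\Xi_{lm}$ ($i=1,\dots,n$) be a constant coefficient differential operator acting on symmetric matrix fields, and let $L^*$ be its formal adjoint, with values in the symmetric matrix fields. Consider the problem $\partial_t v=L(\mathbf F(v))$, $v(0,\cdot)=v_0$. Put $\mathbf K(v)=\frac12\operatorname{tr}(\mathbf F(v)-\mathbf F(0))$, let $\mathbf K^*$ be its Legendre transform, $v^\#=\nabla\mathbf K(v)$, and let $\Lambda$ be the smallest linear space of symmetric matrices containing $I$ and all values of $L^*u$, $u:\Omega\to\mathbb R^n$ smooth. Write $A\succeq B$ if $A-B$ is nonnegative definite, and, for symmetric $A,B$, $B\le A$ if $(A-B):P\ge0$ for every nonnegative definite $P\in\Lambda$. Assume: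 * $\mathbf K$ is strictly convex and is an $N$-function (it is convex, even, nonnegative, and $\Phi_-(|y|)\le\mathbf K(y)\le\Phi_+(|y|)$ for two Young functions $\Phi_\pm$, i.e. even convex $\Phi:\mathbb R\to[0,\infty)$ vanishing only at $0$ with $\Phi(s)/s\to0$ as $s\to0$ and $\Phi(s)/s\to\infty$ as $s\to\infty$); $\mathbf K$ and $\mathbf K^*$ satisfy the $\Delta_2$-condition ($\mathbf K(2y)\le C(\mathbf K(y)+1)$, and likewise for $\mathbf K^*$); * for every nonnegative definite $P\in\Lambda$ the function $\mathbf F:P$ is convex and nonnegative; and $|\pi_\Lambda\partial_l\mathbf F(v)|\le C(|\nabla\mathbf K(v)|+1)$ for all $l,v$, where $\pi_\Lambda$ is the Frobenius-orthogonal projection onto $\Lambda$; * $(\mathbf F(\nabla\mathbf K^*(u)),L^*u)=0$ for every smooth $u:\Omega\to\mathbb R^n$. For an $N$-function $\mathbf G$, $L_{\mathbf G}$ is the set of measurable $f$ with $\int\mathbf G(f)<\infty$. Fix $T>0$, a measurable weight $ϰ$ on $[0,T]$ bounded away from $0$ and $\infty$, put $Ϙ(t)=\int_t^Tϰ(s)\,ds$,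 and let $v_0\in L_{\mathbf K}(\Omega;\mathbb R^n)$. Let $\mathcal A$ be the set of pairs $(E,B)\in L_{\mathbf K^*}((0,T)\times\Omega;\mathbb R^n)\times L^\infty((0,T)\times\Omega;\mathbb R^{N\times N}_s)$ such that $\int_0^T[(B,\partial_t\Psi)+(E,L\Psi)]\,dt=0$ for all smooth $\Psi:[0,T]\times\Omega\to\mathbb R^{N\times N}_s$ with $\Psi(0)=0$. A weak solution on $[0,T]$ is a $v\in L_{\mathbf K}((0,T)\times\Omega;\mathbb R^n)$ with $\int_0^T[(v-v_0,E)+(\mathbf F(v),B)]\,dt=0$ for all $(E,B)\in\mathcal A$. A strong solution is a weak solution such that (with distributional derivatives) $\partial_t(Ϙv^\#)\in L_{\mathbf K^*}((0,T)\times\Omega;\mathbb R^n)$, $ϘL^*(v^\#)\in L^\infty((0,T)\times\Omega;\mathbb R^{N\times N}_s)$, $\partial_t(v^\#)_l+L^*(v^\#):\partial_l\mathbf F(\nabla\mathbf K^*(v^\#))=0$ a.e. for $l=1,\dots,n$, and $v^\#(0,\cdot)=v_0^\#$ (as the essential limit in $L^1(\Omega)$ as $t\to0^+$). Define, in $[-\infty,\infty]$,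 with $v\in L_{\mathbf K}((0,T)\times\Omega;\mathbb R^n)$, $M\in L^1((0,T)\times\Omega;\mathbb R^{N\times N}_s)$ and $\mathbf F(v)\le M$ a.e., $$\mathcal I=\inf_v\sup_{(E,B)\in\mathcal A}\int_0^T[(v-v_0,E)+\tfrac12(\mathbf F(v),ϰI+2B)]\,dt,\qquad \tilde{\mathcal I}=\inf_{(v,M)}\sup_{(E,B)\in\mathcal A}\int_0^T[(v-v_0,E)+\tfrac12(M,ϰI+2B)]\,dt,$$ let $\mathcal J,\tilde{\mathcal J}$ be the same with $\sup_{(E,B)}\inf$ in place of $\inf\sup_{(E,B)}$, and let $K_0=\frac12\int_\Omega\operatorname{tr}\mathbf F(v_0)\,dx$. The dual problem is to maximize $$D(E,B)=-\int_0^T(v_0,E)\,dt+\inf_{(z,M):\,\mathbf F(z)\le M}\int_0^T[(z,E)+\tfrac12(M,ϰI+2B)]\,dt$$ over all $(E,B)\in\mathcal A$ with $ϰI+2B\succeq0$ a.e. **Theorem (Consistency).** Let $v$ be a strong solution on $[0,T]$. (1) If $ϰI\succeq-2Ϙ(t)L^*(v^\#)$ a.e. in $(0,T)\times\Omega$, then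 $\mathcal I=\mathcal J=\tilde{\mathcal I}=\tilde{\mathcal J}=Ϙ(0)K_0$. The distributions $E_+=\partial_t(Ϙv^\#)$ and $B_+=L^*(Ϙv^\#)$ are functions, the pair $(E_+,B_+)$ belongs to $L_{\mathbf K^*}((0,T)\times\Omega;\mathbb R^n)\times L^\infty((0,T)\times\Omega;\mathbb R^{N\times N}_s)$, it is feasible for the dual problem and maximizes it, with $D(E_+,B_+)=\tilde{\mathcal J}$, and $$v(t,x)=\nabla\mathbf K^*\Big(\frac1{Ϙ(t)}\int_t^T(-E_+)(s,x)\,ds\Big)\quad\text{for a.e. }(t,x)\in(0,T)\times\Omega.$$ (2) For every $T_1\in(0,T)$ there is $\gamma_0>0$ such that for every $\gamma\ge\gamma_0$ the following holds with $T$ replaced by $T_1$ and with the weights $ϰ(t)=e^{-\gamma t}$, $Ϙ(t)=\int_t^{T_1}e^{-\gamma s}\,ds$: the restriction of $v$ to $[0,T_1]$ is a strong solution on $[0,T_1]$, it satisfies the positivity condition of (1), and hence all conclusions of (1) hold on $[0,T_1]$. -/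

import Mathlib

open MeasureTheory Set Filter Topology
open scoped ContDiff

noncomputable section

namespace DualConsistency

/-! ### Basic spaces -/

/-- `ℝⁿ` with its Euclidean structure. -/
abbrev Vec (n : ℕ) := EuclideanSpace ℝ (Fin n)

/-- Real `N × N` matrices. -/
abbrev Mat (N : ℕ) := Matrix (Fin N) (Fin N) ℝ

/-- The periodic box `𝕋ᵈ = ℝᵈ / ℤᵈ`, with its Lebesgue (Haar) measure. -/
abbrev Torus (d : ℕ) := UnitAddTorus (Fin d)

/-- The Frobenius scalar product `A : B`. -/
def frob {N : ℕ} (A B : Mat N) : ℝ := ∑ l, ∑ m, A l m * B l m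

/-- A matrix as a vector of its entries; the Euclidean norm of `matVec N A` is the Frobenius
norm of `A`, and the inner product is the Frobenius product. -/
def matVec (N : ℕ) : Mat N →ₗ[ℝ] EuclideanSpace ℝ (Fin N × Fin N) where
  toFun A := WithLp.toLp 2 fun p => A p.1 p.2
  map_add' _ _ := rfl
  map_smul' _ _ := rfl

/-- Lebesgue measure on `(0,T) × 𝕋ᵈ`. -/
def stMeasure (T : ℝ) (d : ℕ) : Measure (ℝ × Torus d) :=
  (volume.restrict (Ioo 0 T)).prod volume

/-! ### `N`-functions and anisotropic Orlicz classes -/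

/-- Young functions. -/
structure IsYoung (Φ : ℝ → ℝ) : Prop where
  convex : ConvexOn ℝ univ Φ
  nonneg : ∀ s, 0 ≤ Φ s
  even : ∀ s, Φ (-s) = Φ s
  eq_zero_iff : ∀ s, Φ s = 0 ↔ s = 0
  lim_zero : Tendsto (fun s => Φ s / s) (𝓝[≠] 0) (𝓝 0)
  lim_top : Tendsto (fun s => Φ s / s) atTop atTop

/-- `N`-functions on `ℝⁿ`. -/
structure IsNFunction {n : ℕ} (K : Vec n → ℝ) : Prop where
  convex : ConvexOn ℝ univ K
  nonneg : ∀ y, 0 ≤ K y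
  even : ∀ y, K (-y) = K y
  bounds : ∃ Φm Φp : ℝ → ℝ, IsYoung Φm ∧ IsYoung Φp ∧
    ∀ y, Φm ‖y‖ ≤ K y ∧ K y ≤ Φp ‖y‖

/-- The `Δ₂`-condition `K (2y) ≲ K y + 1`. -/
def Delta2 {n : ℕ} (K : Vec n → ℝ) : Prop :=
  ∃ C : ℝ, ∀ y, K ((2 : ℝ) • y) ≤ C * (K y + 1)

/-- The Legendre transform `K*(y) = sup_x (x · y - K x)`. -/
def legendre {n : ℕ} (K : Vec n → ℝ) (y : Vec n) : ℝ :=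
  ⨆ x : Vec n, (inner ℝ x y - K x)

/-- Membership in the Orlicz class `L_K(X, μ; ℝⁿ)`: measurability and finiteness of the
modular `∫ K(f) dμ`. -/
def InOrlicz {X : Type*} [MeasurableSpace X] {n : ℕ} (K : Vec n → ℝ) (μ : Measure X)
    (f : X → Vec n) : Prop :=
  AEStronglyMeasurable f μ ∧ Integrable (fun x => K (f x)) μ

/-! ### Calculus on the torus -/

/-- The covering map `ℝᵈ → 𝕋ᵈ`. -/
def toTorus {d : ℕ} (y : Fin d → ℝ) : Torus d := fun i => (y i : UnitAddCircle)

/-- Smoothness of a function on `𝕋ᵈ`. -/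
def SmoothX {d : ℕ} {V : Type*} [NormedAddCommGroup V] [NormedSpace ℝ V]
    (u : Torus d → V) : Prop :=
  ContDiff ℝ ∞ fun y : Fin d → ℝ => u (toTorus y)

/-- Smoothness of a function on `ℝ × 𝕋ᵈ`. Restrictions of such functions to
`[0,T] × 𝕋ᵈ` are the functions that are smooth up to the boundary. -/
def SmoothTX {d : ℕ} {V : Type*} [NormedAddCommGroup V] [NormedSpace ℝ V]
    (φ : ℝ × Torus d → V) : Prop :=
  ContDiff ℝ ∞ fun p : ℝ × (Fin d → ℝ) => φ (p.1, toTorus p.2)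

/-- The partial derivative `∂ᵢ g` on the torus. -/
def torusPartial {d : ℕ} (i : Fin d) (g : Torus d → ℝ) (x : Torus d) : ℝ :=
  deriv (fun h : ℝ => g (x + toTorus (Pi.single i h))) 0

/-- The partial derivative `∂_α g` for a multiindex `α`. -/
def torusDeriv {d : ℕ} (α : Fin d → ℕ) (g : Torus d → ℝ) : Torus d → ℝ :=
  (List.finRange d).foldr (fun i f => (torusPartial i)^[α i] f) g

/-- Time derivative of a vector field. -/
def dtVec {d n : ℕ} (φ : ℝ × Torus d → Vec n) (z : ℝ × Torus d) : Vec n :=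
  deriv (fun s => φ (s, z.2)) z.1

/-- Time derivative of a matrix field. -/
def dtMat {d N : ℕ} (Ψ : ℝ × Torus d → Mat N) (z : ℝ × Torus d) : Mat N :=
  Matrix.of fun l m => deriv (fun s => Ψ (s, z.2) l m) z.1

/-- Smooth symmetric matrix fields on space-time. -/
def SmoothSymTX {d N : ℕ} (Ψ : ℝ × Torus d → Mat N) : Prop :=
  (∀ l m, SmoothTX fun z => Ψ z l m) ∧ ∀ z, (Ψ z).IsSymm

/-- A field on space-time is compactly supported in `(0,T) × 𝕋ᵈ`. -/
def CompactIn {d : ℕ} {V : Type*} [Zero V] (T : ℝ) (φ : ℝ × Torus d → V) : Prop :=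
  HasCompactSupport φ ∧ tsupport φ ⊆ Ioo 0 T ×ˢ univ

/-- `w = ∂ₜ u` in the sense of distributions on `(0,T) × 𝕋ᵈ`. -/
def IsWeakDt {d n : ℕ} (T : ℝ) (u w : ℝ × Torus d → Vec n) : Prop :=
  LocallyIntegrableOn u (Ioo 0 T ×ˢ univ) volume ∧
  LocallyIntegrableOn w (Ioo 0 T ×ˢ univ) volume ∧
  ∀ φ : ℝ × Torus d → Vec n, SmoothTX φ → CompactIn T φ →
    ∫ z, inner ℝ (u z) (dtVec φ z) ∂stMeasure T d = -∫ z, inner ℝ (w z) (φ z) ∂stMeasure T d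

/-! ### The abstract system `∂ₜ v = L(F(v))` -/

/-- The data of the problem: the flux `F : ℝⁿ → ℝ^{N×N}` and the order `ν` and the
coefficients `b_{i l m α}` of the constant coefficient operator `L`. -/
structure System (d n N : ℕ) where
  F : Vec n → Mat N
  ν : ℕ
  b : Fin n → Fin N → Fin N → (Fin d → ℕ) → ℝ

namespace System

variable {d n N : ℕ} (S : System d n N)

/-- `L(Ξ)_i = ∑_{j ≤ ν} ∑_{l,m} ∑_{|α| = j} b_{ilmα} ∂_α Ξ_{lm}`. -/
def L (Ξ : Torus d → Mat N) (x : Torus d) : Vec n :=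
  WithLp.toLp 2 fun i => ∑ j ∈ Finset.range (S.ν + 1), ∑ l, ∑ m,
    ∑ α ∈ Finset.piAntidiag (Finset.univ : Finset (Fin d)) j,
      S.b i l m α * torusDeriv α (fun y => Ξ y l m) x

/-- The formal adjoint `L*` of `L` regarded as an operator on symmetric matrix fields; hence the
symmetrization of the coefficients in `l, m`. -/
def Lstar (u : Torus d → Vec n) (x : Torus d) : Mat N :=
  Matrix.of fun l m => ∑ j ∈ Finset.range (S.ν + 1), ∑ i,
    ∑ α ∈ Finset.piAntidiag (Finset.univ : Finset (Fin d)) j,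
      (-1) ^ j * ((S.b i l m α + S.b i m l α) / 2) * torusDeriv α (fun y => u y i) x

/-- `G = L* u` in the sense of distributions on `(0,T) × 𝕋ᵈ`. -/
def IsWeakLstar (T : ℝ) (u : ℝ × Torus d → Vec n) (G : ℝ × Torus d → Mat N) : Prop :=
  LocallyIntegrableOn u (Ioo 0 T ×ˢ univ) volume ∧
  (∀ l m, LocallyIntegrableOn (fun z => G z l m) (Ioo 0 T ×ˢ univ) volume) ∧
  (∀ᵐ z ∂stMeasure T d, (G z).IsSymm) ∧
  ∀ Ψ : ℝ × Torus d → Mat N, SmoothSymTX Ψ → CompactIn T Ψ →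
    ∫ z, inner ℝ (u z) (S.L (fun y => Ψ (z.1, y)) z.2) ∂stMeasure T d =
      ∫ z, frob (G z) (Ψ z) ∂stMeasure T d

/-- The entropy `K(v) = ½ tr (F(v) - F(0))`. -/
def K (v : Vec n) : ℝ := 1 / 2 * (S.F v - S.F 0).trace

/-- The Legendre transform of the entropy. -/
def Kstar : Vec n → ℝ := legendre S.K

/-- The sharp vector `v^# = ∇K(v)`. -/
def sharp (v : Vec n) : Vec n := gradient S.K v

/-- The partial derivative `∂ₖ F(v)`. -/
def dF (k : Fin n) (v : Vec n) : Mat N :=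
  Matrix.of fun l m => fderiv ℝ (fun w => S.F w l m) v (EuclideanSpace.single k 1)

/-- `Λ`: the smallest linear space of (symmetric) matrices that contains `I` and all values of
`L* u`, `u` smooth. -/
def Lam : Submodule ℝ (Mat N) :=
  Submodule.span ℝ ({1} ∪ {A | ∃ u : Torus d → Vec n, SmoothX u ∧ ∃ x, A = S.Lstar u x})

/-- The cone `ℝ^{N×N}_Λ` of symmetric matrices that are nonnegative in the `Λ`-order. -/
def LamNonneg (A : Mat N) : Prop :=
  A.IsSymm ∧ ∀ P ∈ S.Lam, P.PosSemidef → 0 ≤ frob A P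

/-- `|π_Λ A|`: the Frobenius norm of the Frobenius-orthogonal projection of `A` onto `Λ`. -/
def projNorm (A : Mat N) : ℝ :=
  ‖(S.Lam.map (matVec N)).starProjection (matVec N A)‖

/-- The standing assumptions on the flux and the operator. -/
structure Assumptions : Prop where
  /-- `F` is a `C²` function with values in the symmetric matrices. -/
  F_symm : ∀ v, (S.F v).IsSymm
  F_smooth : ∀ l m, ContDiff ℝ 2 fun v => S.F v l m
  /-- Entropy. -/
  K_strictConvex : StrictConvexOn ℝ univ S.K
  K_nFunction : IsNFunction S.K
  K_delta2 : Delta2 S.K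
  Kstar_delta2 : Delta2 S.Kstar
  /-- `Λ`-convexity. -/
  lam_convex : ∀ P ∈ S.Lam, P.PosSemidef → ConvexOn ℝ univ fun v => frob (S.F v) P
  /-- Nonnegativity in the `Λ`-order. -/
  lam_nonneg : ∀ v, S.LamNonneg (S.F v)
  /-- Control of the derivatives of the flux. -/
  growth : ∃ C : ℝ, ∀ k v, S.projNorm (S.dF k v) ≤ C * (‖gradient S.K v‖ + 1)
  /-- Conservativity: `(F(v), L*(v^#)) = 0` whenever `v^# = u` is smooth. -/
  conservative : ∀ u : Torus d → Vec n, SmoothX u →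
    ∫ x, frob (S.F (gradient S.Kstar (u x))) (S.Lstar u x) = 0

/-! ### Weak and strong solutions -/

/-- The class `L_{K*}((0,T) × Ω; ℝⁿ) × L^∞((0,T) × Ω; ℝ^{N×N}_s)` of pairs `(E,B)`. -/
def InDualClass (T : ℝ) (E : ℝ × Torus d → Vec n) (B : ℝ × Torus d → Mat N) : Prop :=
  InOrlicz S.Kstar (stMeasure T d) E ∧
  (∀ l m, MemLp (fun z => B z l m) ⊤ (stMeasure T d)) ∧
  ∀ᵐ z ∂stMeasure T d, (B z).IsSymm

/-- The weak form of the constraint `∂ₜ B = L* E`, `B(T) = 0`. -/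
def Constraint (T : ℝ) (E : ℝ × Torus d → Vec n) (B : ℝ × Torus d → Mat N) : Prop :=
  ∀ Ψ : ℝ × Torus d → Mat N, SmoothSymTX Ψ → (∀ x, Ψ (0, x) = 0) →
    ∫ z, (frob (B z) (dtMat Ψ z) + inner ℝ (E z) (S.L (fun y => Ψ (z.1, y)) z.2))
      ∂stMeasure T d = 0

/-- The admissible pairs `(E,B)` of the saddle-point problems. -/
def Admissible (T : ℝ) : Set ((ℝ × Torus d → Vec n) × (ℝ × Torus d → Mat N)) :=
  {p | S.InDualClass T p.1 p.2 ∧ S.Constraint T p.1 p.2}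

/-- Weak solutions on `[0,T]` with initial datum `v₀`. -/
def IsWeakSolution (T : ℝ) (v₀ : Torus d → Vec n) (v : ℝ × Torus d → Vec n) : Prop :=
  InOrlicz S.K (stMeasure T d) v ∧
  ∀ p ∈ S.Admissible T,
    ∫ z, (inner ℝ (v z - v₀ z.2) (p.1 z) + frob (S.F (v z)) (p.2 z)) ∂stMeasure T d = 0

end System

/-- A measurable weight `ϰ` on `[0,T]` that is bounded away from `0` and `∞`. -/
def IsWeight (T : ℝ) (ϰ : ℝ → ℝ) : Prop :=
  AEMeasurable ϰ (volume.restrict (Icc 0 T)) ∧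
  ∃ c C : ℝ, 0 < c ∧ ∀ t ∈ Icc 0 T, c ≤ ϰ t ∧ ϰ t ≤ C

/-- `Ϙ(t) = ∫_t^T ϰ(s) ds`. -/
def bigWeight (T : ℝ) (ϰ : ℝ → ℝ) (t : ℝ) : ℝ := ∫ s in t..T, ϰ s

namespace System

variable {d n N : ℕ} (S : System d n N)

/-- The field `a = Ϙ v^#`. -/
def weightedSharp (T : ℝ) (ϰ : ℝ → ℝ) (v : ℝ × Torus d → Vec n) (z : ℝ × Torus d) : Vec n :=
  bigWeight T ϰ z.1 • S.sharp (v z)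

/-- Strong solutions on `[0,T]` with initial datum `v₀`. Here `E = ∂ₜ(Ϙ v^#)`, `W = ∂ₜ(v^#)` and
`G = L*(v^#)`. The function `v^#` is defined up to null sets, and its initial value is its essential
limit in `L¹(Ω)` as `t → 0+`. -/
structure IsStrongSolution (T : ℝ) (ϰ : ℝ → ℝ) (v₀ : Torus d → Vec n)
    (v : ℝ × Torus d → Vec n) : Prop where
  datum : InOrlicz S.K volume v₀
  weak : S.IsWeakSolution T v₀ v
  dt_class : ∃ E : ℝ × Torus d → Vec n, IsWeakDt T (S.weightedSharp T ϰ v) E ∧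
    InOrlicz S.Kstar (stMeasure T d) E
  equation : ∃ (W : ℝ × Torus d → Vec n) (G : ℝ × Torus d → Mat N),
    IsWeakDt T (fun z => S.sharp (v z)) W ∧
    S.IsWeakLstar T (fun z => S.sharp (v z)) G ∧
    (∀ l m, MemLp (fun z => bigWeight T ϰ z.1 * G z l m) ⊤ (stMeasure T d)) ∧
    ∀ᵐ z ∂stMeasure T d, ∀ k,
      W z k + frob (G z) (S.dF k (gradient S.Kstar (S.sharp (v z)))) = 0
  initial : Tendsto (fun t : ℝ => ∫⁻ x, ‖S.sharp (v (t, x)) - S.sharp (v₀ x)‖ₑ)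
    (𝓝[>] 0 ⊓ ae volume) (𝓝 0)

/-- The weighted positivity condition `ϰ I ⪰ -2 Ϙ L*(v^#)` a.e. in `(0,T) × Ω`. -/
def WeightedPositivity (T : ℝ) (ϰ : ℝ → ℝ) (v : ℝ × Torus d → Vec n) : Prop :=
  ∃ G : ℝ × Torus d → Mat N, S.IsWeakLstar T (fun z => S.sharp (v z)) G ∧
    ∀ᵐ z ∂stMeasure T d,
      (ϰ z.1 • (1 : Mat N) - (-(2 * bigWeight T ϰ z.1)) • G z).PosSemidef

/-! ### The optimization problems -/

/-- `∫₀ᵀ [(v - v₀, E) + ½ (M, ϰ I + 2 B)] dt`. -/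
def payoff (T : ℝ) (ϰ : ℝ → ℝ) (v₀ : Torus d → Vec n) (v : ℝ × Torus d → Vec n)
    (M : ℝ × Torus d → Mat N) (E : ℝ × Torus d → Vec n) (B : ℝ × Torus d → Mat N) : ℝ :=
  ∫ z, (inner ℝ (v z - v₀ z.2) (E z) +
    1 / 2 * frob (M z) (ϰ z.1 • (1 : Mat N) + (2 : ℝ) • B z)) ∂stMeasure T d

/-- The space `L_K((0,T) × Ω; ℝⁿ)`. -/
def PrimalClass (T : ℝ) : Set (ℝ × Torus d → Vec n) :=
  {v | InOrlicz S.K (stMeasure T d) v}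

/-- Pairs `(v,M)` in `L_K × L¹` with `F(v) ≤ M` a.e. in the `Λ`-order. -/
def SubClass (T : ℝ) : Set ((ℝ × Torus d → Vec n) × (ℝ × Torus d → Mat N)) :=
  {q | InOrlicz S.K (stMeasure T d) q.1 ∧
    (∀ l m, Integrable (fun z => q.2 z l m) (stMeasure T d)) ∧
    ∀ᵐ z ∂stMeasure T d, S.LamNonneg (q.2 z - S.F (q.1 z))}

/-- The primal optimal value `𝓘(v₀,T)`. -/
def primalValue (T : ℝ) (ϰ : ℝ → ℝ) (v₀ : Torus d → Vec n) : EReal :=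
  ⨅ v ∈ S.PrimalClass T, ⨆ p ∈ S.Admissible T,
    ((payoff T ϰ v₀ v (fun z => S.F (v z)) p.1 p.2 : ℝ) : EReal)

/-- The dual optimal value `𝓙(v₀,T)`. -/
def dualValue (T : ℝ) (ϰ : ℝ → ℝ) (v₀ : Torus d → Vec n) : EReal :=
  ⨆ p ∈ S.Admissible T, ⨅ v ∈ S.PrimalClass T,
    ((payoff T ϰ v₀ v (fun z => S.F (v z)) p.1 p.2 : ℝ) : EReal)

/-- The primal optimal value for subsolutions. -/
def primalSubValue (T : ℝ) (ϰ : ℝ → ℝ) (v₀ : Torus d → Vec n) : EReal :=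
  ⨅ q ∈ S.SubClass T, ⨆ p ∈ S.Admissible T,
    ((payoff T ϰ v₀ q.1 q.2 p.1 p.2 : ℝ) : EReal)

/-- The dual optimal value for subsolutions. -/
def dualSubValue (T : ℝ) (ϰ : ℝ → ℝ) (v₀ : Torus d → Vec n) : EReal :=
  ⨆ p ∈ S.Admissible T, ⨅ q ∈ S.SubClass T,
    ((payoff T ϰ v₀ q.1 q.2 p.1 p.2 : ℝ) : EReal)

/-- The functional `𝓚(E,B) = inf_{F(z) ≤ M} ∫₀ᵀ [(z, E) + ½ (M, ϰ I + 2 B)] dt`. -/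
def kFunctional (T : ℝ) (ϰ : ℝ → ℝ) (E : ℝ × Torus d → Vec n) (B : ℝ × Torus d → Mat N) : EReal :=
  ⨅ q ∈ S.SubClass T, ((payoff T ϰ 0 q.1 q.2 E B : ℝ) : EReal)

/-- The objective `-∫₀ᵀ (v₀, E) dt + 𝓚(E,B)` of the concave maximization problem. -/
def dualObjective (T : ℝ) (ϰ : ℝ → ℝ) (v₀ : Torus d → Vec n)
    (p : (ℝ × Torus d → Vec n) × (ℝ × Torus d → Mat N)) : EReal :=
  ((-∫ z, inner ℝ (v₀ z.2) (p.1 z) ∂stMeasure T d : ℝ) : EReal) + S.kFunctional T ϰ p.1 p.2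

/-- The feasible set of the concave maximization problem: admissible pairs with
`ϰ I + 2 B ⪰ 0` a.e. -/
def Feasible (T : ℝ) (ϰ : ℝ → ℝ) : Set ((ℝ × Torus d → Vec n) × (ℝ × Torus d → Mat N)) :=
  {p | p ∈ S.Admissible T ∧
    ∀ᵐ z ∂stMeasure T d, (ϰ z.1 • (1 : Mat N) + (2 : ℝ) • p.2 z).PosSemidef}

/-- `K₀ = ½ ∫_Ω tr F(v₀) dx`. -/
def K₀ (v₀ : Torus d → Vec n) : ℝ := 1 / 2 * ∫ x, (S.F (v₀ x)).trace

/-- Consistency on `[0,T]` with the weight `ϰ`: all four optimal values equal `Ϙ(0) K₀`; the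
distributions `E₊ = ∂ₜ(Ϙ v^#)` and `B₊ = L*(Ϙ v^#)` are functions, belong to the dual class, and
solve the concave maximization problem, whose maximal value is that of the dual problem; and `v` is
recovered from `E₊`. -/
structure Consistent (T : ℝ) (ϰ : ℝ → ℝ) (v₀ : Torus d → Vec n)
    (v : ℝ × Torus d → Vec n) : Prop where
  primal : S.primalValue T ϰ v₀ = ((bigWeight T ϰ 0 * S.K₀ v₀ : ℝ) : EReal)
  dual : S.dualValue T ϰ v₀ = ((bigWeight T ϰ 0 * S.K₀ v₀ : ℝ) : EReal)
  primalSub : S.primalSubValue T ϰ v₀ = ((bigWeight T ϰ 0 * S.K₀ v₀ : ℝ) : EReal)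
  dualSub : S.dualSubValue T ϰ v₀ = ((bigWeight T ϰ 0 * S.K₀ v₀ : ℝ) : EReal)
  exists_pair : ∃ (E : ℝ × Torus d → Vec n) (B : ℝ × Torus d → Mat N),
    IsWeakDt T (S.weightedSharp T ϰ v) E ∧ S.IsWeakLstar T (S.weightedSharp T ϰ v) B
  pair : ∀ (E : ℝ × Torus d → Vec n) (B : ℝ × Torus d → Mat N),
    IsWeakDt T (S.weightedSharp T ϰ v) E → S.IsWeakLstar T (S.weightedSharp T ϰ v) B →
      S.InDualClass T E B ∧ (E, B) ∈ S.Feasible T ϰ ∧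
      IsMaxOn (S.dualObjective T ϰ v₀) (S.Feasible T ϰ) (E, B) ∧
      S.dualObjective T ϰ v₀ (E, B) = S.dualSubValue T ϰ v₀ ∧
      ∀ᵐ z ∂stMeasure T d,
        v z = gradient S.Kstar ((bigWeight T ϰ z.1)⁻¹ • ∫ s in z.1..T, -E (s, z.2))

end System

end DualConsistency

end

open DualConsistency

noncomputable section

namespace DualConsistency

/-! ### Convex analysis -/

/-! Write `E = ∂ₜ(Ϙ v^#)`, `B = L*(Ϙ v^#)`, `Q = ϰ I + 2 B` and `c = Ϙ(0) K₀`. The four values are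
squeezed. The trivial minimax inequality, together with the choice `M = π_Λ F(v)`, gives `𝓙~ ≤ 𝓙 ≤
𝓘` and `𝓙~ ≤ 𝓘~ ≤ 𝓘`, so that only `𝓘 ≤ c` and `c ≤ 𝓙~` need an argument.

For `𝓘 ≤ c`, insert the solution `v`. The weak formulation removes the admissible pair from the
payoff and leaves `½ ∫ ϰ tr F(v)`, and one has to see that this is `c` (`IsDualPair.payoff_eq`).
This weighted energy balance comes from testing the weak formulation with `(E,B)` itself. There `∫
F(v):B = 0` by conservativity, and `∫ v₀·E = -Ϙ(0) ∫ v₀·v₀^#`. For fixed `x`, the equality case of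
Young's inequality gives `(Ϙ K*(v^#))' = v·E + ϰ K(v)`, whence `∫ (v·E + ϰ K(v)) = -Ϙ(0) ∫
K*(v₀^#)`; together these yield `∫ ϰ K(v) = Ϙ(0) ∫ K(v₀)`. Positivity plays no role here.

For `c ≤ 𝓙~`, insert the pair `(E,B)`. At almost every point `Q` is a nonnegative definite element
of `Λ`, so `y ↦ y·E + ½ F(y):Q` is convex. Its partial derivatives at `y = v` are `E_k + ϰ v^#_k +
B:∂_k F(v)`, which vanish: this is the equation of a strong solution multiplied by `Ϙ`. Hence `v`
minimizes pointwise, and replacing `F(y)` by a larger `M` only increases the value (`objective_le`,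
`IsDualPair.le_payoff`). The same two bounds identify the maximum of the dual problem.

The analytic work lies in three places. First, derivatives in time are weak and there is no trace at
`T`. Since `Ϙ(t)` is comparable to `T - t`, the function `(T-t)⁻¹ Ϙ v^#` is integrable, which forces
`Ϙ v^# = -∫_t^T E` (`IsWeakDt.ae_eq`). This representation yields the constraint with its terminal
condition, the initial value, the calculus along trajectories and, as `∇K*` inverts `∇K`, the
formula for `v`. Second, conservativity is assumed for smooth fields only. It is extended to almost
every time slice by mollification, which commutes with `L*`; Jensen's inequality supplies a
convergent sequence of majorants (`Assumptions.conservative_of_weak`). Third, only the `Λ`-part of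
`F(v)` is controlled by `K(v)`. This suffices because the matrix part of every admissible pair takes
values in `Λ` (`Admissible.ae_mem_Lam`).

For the second assertion, `L*(v^#)` is bounded on `[0,T₁]` because `Ϙ` is bounded below there, and
for the exponential weight `Ϙ ≤ ϰ / γ`; a large `γ` therefore enforces positivity. -/

lemma tangent_le_of_convexOn {V : Type*} [NormedAddCommGroup V] [NormedSpace ℝ V] {f : V → ℝ}
    (hf : ConvexOn ℝ univ f) {f' : V →L[ℝ] ℝ} {x : V} (h : HasFDerivAt f f' x) (y : V) :
    f x + f' (y - x) ≤ f y := by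
  have h1 : ConvexOn ℝ univ fun t : ℝ => f (x + t • (y - x)) := by
    refine ⟨convex_univ, fun s _ t _ a b ha hb hab => ?_⟩
    have := hf.2 (mem_univ (x + s • (y - x))) (mem_univ (x + t • (y - x))) ha hb hab
    convert this using 2
    have hb' : b = 1 - a := by linarith
    subst hb'
    module
  have h2 : HasDerivAt (fun t : ℝ => f (x + t • (y - x))) (f' (y - x)) 0 := by
    have h3 : HasDerivAt (fun t : ℝ => x + t • (y - x)) (y - x) 0 := by
      simpa using ((hasDerivAt_id (0 : ℝ)).smul_const (y - x)).const_add x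
    have h4 : HasFDerivAt f f' (x + (0 : ℝ) • (y - x)) := by simpa using h
    exact h4.comp_hasDerivAt 0 h3
  have h5 := h1.le_slope_of_hasDerivAt (mem_univ 0) (mem_univ 1) zero_lt_one h2
  simp [slope_def_field] at h5
  rw [map_sub]
  linarith

lemma IsYoung.linear_bound {Φ : ℝ → ℝ} (h : IsYoung Φ) (R : ℝ) (hR : 0 ≤ R) :
    ∃ C : ℝ, ∀ s, 0 ≤ s → R * s ≤ Φ s + C := by
  obtain ⟨s₀, hs₀⟩ := (h.lim_top.eventually_ge_atTop R).exists_forall_of_atTop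
  refine ⟨R * max s₀ 1, fun s hs => ?_⟩
  rcases le_total s (max s₀ 1) with h1 | h1
  · have := mul_le_mul_of_nonneg_left h1 hR
    linarith [h.nonneg s]
  · have h2 := hs₀ s ((le_max_left _ _).trans h1)
    have h3 : 0 < s := lt_of_lt_of_le (by positivity) ((le_max_right s₀ 1).trans h1)
    rw [le_div_iff₀ h3] at h2
    have : 0 ≤ R * max s₀ 1 := by positivity
    linarith

section NFunction

variable {n : ℕ} {K : Vec n → ℝ}

lemma IsNFunction.linear_bound (h : IsNFunction K) (R : ℝ) (hR : 0 ≤ R) :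
    ∃ C : ℝ, ∀ y, R * ‖y‖ ≤ K y + C := by
  obtain ⟨Φm, Φp, hm, -, hb⟩ := h.bounds
  obtain ⟨C, hC⟩ := hm.linear_bound R hR
  exact ⟨C, fun y => (hC _ (norm_nonneg y)).trans (by linarith [(hb y).1])⟩

lemma IsNFunction.map_zero (h : IsNFunction K) : K 0 = 0 := by
  obtain ⟨Φm, Φp, -, hp, hb⟩ := h.bounds
  have h1 := (hb 0).2
  rw [norm_zero, (hp.eq_zero_iff 0).2 rfl] at h1
  exact le_antisymm h1 (h.nonneg 0)

lemma IsNFunction.continuous (h : IsNFunction K) : Continuous K :=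
  continuousOn_univ.1 (h.convex.continuousOn isOpen_univ)

/-- Superlinear growth beats the linear term. Without boundedness the real supremum in `legendre`
would be the default value `0`. -/
lemma IsNFunction.bddAbove_legendre (h : IsNFunction K) (y : Vec n) :
    BddAbove (range fun x : Vec n => inner ℝ x y - K x) := by
  obtain ⟨C, hC⟩ := h.linear_bound ‖y‖ (norm_nonneg y)
  refine ⟨C, ?_⟩
  rintro _ ⟨x, rfl⟩
  have := real_inner_le_norm x y
  have := hC x
  dsimp only
  nlinarith

lemma IsNFunction.young (h : IsNFunction K) (x y : Vec n) :
    inner ℝ x y ≤ K x + legendre K y := by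
  have := le_ciSup (h.bddAbove_legendre y) x
  change _ ≤ legendre K y at this
  linarith

lemma IsNFunction.abs_inner_le (h : IsNFunction K) (x y : Vec n) :
    |inner ℝ x y| ≤ K x + legendre K y := by
  refine abs_le.2 ⟨?_, h.young x y⟩
  have := h.young (-x) y
  rw [h.even, inner_neg_left] at this
  linarith

lemma IsNFunction.legendre_nonneg (h : IsNFunction K) (y : Vec n) : 0 ≤ legendre K y := by
  have := h.young 0 y
  simpa [h.map_zero] using this

lemma IsNFunction.legendre_zero (h : IsNFunction K) : legendre K 0 = 0 := by
  refine le_antisymm (ciSup_le fun x => ?_) (h.legendre_nonneg 0)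
  simpa using h.nonneg x

lemma IsNFunction.legendre_even (h : IsNFunction K) (y : Vec n) :
    legendre K (-y) = legendre K y := by
  have key : ∀ y, legendre K (-y) ≤ legendre K y := fun y => ciSup_le fun x => by
    have := h.young (-x) y
    rw [h.even, inner_neg_left] at this
    rw [inner_neg_right]
    linarith
  refine le_antisymm (key y) ?_
  simpa using key (-y)

lemma IsNFunction.legendre_convex (h : IsNFunction K) : ConvexOn ℝ univ (legendre K) := by
  refine ⟨convex_univ, fun y _ z _ a b ha hb hab => ciSup_le fun x => ?_⟩
  have h1 := mul_le_mul_of_nonneg_left (h.young x y) ha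
  have h2 := mul_le_mul_of_nonneg_left (h.young x z) hb
  simp only [inner_add_right, inner_smul_right, smul_eq_mul]
  have : K x = a * K x + b * K x := by rw [← add_mul, hab, one_mul]
  linarith

lemma IsNFunction.legendre_continuous (h : IsNFunction K) : Continuous (legendre K) :=
  continuousOn_univ.1 (h.legendre_convex.continuousOn isOpen_univ)

lemma IsNFunction.legendre_linear_bound (h : IsNFunction K) (R : ℝ) (hR : 0 ≤ R) :
    ∃ C : ℝ, ∀ y, R * ‖y‖ ≤ legendre K y + C := by
  obtain ⟨C, hC⟩ := ((isCompact_closedBall (0 : Vec n) R).image h.continuous).bddAbove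
  refine ⟨C, fun y => ?_⟩
  by_cases hy : y = 0
  · have := hC ⟨0, by simpa using hR, rfl⟩
    simp only [hy, norm_zero, mul_zero, h.legendre_zero, zero_add]
    linarith [h.map_zero]
  have hy' : ‖y‖ ≠ 0 := norm_ne_zero_iff.2 hy
  -- The point of norm `R` in the direction of `y` turns the pairing into `R ‖y‖`, and `K` is
  -- bounded on the ball of radius `R`.
  have h1 := h.young ((R * ‖y‖⁻¹) • y) y
  have h2 : K ((R * ‖y‖⁻¹) • y) ≤ C := by
    refine hC ⟨_, ?_, rfl⟩
    rw [mem_closedBall_zero_iff, norm_smul, norm_mul, norm_inv, norm_norm, mul_assoc,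
      inv_mul_cancel₀ hy', mul_one, Real.norm_of_nonneg hR]
  rw [inner_smul_left, real_inner_self_eq_norm_sq] at h1
  have h3 : (R * ‖y‖⁻¹) * ‖y‖ ^ 2 = R * ‖y‖ := by field_simp
  simp only [conj_trivial] at h1
  linarith

lemma inner_gradient {f : Vec n → ℝ} {x : Vec n} (h : Vec n) :
    inner ℝ (gradient f x) h = fderiv ℝ f x h := by
  simp [gradient]

lemma tangent_le_gradient (hc : ConvexOn ℝ univ K) (hd : Differentiable ℝ K) (x y : Vec n) :
    K x + inner ℝ (gradient K x) (y - x) ≤ K y := by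
  rw [inner_gradient]
  exact tangent_le_of_convexOn hc (hd x).hasFDerivAt y

/-- The equality case of Young's inequality: the tangent inequality at `x` says that `x` attains the
supremum. -/
lemma IsNFunction.legendre_gradient (h : IsNFunction K) (hd : Differentiable ℝ K) (x : Vec n) :
    legendre K (gradient K x) = inner ℝ x (gradient K x) - K x := by
  refine le_antisymm (ciSup_le fun z => ?_) (by linarith [h.young x (gradient K x)])
  have := tangent_le_gradient h.convex hd x z
  rw [inner_sub_right] at this
  rw [real_inner_comm _ z, real_inner_comm _ x]
  linarith

/-- Quantitative strict convexity away from a point. -/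
lemma IsNFunction.exists_strict_gap (h : IsNFunction K) (hd : Differentiable ℝ K)
    (hs : StrictConvexOn ℝ univ K) (x : Vec n) {ε : ℝ} (hε : 0 < ε) :
    ∃ δ > 0, ∀ z, ε ≤ ‖z - x‖ →
      K x + inner ℝ (gradient K x) (z - x) + δ * ‖z - x‖ ≤ K z := by
  -- The Bregman distance from `x`. It is positive off `x`, so it has a positive minimum on the
  -- sphere of radius `ε`, and convexity carries this bound outwards with linear growth.
  set g : Vec n → ℝ := fun z => K z - K x - inner ℝ (gradient K x) (z - x) with hg
  have hgc : Continuous g := by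
    have := h.continuous
    fun_prop
  have hpos : ∀ z ≠ x, 0 < g z := by
    intro z hz
    have h1 := hs.2 (mem_univ x) (mem_univ z) hz.symm (by norm_num : (0 : ℝ) < 1 / 2)
      (by norm_num : (0 : ℝ) < 1 / 2) (by norm_num)
    have h2 := tangent_le_gradient h.convex hd x ((1 / 2 : ℝ) • x + (1 / 2 : ℝ) • z)
    have h3 : (1 / 2 : ℝ) • x + (1 / 2 : ℝ) • z - x = (1 / 2 : ℝ) • (z - x) := by module
    rw [h3, inner_smul_right] at h2
    simp only [smul_eq_mul] at h1
    simp only [hg]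
    linarith
  -- The empty sphere occurs only in dimension `0`, where no `z` lies at distance `ε` or more
  -- either.
  rcases (Metric.sphere x ε).eq_empty_or_nonempty with he | hne
  · refine ⟨1, one_pos, fun z hz => ?_⟩
    exfalso
    have h0 : ‖z - x‖ ≠ 0 := by linarith
    have : x + (ε * ‖z - x‖⁻¹) • (z - x) ∈ Metric.sphere x ε := by
      rw [mem_sphere_iff_norm, add_sub_cancel_left, norm_smul, norm_mul, norm_inv, norm_norm,
        mul_assoc, inv_mul_cancel₀ h0, mul_one, Real.norm_of_nonneg hε.le]
    rw [he] at this
    exact this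
  obtain ⟨z₀, hz₀, hmin⟩ := (isCompact_sphere x ε).exists_isMinOn hne hgc.continuousOn
  have hz₀' : z₀ ≠ x := by
    rintro rfl
    simp at hz₀
    exact hε.ne hz₀
  refine ⟨g z₀ / ε, div_pos (hpos _ hz₀') hε, fun z hz => ?_⟩
  have h0 : 0 < ‖z - x‖ := by linarith
  set r : ℝ := ε * ‖z - x‖⁻¹ with hr
  have hr0 : 0 < r := by positivity
  have hr1 : r ≤ 1 := by
    rw [hr, ← div_eq_mul_inv, div_le_one h0]; exact hz
  have hmem : x + r • (z - x) ∈ Metric.sphere x ε := by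
    rw [mem_sphere_iff_norm, add_sub_cancel_left, norm_smul, hr, norm_mul, norm_inv, norm_norm,
        mul_assoc, inv_mul_cancel₀ h0.ne', mul_one, Real.norm_of_nonneg hε.le]
  have h1 : g z₀ ≤ g (x + r • (z - x)) := hmin hmem
  have h2 : g (x + r • (z - x)) ≤ r * g z := by
    have h3 := h.convex.2 (mem_univ x) (mem_univ z) (by linarith : 0 ≤ 1 - r) hr0.le (by ring)
    have h4 : (1 - r) • x + r • z = x + r • (z - x) := by module
    rw [h4] at h3
    simp only [smul_eq_mul] at h3
    simp only [hg, add_sub_cancel_left, inner_smul_right]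
    linarith
  have h5 : g z₀ / ε * ‖z - x‖ ≤ g z := by
    have h6 : g z₀ ≤ r * g z := h1.trans h2
    calc g z₀ / ε * ‖z - x‖ ≤ (r * g z) / ε * ‖z - x‖ := by gcongr
      _ = g z := by rw [hr]; field_simp
  simp only [hg] at h5 ⊢
  linarith

/-- For `y` within `δ` of `∇K(x)`, competitors `z` with `‖z - x‖ ≥ ε` lose to `x` by the strict gap,
while the others improve on the affine approximation by at most `ε ‖y - ∇K(x)‖`. Strict convexity of
`K` thus gives differentiability of `K*` directly. -/
lemma IsNFunction.hasGradientAt_legendre (h : IsNFunction K) (hd : Differentiable ℝ K)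
    (hs : StrictConvexOn ℝ univ K) (x : Vec n) :
    HasGradientAt (legendre K) x (gradient K x) := by
  rw [hasGradientAt_iff_isLittleO, Asymptotics.isLittleO_iff]
  intro ε hε
  obtain ⟨δ, hδ, hgap⟩ := h.exists_strict_gap hd hs x hε
  filter_upwards [Metric.ball_mem_nhds _ hδ] with y hy
  rw [mem_ball_iff_norm] at hy
  have h0 := h.legendre_gradient hd x
  have hlow : 0 ≤ legendre K y - legendre K (gradient K x) - inner ℝ x (y - gradient K x) := by
    have := h.young x y
    rw [inner_sub_right]
    linarith
  rw [Real.norm_of_nonneg hlow]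
  suffices legendre K y ≤ legendre K (gradient K x) + inner ℝ x (y - gradient K x) +
      ε * ‖y - gradient K x‖ by linarith
  refine ciSup_le fun z => ?_
  have hid : inner ℝ z y - K z = (legendre K (gradient K x) + inner ℝ x (y - gradient K x)) +
      (inner ℝ (z - x) (y - gradient K x) -
        (K z - K x - inner ℝ (gradient K x) (z - x))) := by
    rw [h0, real_inner_comm _ (gradient K x)]
    simp only [inner_sub_left, inner_sub_right]
    ring
  rw [hid]
  have hcs := real_inner_le_norm (z - x) (y - gradient K x)
  have := norm_nonneg (y - gradient K x)
  have := norm_nonneg (z - x)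
  rcases le_total ε ‖z - x‖ with h1 | h1
  · have h2 := hgap z h1
    nlinarith
  · have h2 := tangent_le_gradient h.convex hd x z
    nlinarith

lemma IsNFunction.gradient_legendre_gradient (h : IsNFunction K) (hd : Differentiable ℝ K)
    (hs : StrictConvexOn ℝ univ K) (x : Vec n) : gradient (legendre K) (gradient K x) = x :=
  (h.hasGradientAt_legendre hd hs x).gradient

/-- The function `K - (·, y)` is coercive by superlinear growth, and `∇K = y` at its minimum. -/
lemma IsNFunction.exists_gradient_eq (h : IsNFunction K) (hd : Differentiable ℝ K)
    (y : Vec n) : ∃ x, gradient K x = y := by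
  have hc : Continuous fun x => K x - inner ℝ x y := by
    have := h.continuous
    fun_prop
  obtain ⟨C, hC⟩ := h.linear_bound (‖y‖ + 1) (by positivity)
  have ht : Tendsto (fun x => K x - inner ℝ x y) (cocompact (Vec n)) atTop := by
    refine tendsto_atTop_mono (f := fun x => ‖x‖ + (-C)) (fun x => ?_)
      (tendsto_atTop_add_const_right _ _ tendsto_norm_cocompact_atTop)
    have := real_inner_le_norm x y
    have := hC x
    nlinarith
  obtain ⟨x, hx⟩ := hc.exists_forall_le ht
  refine ⟨x, ?_⟩
  have hmin : IsLocalMin (fun x => K x - inner ℝ x y) x := Eventually.of_forall hx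
  have h1 : HasFDerivAt (fun x => K x - inner ℝ x y) (fderiv ℝ K x - innerSL ℝ y) x := by
    refine (hd x).hasFDerivAt.sub ?_
    have h3 : (fun x => inner ℝ x y) = innerSL ℝ y := by
      ext z
      exact real_inner_comm _ _
    rw [h3]
    exact (innerSL ℝ y).hasFDerivAt
  have h2 := hmin.hasFDerivAt_eq_zero h1
  refine ext_inner_right ℝ fun z => ?_
  rw [inner_gradient]
  have := congrArg (fun l => l z) h2
  simp at this
  linarith

/-- Every dual point is a gradient, so continuity concerns the inverse of `∇K`. Adding the strict
gap at `x` to the tangent inequality at `x'` shows that points at distance `ε` have gradients at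
distance at least `δ`. -/
lemma IsNFunction.continuous_gradient_legendre (h : IsNFunction K) (hd : Differentiable ℝ K)
    (hs : StrictConvexOn ℝ univ K) : Continuous (gradient (legendre K)) := by
  rw [continuous_iff_continuousAt]
  intro y
  rw [Metric.continuousAt_iff]
  intro ε hε
  obtain ⟨x, rfl⟩ := h.exists_gradient_eq hd y
  obtain ⟨δ, hδ, hgap⟩ := h.exists_strict_gap hd hs x hε
  refine ⟨δ, hδ, fun {y'} hy' => ?_⟩
  obtain ⟨x', rfl⟩ := h.exists_gradient_eq hd y'
  rw [h.gradient_legendre_gradient hd hs, h.gradient_legendre_gradient hd hs, dist_eq_norm]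
  rw [dist_eq_norm] at hy'
  by_contra! hcon
  have h1 := hgap x' hcon
  have h2 := tangent_le_gradient h.convex hd x' x
  have h3 : inner ℝ (gradient K x') (x - x') + inner ℝ (gradient K x) (x' - x) =
      - inner ℝ (gradient K x' - gradient K x) (x' - x) := by
    simp only [inner_sub_left, inner_sub_right]; ring
  have h4 := real_inner_le_norm (gradient K x' - gradient K x) (x' - x)
  nlinarith

/-- The tangent at `x` evaluated at `2x` bounds `x · ∇K(x)` by `K(2x) - K(x)`, where the doubling
condition applies. -/
lemma IsNFunction.exists_legendre_gradient_le (h : IsNFunction K) (hd : Differentiable ℝ K)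
    (h2 : Delta2 K) : ∃ C, ∀ x, legendre K (gradient K x) ≤ C * (K x + 1) := by
  obtain ⟨C, hC⟩ := h2
  refine ⟨C, fun x => ?_⟩
  have h1 := tangent_le_gradient h.convex hd x ((2 : ℝ) • x)
  have h3 : (2 : ℝ) • x - x = x := by module
  rw [h3] at h1
  rw [h.legendre_gradient hd, real_inner_comm]
  linarith [hC x, h.nonneg x]

/-- With `y = ∇K(x)`, Young's inequality for `x` and `2y` together with `x · y ≥ K(x)` gives `K(x) ≤
K*(2y)`. -/
lemma IsNFunction.exists_le_legendre (h : IsNFunction K) (hd : Differentiable ℝ K)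
    (hs : StrictConvexOn ℝ univ K) (h2 : Delta2 (legendre K)) :
    ∃ C, ∀ y, K (gradient (legendre K) y) ≤ C * (legendre K y + 1) := by
  obtain ⟨C, hC⟩ := h2
  refine ⟨C, fun y => ?_⟩
  obtain ⟨x, rfl⟩ := h.exists_gradient_eq hd y
  rw [h.gradient_legendre_gradient hd hs]
  refine le_trans ?_ (hC _)
  have h1 := h.young x ((2 : ℝ) • gradient K x)
  have h3 := h.legendre_nonneg (gradient K x)
  rw [h.legendre_gradient hd] at h3
  rw [inner_smul_right] at h1
  linarith

end NFunction

/-! ### Doubling and bounded linear combinations -/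

section Delta2

variable {n : ℕ} {f : Vec n → ℝ}

lemma Delta2.exists_smul_le (hc : ConvexOn ℝ univ f) (h0 : ∀ y, 0 ≤ f y)
    (he : ∀ y, f (-y) = f y) (h2 : Delta2 f) (R : ℝ) :
    ∃ C, 0 ≤ C ∧ ∀ r : ℝ, |r| ≤ R → ∀ y, f (r • y) ≤ C * (f y + 1) := by
  have hpow : ∀ m : ℕ, ∃ C, 0 ≤ C ∧ ∀ y, f ((2 : ℝ) ^ m • y) ≤ C * (f y + 1) := by
    intro m
    induction m with
    | zero => exact ⟨1, zero_le_one, fun y => by simp⟩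
    | succ m ih =>
      obtain ⟨C, hC0, hC⟩ := ih
      obtain ⟨D, hD⟩ := h2
      have hD0 : 0 ≤ D := by
        have := (h0 _).trans (hD 0)
        exact nonneg_of_mul_nonneg_left this (by linarith [h0 0])
      refine ⟨D * (C + 1), by positivity, fun y => ?_⟩
      have h1 := hD ((2 : ℝ) ^ m • y)
      rw [smul_smul, ← pow_succ'] at h1
      refine h1.trans ?_
      rw [mul_assoc]
      gcongr
      nlinarith [hC y, h0 y]
  obtain ⟨m, hm⟩ := pow_unbounded_of_one_lt R (one_lt_two : (1 : ℝ) < 2)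
  obtain ⟨C, hC0, hC⟩ := hpow m
  refine ⟨C, hC0, fun r hr y => le_trans ?_ (hC y)⟩
  -- With `|s| ≤ 1` the point `r y` is a convex combination of `±2^m y`, at which the even function
  -- `f` has the same value.
  set s : ℝ := r / 2 ^ m with hs
  have hp : (0 : ℝ) < 2 ^ m := by positivity
  have hs1 : |s| ≤ 1 := by
    rw [hs, abs_div, abs_of_pos hp, div_le_one hp]; linarith
  have hsr : r • y = ((1 + s) / 2) • ((2 : ℝ) ^ m • y) + ((1 - s) / 2) • -((2 : ℝ) ^ m • y) := by
    have : r = s * 2 ^ m := by rw [hs]; field_simp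
    rw [this]; module
  have h1 := hc.2 (mem_univ ((2 : ℝ) ^ m • y)) (mem_univ (-((2 : ℝ) ^ m • y)))
    (by linarith [(abs_le.1 hs1).1] : 0 ≤ (1 + s) / 2)
    (by linarith [(abs_le.1 hs1).2] : 0 ≤ (1 - s) / 2) (by ring)
  rw [← hsr, he] at h1
  simp only [smul_eq_mul] at h1
  linarith

lemma Delta2.exists_lincomb_le (hc : ConvexOn ℝ univ f) (h0 : ∀ y, 0 ≤ f y)
    (he : ∀ y, f (-y) = f y) (h2 : Delta2 f) (R : ℝ) :
    ∃ C, 0 ≤ C ∧ ∀ r s : ℝ, |r| ≤ R → |s| ≤ R → ∀ y z,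
      f (r • y + s • z) ≤ C * (f y + f z + 1) := by
  obtain ⟨C, hC0, hC⟩ := Delta2.exists_smul_le hc h0 he h2 (2 * R)
  refine ⟨C, hC0, fun r s hr hs y z => ?_⟩
  have h1 := hc.2 (mem_univ ((2 * r) • y)) (mem_univ ((2 * s) • z))
    (by norm_num : (0 : ℝ) ≤ 1 / 2) (by norm_num : (0 : ℝ) ≤ 1 / 2) (by norm_num)
  have h3 : (1 / 2 : ℝ) • ((2 * r) • y) + (1 / 2 : ℝ) • ((2 * s) • z) = r • y + s • z := by module
  rw [h3] at h1
  have h4 := hC (2 * r) (by rw [abs_mul]; simpa using hr) y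
  have h5 := hC (2 * s) (by rw [abs_mul]; simpa using hs) z
  simp only [smul_eq_mul] at h1
  nlinarith [h0 y, h0 z]

end Delta2


/-! ### Calculus on the torus -/

section TorusCalculus

variable {d : ℕ}

lemma toTorus_add (y z : Fin d → ℝ) : toTorus (y + z) = toTorus y + toTorus z := by
  ext i; simp [toTorus]

lemma toTorus_neg (y : Fin d → ℝ) : toTorus (-y) = -toTorus y := by
  ext i; simp [toTorus]

/-- Smoothness is defined on the cover; this brings continuity down to the torus. -/
lemma isOpenQuotientMap_toTorus : IsOpenQuotientMap (toTorus : (Fin d → ℝ) → Torus d) :=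
  IsOpenQuotientMap.piMap fun _ => QuotientAddGroup.isOpenQuotientMap_mk

lemma exists_toTorus (x : Torus d) : ∃ y, toTorus y = x :=
  isOpenQuotientMap_toTorus.surjective x

section

variable {V : Type*} [NormedAddCommGroup V] [NormedSpace ℝ V]

lemma SmoothX.continuous {g : Torus d → V} (hg : SmoothX g) : Continuous g :=
  isOpenQuotientMap_toTorus.isQuotientMap.continuous_iff.2 (ContDiff.continuous hg)

lemma SmoothTX.continuous {φ : ℝ × Torus d → V} (hφ : SmoothTX φ) : Continuous φ :=
  ((IsOpenQuotientMap.id (X := ℝ)).prodMap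
    isOpenQuotientMap_toTorus).isQuotientMap.continuous_iff.2 (ContDiff.continuous hφ)

lemma SmoothTX.slice {φ : ℝ × Torus d → V} (hφ : SmoothTX φ) (t : ℝ) :
    SmoothX fun x => φ (t, x) :=
  ContDiff.comp (g := fun p : ℝ × (Fin d → ℝ) => φ (p.1, toTorus p.2)) hφ
    (contDiff_const.prodMk contDiff_id)

lemma SmoothTX.contDiff_time {φ : ℝ × Torus d → V} (hφ : SmoothTX φ) (x : Torus d) :
    ContDiff ℝ ∞ fun t => φ (t, x) := by
  obtain ⟨y, rfl⟩ := exists_toTorus x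
  exact ContDiff.comp (g := fun p : ℝ × (Fin d → ℝ) => φ (p.1, toTorus p.2)) hφ
    (contDiff_id.prodMk contDiff_const)

lemma SmoothX.smoothTX {g : Torus d → V} (hg : SmoothX g) : SmoothTX fun z => g z.2 :=
  ContDiff.comp (g := fun y : Fin d → ℝ => g (toTorus y)) hg contDiff_snd

lemma smoothTX_time {η : ℝ → V} (hη : ContDiff ℝ ∞ η) :
    SmoothTX fun z : ℝ × Torus d => η z.1 :=
  ContDiff.comp (g := η) hη contDiff_fst

lemma SmoothTX.smul {η : ℝ × Torus d → ℝ} {φ : ℝ × Torus d → V} (hη : SmoothTX η)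
    (hφ : SmoothTX φ) : SmoothTX fun z => η z • φ z :=
  ContDiff.smul (f := fun p : ℝ × (Fin d → ℝ) => η (p.1, toTorus p.2)) hη hφ

lemma SmoothTX.mul {η φ : ℝ × Torus d → ℝ} (hη : SmoothTX η)
    (hφ : SmoothTX φ) : SmoothTX fun z => η z * φ z := hη.smul hφ

lemma SmoothTX.sum {ι : Type*} {s : Finset ι} {φ : ι → ℝ × Torus d → V}
    (h : ∀ k ∈ s, SmoothTX (φ k)) : SmoothTX fun z => ∑ k ∈ s, φ k z :=
  ContDiff.sum (f := fun k (p : ℝ × (Fin d → ℝ)) => φ k (p.1, toTorus p.2)) h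

lemma SmoothX.mul {f g : Torus d → ℝ} (hf : SmoothX f) (hg : SmoothX g) :
    SmoothX fun x => f x * g x :=
  ContDiff.mul (f := fun y : Fin d → ℝ => f (toTorus y)) hf hg

lemma SmoothX.add {f g : Torus d → V} (hf : SmoothX f) (hg : SmoothX g) :
    SmoothX fun x => f x + g x :=
  ContDiff.add (f := fun y : Fin d → ℝ => f (toTorus y)) hf hg

lemma SmoothX.const_mul {g : Torus d → ℝ} (c : ℝ) (hg : SmoothX g) :
    SmoothX fun x => c * g x :=
  ContDiff.mul (f := fun _ : Fin d → ℝ => c) contDiff_const hg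

lemma smoothX_const (c : V) : SmoothX fun _ : Torus d => c :=
  contDiff_const (c := c)

lemma SmoothX.sum {ι : Type*} {s : Finset ι} {f : ι → Torus d → V}
    (h : ∀ k ∈ s, SmoothX (f k)) : SmoothX fun x => ∑ k ∈ s, f k x :=
  ContDiff.sum (f := fun k (y : Fin d → ℝ) => f k (toTorus y)) h

lemma SmoothX.comp_neg {g : Torus d → V} (hg : SmoothX g) : SmoothX fun x => g (-x) := by
  have : ContDiff ℝ ∞ fun y : Fin d → ℝ => g (toTorus (-y)) :=
    ContDiff.comp (g := fun y : Fin d → ℝ => g (toTorus y)) hg contDiff_neg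
  simp only [toTorus_neg] at this
  exact this

lemma smoothTX_vec_iff {n : ℕ} {φ : ℝ × Torus d → Vec n} :
    SmoothTX φ ↔ ∀ i, SmoothTX fun z => φ z i :=
  contDiff_euclidean

lemma smoothX_vec_iff {n : ℕ} {φ : Torus d → Vec n} :
    SmoothX φ ↔ ∀ i, SmoothX fun z => φ z i :=
  contDiff_euclidean

lemma SmoothTX.hasDerivAt {φ : ℝ × Torus d → V} (hφ : SmoothTX φ) (y : Fin d → ℝ) (t : ℝ) :
    HasDerivAt (fun s => φ (s, toTorus y))
      (fderiv ℝ (fun p : ℝ × (Fin d → ℝ) => φ (p.1, toTorus p.2)) (t, y) (1, 0)) t := by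
  have h1 : HasFDerivAt (fun p : ℝ × (Fin d → ℝ) => φ (p.1, toTorus p.2))
      (fderiv ℝ (fun p : ℝ × (Fin d → ℝ) => φ (p.1, toTorus p.2)) (t, y)) (t, y) :=
    (ContDiff.differentiable hφ (by simp) _).hasFDerivAt
  have h2 : HasDerivAt (fun s : ℝ => (s, y)) ((1 : ℝ), (0 : Fin d → ℝ)) t :=
    (hasDerivAt_id t).prodMk (hasDerivAt_const t y)
  exact h1.comp_hasDerivAt t h2

lemma SmoothTX.deriv_time {φ : ℝ × Torus d → V} (hφ : SmoothTX φ) :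
    SmoothTX fun z => deriv (fun s => φ (s, z.2)) z.1 := by
  have h1 : (fun p : ℝ × (Fin d → ℝ) => deriv (fun s => φ (s, toTorus p.2)) p.1) =
      fun p => fderiv ℝ (fun p : ℝ × (Fin d → ℝ) => φ (p.1, toTorus p.2)) p (1, 0) := by
    ext p
    exact (hφ.hasDerivAt p.2 p.1).deriv
  unfold SmoothTX
  rw [h1]
  exact ((ContDiff.fderiv_right (m := ∞) hφ (by simp)).clm_apply contDiff_const)

end

lemma torusPartial_toTorus {g : Torus d → ℝ} (hg : SmoothX g) (i : Fin d) (y : Fin d → ℝ) :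
    torusPartial i g (toTorus y) = fderiv ℝ (fun y => g (toTorus y)) y (Pi.single i 1) := by
  have h1 : HasFDerivAt (fun y => g (toTorus y)) (fderiv ℝ (fun y => g (toTorus y)) y)
      (y + (0 : ℝ) • Pi.single i 1) := by
    simpa using (ContDiff.differentiable hg (by simp) y).hasFDerivAt
  have h2 : HasDerivAt (fun h : ℝ => y + h • (Pi.single i 1 : Fin d → ℝ)) (Pi.single i 1) 0 := by
    simpa using ((hasDerivAt_id (0 : ℝ)).smul_const (Pi.single i 1 : Fin d → ℝ)).const_add y
  have h3 := (h1.comp_hasDerivAt 0 h2).deriv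
  rw [← h3]
  unfold torusPartial
  congr 1
  ext h
  simp only [Function.comp, toTorus_add]
  congr 3
  ext j
  simp only [Pi.single_apply, Pi.smul_apply, smul_eq_mul]
  split_ifs <;> simp

lemma SmoothTX.torusPartial_eq {φ : ℝ × Torus d → ℝ} (hφ : SmoothTX φ) (i : Fin d)
    (p : ℝ × (Fin d → ℝ)) :
    torusPartial i (fun x => φ (p.1, x)) (toTorus p.2) =
      fderiv ℝ (fun p : ℝ × (Fin d → ℝ) => φ (p.1, toTorus p.2)) p (0, Pi.single i 1) := by
  rw [torusPartial_toTorus (hφ.slice p.1)]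
  have h1 : HasFDerivAt (fun p : ℝ × (Fin d → ℝ) => φ (p.1, toTorus p.2))
      (fderiv ℝ (fun p : ℝ × (Fin d → ℝ) => φ (p.1, toTorus p.2)) p) (p.1, p.2) :=
    (ContDiff.differentiable hφ (by simp) _).hasFDerivAt
  have h2 : HasFDerivAt (fun y : Fin d → ℝ => (p.1, y))
      (ContinuousLinearMap.inr ℝ ℝ (Fin d → ℝ)) p.2 := hasFDerivAt_prodMk_right _ _
  have h3 := (h1.comp p.2 h2).fderiv
  change (fderiv ℝ ((fun p : ℝ × (Fin d → ℝ) => φ (p.1, toTorus p.2)) ∘ fun y => (p.1, y)) p.2) _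
    = _
  rw [h3]
  simp

/-- Translation-invariant differential operators of parity `k` on the torus. -/
structure IsDiffOp (k : ℕ) (D : (Torus d → ℝ) → Torus d → ℝ) : Prop where
  smooth : ∀ φ : ℝ × Torus d → ℝ, SmoothTX φ →
    SmoothTX fun z : ℝ × Torus d => D (fun x => φ (z.1, x)) z.2
  deriv_comm : ∀ φ : ℝ × Torus d → ℝ, SmoothTX φ → ∀ z : ℝ × Torus d,
    deriv (fun s => D (fun x => φ (s, x)) z.2) z.1 =
      D (fun x => deriv (fun s => φ (s, x)) z.1) z.2
  const_mul : ∀ (c : ℝ) (g : Torus d → ℝ), D (fun x => c * g x) = fun x => c * D g x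
  add : ∀ f g : Torus d → ℝ, SmoothX f → SmoothX g →
    D (fun x => f x + g x) = fun x => D f x + D g x
  sub_const : ∀ (g : Torus d → ℝ) (y : Torus d), D (fun x => g (x - y)) = fun x => D g (x - y)
  neg : ∀ g : Torus d → ℝ, D (fun x => g (-x)) = fun x => (-1) ^ k * D g (-x)

lemma IsDiffOp.smoothX {k : ℕ} {D : (Torus d → ℝ) → Torus d → ℝ} (hD : IsDiffOp k D)
    {g : Torus d → ℝ} (hg : SmoothX g) : SmoothX (D g) :=
  (hD.smooth _ hg.smoothTX).slice 0

lemma isDiffOp_id : IsDiffOp 0 (fun g : Torus d → ℝ => g) where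
  smooth _ h := h
  deriv_comm _ _ _ := rfl
  const_mul _ _ := rfl
  add _ _ _ _ := rfl
  sub_const _ _ := rfl
  neg g := by simp

lemma IsDiffOp.comp {k l : ℕ} {D D' : (Torus d → ℝ) → Torus d → ℝ} (hD : IsDiffOp k D)
    (hD' : IsDiffOp l D') : IsDiffOp (k + l) fun g => D (D' g) where
  smooth φ hφ := hD.smooth _ (hD'.smooth φ hφ)
  deriv_comm φ hφ z := by
    rw [hD.deriv_comm (fun z : ℝ × Torus d => D' (fun x => φ (z.1, x)) z.2) (hD'.smooth φ hφ) z]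
    congr 1
    ext x
    exact hD'.deriv_comm φ hφ (z.1, x)
  const_mul c g := by
    rw [hD'.const_mul, hD.const_mul]
  add f g hf hg := by
    rw [hD'.add f g hf hg, hD.add _ _ (hD'.smoothX hf) (hD'.smoothX hg)]
  sub_const g y := by
    rw [hD'.sub_const, hD.sub_const (D' g)]
  neg g := by
    rw [hD'.neg, hD.const_mul, hD.neg (D' g)]
    ext x
    ring

lemma fderiv_fderiv_comm {V : Type*} [NormedAddCommGroup V] [NormedSpace ℝ V] {f : V → ℝ}
    (hf : ContDiff ℝ ∞ f) (x v w : V) :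
    fderiv ℝ (fun p => fderiv ℝ f p v) x w = fderiv ℝ (fderiv ℝ f) x w v ∧
      fderiv ℝ (fderiv ℝ f) x w v = fderiv ℝ (fderiv ℝ f) x v w := by
  have hd : Differentiable ℝ (fderiv ℝ f) :=
    (ContDiff.fderiv_right (m := ∞) hf (by simp)).differentiable (by simp)
  refine ⟨?_, ?_⟩
  · rw [((hd x).hasFDerivAt.clm_apply (hasFDerivAt_const v x)).fderiv]
    simp
  · exact (hf.contDiffAt.isSymmSndFDerivAt
      (by simpa using (WithTop.coe_le_coe.2 le_top : ((2 : ℕ∞) : WithTop ℕ∞) ≤ ∞))) w v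

lemma SmoothTX.deriv_torusPartial_comm {φ : ℝ × Torus d → ℝ} (hφ : SmoothTX φ) (i : Fin d)
    (t : ℝ) (y : Fin d → ℝ) :
    deriv (fun s => torusPartial i (fun x => φ (s, x)) (toTorus y)) t =
      torusPartial i (fun x => deriv (fun s => φ (s, x)) t) (toTorus y) := by
  set f : ℝ × (Fin d → ℝ) → ℝ := fun p => φ (p.1, toTorus p.2) with hf
  have hf' : ContDiff ℝ ∞ f := hφ
  have h0 := hφ.deriv_time.torusPartial_eq i (t, y)
  dsimp only at h0
  rw [h0]
  have h1 : (fun p : ℝ × (Fin d → ℝ) => deriv (fun s => φ (s, toTorus p.2)) p.1) =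
      fun p => fderiv ℝ f p (1, 0) := by
    ext p
    exact (hφ.hasDerivAt p.2 p.1).deriv
  have h2 : (fun s => torusPartial i (fun x => φ (s, x)) (toTorus y)) =
      fun s => fderiv ℝ f (s, y) (0, Pi.single i 1) := by
    ext s
    exact hφ.torusPartial_eq i (s, y)
  rw [h1, h2]
  have h6 : DifferentiableAt ℝ (fun p => fderiv ℝ f p (0, Pi.single i 1)) (t, y) :=
    ((ContDiff.fderiv_right (m := ∞) hf' (by simp)).clm_apply
      contDiff_const).differentiable (by simp) _
  have h3 : HasDerivAt (fun s : ℝ => (s, y)) ((1 : ℝ), (0 : Fin d → ℝ)) t :=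
    (hasDerivAt_id t).prodMk (hasDerivAt_const t y)
  have h4 := h6.hasFDerivAt.comp_hasDerivAt t h3
  have h5 := h4.deriv
  simp only [Function.comp_def] at h5
  rw [h5, (fderiv_fderiv_comm hf' _ _ _).1, (fderiv_fderiv_comm hf' _ _ _).1]
  exact (fderiv_fderiv_comm hf' _ _ _).2

lemma isDiffOp_torusPartial (i : Fin d) : IsDiffOp 1 (torusPartial i) where
  smooth φ hφ := by
    unfold SmoothTX
    simp only [hφ.torusPartial_eq]
    exact ((ContDiff.fderiv_right (m := ∞) hφ (by simp)).clm_apply contDiff_const)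
  deriv_comm φ hφ z := by
    obtain ⟨t, x⟩ := z
    obtain ⟨y, rfl⟩ := exists_toTorus x
    exact hφ.deriv_torusPartial_comm i t y
  const_mul c g := by
    ext x
    exact deriv_const_mul_field c
  add f g hf hg := by
    ext x
    obtain ⟨y, rfl⟩ := exists_toTorus x
    rw [torusPartial_toTorus hf, torusPartial_toTorus hg, torusPartial_toTorus (hf.add hg)]
    have := fderiv_add (ContDiff.differentiable hf (by simp) y)
      (ContDiff.differentiable hg (by simp) y)
    exact congrArg (fun l => l (Pi.single i 1)) this
  sub_const g y := by
    ext x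
    simp only [torusPartial]
    congr 1
    ext h
    congr 1
    abel
  neg g := by
    ext x
    simp only [torusPartial, pow_one, neg_mul, one_mul]
    have h1 := deriv_comp_neg (fun h : ℝ => g (-x + toTorus (Pi.single i h))) 0
    rw [neg_zero] at h1
    rw [← h1]
    congr 1
    ext h
    congr 1
    rw [Pi.single_neg, toTorus_neg]
    abel

lemma IsDiffOp.iterate {D : (Torus d → ℝ) → Torus d → ℝ} (hD : IsDiffOp 1 D) (m : ℕ) :
    IsDiffOp m (D^[m]) := by
  induction m with
  | zero => exact isDiffOp_id
  | succ m ih => exact ih.comp hD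

lemma isDiffOp_torusDeriv (α : Fin d → ℕ) : IsDiffOp (∑ i, α i) (torusDeriv α) := by
  have key : ∀ l : List (Fin d), IsDiffOp (l.map α).sum
      fun g : Torus d → ℝ => l.foldr (fun i f => (torusPartial i)^[α i] f) g := by
    intro l
    induction l with
    | nil => exact isDiffOp_id
    | cons i l ih =>
      simp only [List.map_cons, List.sum_cons, List.foldr_cons]
      exact ((isDiffOp_torusPartial i).iterate (α i)).comp ih
  have := key (List.finRange d)
  rwa [← Fin.sum_univ_def] at this

lemma IsDiffOp.zero {k : ℕ} {D : (Torus d → ℝ) → Torus d → ℝ} (hD : IsDiffOp k D) :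
    D (fun _ => 0) = fun _ => 0 := by
  have := hD.const_mul 0 (fun _ => 0)
  simpa using this

lemma IsDiffOp.sum {k : ℕ} {D : (Torus d → ℝ) → Torus d → ℝ} (hD : IsDiffOp k D)
    {ι : Type*} (s : Finset ι) {f : ι → Torus d → ℝ} (hf : ∀ k, SmoothX (f k)) :
    D (fun x => ∑ k ∈ s, f k x) = fun x => ∑ k ∈ s, D (f k) x := by
  classical
  induction s using Finset.induction_on with
  | empty => simpa using hD.zero
  | insert a s ha ih =>
    simp only [Finset.sum_insert ha]
    rw [hD.add _ _ (hf a) (SmoothX.sum fun k _ => hf k), ih]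

end TorusCalculus

/-! ### The operators `L` and `L*` on smooth fields -/

namespace System

variable {d n N : ℕ} (S : System d n N)

lemma L_apply (Ξ : Torus d → Mat N) (x : Torus d) (i : Fin n) :
    S.L Ξ x i = ∑ j ∈ Finset.range (S.ν + 1), ∑ l, ∑ m,
      ∑ α ∈ Finset.piAntidiag (Finset.univ : Finset (Fin d)) j,
        S.b i l m α * torusDeriv α (fun y => Ξ y l m) x := rfl

lemma L_smul (c : ℝ) (Ξ : Torus d → Mat N) (x : Torus d) :
    S.L (fun y => c • Ξ y) x = c • S.L Ξ x := by
  ext i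
  rw [PiLp.smul_apply, L_apply, L_apply]
  simp only [Matrix.smul_apply, smul_eq_mul, (isDiffOp_torusDeriv _).const_mul, Finset.mul_sum]
  refine Finset.sum_congr rfl fun j _ => Finset.sum_congr rfl fun l _ =>
    Finset.sum_congr rfl fun m _ => Finset.sum_congr rfl fun α _ => by ring

lemma L_zero (x : Torus d) : S.L (fun _ => 0) x = 0 := by
  have := S.L_smul 0 (fun _ => 0) x
  simpa using this

lemma smoothTX_L {Ψ : ℝ × Torus d → Mat N} (h : ∀ l m, SmoothTX fun z => Ψ z l m) :
    SmoothTX fun z : ℝ × Torus d => S.L (fun y => Ψ (z.1, y)) z.2 := by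
  rw [smoothTX_vec_iff]
  intro i
  simp only [L_apply]
  refine SmoothTX.sum fun j _ => SmoothTX.sum fun l _ => SmoothTX.sum fun m _ =>
    SmoothTX.sum fun α _ => ?_
  exact (smoothTX_time (η := fun _ => S.b i l m α) contDiff_const).mul
    ((isDiffOp_torusDeriv α).smooth _ (h l m))

lemma SmoothTX.dtVec_apply {φ : ℝ × Torus d → Vec n} (hφ : SmoothTX φ) (z : ℝ × Torus d)
    (i : Fin n) : dtVec φ z i = deriv (fun s => φ (s, z.2) i) z.1 := by
  have h1 : DifferentiableAt ℝ (fun s => φ (s, z.2)) z.1 :=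
    (hφ.contDiff_time z.2).differentiable (by simp) _
  have h2 := (EuclideanSpace.proj (𝕜 := ℝ) i).hasFDerivAt.comp_hasDerivAt z.1 h1.hasDerivAt
  exact h2.deriv.symm

lemma deriv_sum_smooth {ι : Type*} (s : Finset ι) {f : ι → ℝ → ℝ} {t : ℝ}
    (h : ∀ k, DifferentiableAt ℝ (f k) t) :
    deriv (fun r => ∑ k ∈ s, f k r) t = ∑ k ∈ s, deriv (f k) t :=
  (HasDerivAt.fun_sum fun k _ => (h k).hasDerivAt).deriv

lemma dtVec_L {Ψ : ℝ × Torus d → Mat N} (h : ∀ l m, SmoothTX fun z => Ψ z l m)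
    (z : ℝ × Torus d) :
    dtVec (fun z : ℝ × Torus d => S.L (fun y => Ψ (z.1, y)) z.2) z =
      S.L (fun y => dtMat Ψ (z.1, y)) z.2 := by
  ext i
  rw [SmoothTX.dtVec_apply (S.smoothTX_L h), L_apply]
  simp only [L_apply]
  have hsm : ∀ l m α, SmoothTX fun z : ℝ × Torus d =>
      S.b i l m α * torusDeriv α (fun y => Ψ (z.1, y) l m) z.2 := fun l m α =>
    (smoothTX_time (η := fun _ => S.b i l m α) contDiff_const).mul
      ((isDiffOp_torusDeriv α).smooth _ (h l m))
  have hd : ∀ l m α, DifferentiableAt ℝ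
      (fun s => S.b i l m α * torusDeriv α (fun y => Ψ (s, y) l m) z.2) z.1 :=
    fun l m α => ((hsm l m α).contDiff_time z.2).differentiable (by simp) _
  rw [deriv_sum_smooth _ fun j => by fun_prop]
  refine Finset.sum_congr rfl fun j _ => ?_
  rw [deriv_sum_smooth _ fun j => by fun_prop]
  refine Finset.sum_congr rfl fun l _ => ?_
  rw [deriv_sum_smooth _ fun j => by fun_prop]
  refine Finset.sum_congr rfl fun m _ => ?_
  rw [deriv_sum_smooth _ fun j => by fun_prop]
  refine Finset.sum_congr rfl fun α _ => ?_
  rw [deriv_const_mul_field]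
  congr 1
  exact (isDiffOp_torusDeriv α).deriv_comm _ (h l m) z

lemma L_smul_const (g : Torus d → ℝ) (A : Mat N) (x : Torus d) (i : Fin n) :
    S.L (fun y => g y • A) x i = ∑ j ∈ Finset.range (S.ν + 1), ∑ l, ∑ m,
      ∑ α ∈ Finset.piAntidiag (Finset.univ : Finset (Fin d)) j,
        S.b i l m α * (A l m * torusDeriv α g x) := by
  rw [L_apply]
  refine Finset.sum_congr rfl fun j _ => Finset.sum_congr rfl fun l _ =>
    Finset.sum_congr rfl fun m _ => Finset.sum_congr rfl fun α _ => ?_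
  have : (fun y => (g y • A) l m) = fun y => A l m * g y := by
    ext y; simp [mul_comm]
  rw [this, (isDiffOp_torusDeriv α).const_mul]

lemma Lstar_isSymm (u : Torus d → Vec n) (x : Torus d) : (S.Lstar u x).IsSymm := by
  ext l m
  simp only [Lstar, Matrix.transpose_apply, Matrix.of_apply, add_comm]

end System


/-! ### Mollification on the torus -/

section Mollification

variable {d : ℕ}

instance : IsProbabilityMeasure (volume : Measure UnitAddCircle) :=
  ⟨UnitAddCircle.measure_univ⟩

/-- The kernels `k(x - y)` that are finite sums of products of smooth functions. -/
def IsSep (k : Torus d → ℝ) : Prop :=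
  ∃ (m : ℕ) (f g : Fin m → Torus d → ℝ), (∀ i, SmoothX (f i)) ∧ (∀ i, SmoothX (g i)) ∧
    ∀ x y, k (x - y) = ∑ i, f i x * g i y

lemma IsSep.mul {k k' : Torus d → ℝ} (h : IsSep k) (h' : IsSep k') :
    IsSep fun x => k x * k' x := by
  obtain ⟨m, f, g, hf, hg, hk⟩ := h
  obtain ⟨m', f', g', hf', hg', hk'⟩ := h'
  refine ⟨m * m', fun i x => f (finProdFinEquiv.symm i).1 x * f' (finProdFinEquiv.symm i).2 x,
    fun i x => g (finProdFinEquiv.symm i).1 x * g' (finProdFinEquiv.symm i).2 x,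
    fun i => (hf _).mul (hf' _), fun i => (hg _).mul (hg' _), fun x y => ?_⟩
  dsimp only
  rw [hk, hk', Finset.sum_mul_sum, ← Finset.sum_product', ← Finset.univ_product_univ.symm,
    ← finProdFinEquiv.symm.sum_comp]
  refine Finset.sum_congr rfl fun i _ => by ring

lemma isSep_const (c : ℝ) : IsSep fun _ : Torus d => c :=
  ⟨1, fun _ _ => c, fun _ _ => 1, fun _ => smoothX_const c, fun _ => smoothX_const 1,
    fun x y => by simp⟩

lemma IsSep.pow {k : Torus d → ℝ} (h : IsSep k) (j : ℕ) : IsSep fun x => k x ^ j := by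
  induction j with
  | zero => simpa using isSep_const (1 : ℝ)
  | succ j ih => simpa only [pow_succ] using ih.mul h

lemma IsSep.prod {ι : Type*} (s : Finset ι) {k : ι → Torus d → ℝ} (h : ∀ i, IsSep (k i)) :
    IsSep fun x => ∏ i ∈ s, k i x := by
  classical
  induction s using Finset.induction_on with
  | empty => simpa using isSep_const (1 : ℝ)
  | insert a s ha ih =>
    simp only [Finset.prod_insert ha]
    exact (h a).mul ih

lemma IsSep.smoothX {k : Torus d → ℝ} (h : IsSep k) : SmoothX k := by
  obtain ⟨m, f, g, hf, hg, hk⟩ := h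
  have : k = fun x => ∑ i, f i x * g i 0 := by
    ext x
    rw [← hk x 0, sub_zero]
  rw [this]
  exact SmoothX.sum fun i _ => (hf i).mul (smoothX_const _)

/-- A nonnegative trigonometric polynomial whose only maximum is at the origin. -/
def peak (x : Torus d) : ℝ := ∏ i, (1 + (AddCircle.toCircle (x i) : ℂ).re) / 2

lemma smoothX_toCircle (i : Fin d) :
    SmoothX (fun x : Torus d => (AddCircle.toCircle (x i) : ℂ).re) ∧
      SmoothX (fun x : Torus d => (AddCircle.toCircle (x i) : ℂ).im) := by
  have h : ∀ y : Fin d → ℝ, (AddCircle.toCircle (toTorus y i) : ℂ) =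
      Complex.exp ((2 * Real.pi * y i : ℝ) * Complex.I) := by
    intro y
    rw [toTorus, AddCircle.toCircle_apply_mk, Circle.coe_exp]
    simp
  unfold SmoothX
  simp only [h, Complex.exp_ofReal_mul_I_re, Complex.exp_ofReal_mul_I_im]
  have hi : ContDiff ℝ ∞ fun y : Fin d → ℝ => y i := contDiff_apply ℝ ℝ i
  exact ⟨Real.contDiff_cos.comp (contDiff_const.mul hi),
    Real.contDiff_sin.comp (contDiff_const.mul hi)⟩

/-- The addition theorem `cos (a - b) = cos a cos b + sin a sin b` gives three terms in each
coordinate, and products of separable kernels are separable. -/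
lemma isSep_peak : IsSep (peak : Torus d → ℝ) := by
  refine IsSep.prod _ fun i => ?_
  obtain ⟨h1, h2⟩ := smoothX_toCircle i
  refine ⟨3, ![fun _ => 1 / 2, fun x => 1 / 2 * (AddCircle.toCircle (x i) : ℂ).re,
    fun x => 1 / 2 * (AddCircle.toCircle (x i) : ℂ).im],
    ![fun _ => 1, fun x => (AddCircle.toCircle (x i) : ℂ).re,
    fun x => (AddCircle.toCircle (x i) : ℂ).im], ?_, ?_, fun x y => ?_⟩
  · intro k
    fin_cases k
    · exact smoothX_const _
    · exact h1.const_mul _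
    · exact h2.const_mul _
  · intro k
    fin_cases k
    · exact smoothX_const _
    · exact h1
    · exact h2
  · dsimp only
    rw [Pi.sub_apply, sub_eq_add_neg, AddCircle.toCircle_add, AddCircle.toCircle_neg,
      Circle.coe_mul, Circle.coe_inv_eq_conj, Fin.sum_univ_three]
    simp
    ring

lemma toCircle_re_le (θ : UnitAddCircle) :
    -1 ≤ (AddCircle.toCircle θ : ℂ).re ∧ (AddCircle.toCircle θ : ℂ).re ≤ 1 := by
  have := Complex.abs_re_le_norm (AddCircle.toCircle θ : ℂ)
  rw [Circle.norm_coe] at this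
  exact abs_le.1 this

lemma peak_nonneg (x : Torus d) : 0 ≤ peak x :=
  Finset.prod_nonneg fun i _ => by linarith [(toCircle_re_le (x i)).1]

lemma peak_zero : peak (0 : Torus d) = 1 := by
  simp [peak]

lemma peak_lt_one {x : Torus d} (hx : x ≠ 0) : peak x < 1 := by
  obtain ⟨i, hi⟩ : ∃ i, x i ≠ 0 := by
    by_contra! h
    exact hx (funext h)
  have h1 : (AddCircle.toCircle (x i) : ℂ).re < 1 := by
    refine lt_of_le_of_ne (toCircle_re_le (x i)).2 fun h => hi ?_
    apply AddCircle.injective_toCircle one_ne_zero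
    rw [AddCircle.toCircle_zero]
    apply Circle.ext
    have h2 := Circle.normSq_coe (AddCircle.toCircle (x i))
    rw [Complex.normSq_apply, h] at h2
    have h3 : (AddCircle.toCircle (x i) : ℂ).im = 0 := by nlinarith
    apply Complex.ext <;> simp [h, h3]
  unfold peak
  rw [← Finset.mul_prod_erase _ _ (Finset.mem_univ i)]
  have h2 : ∏ k ∈ Finset.univ.erase i, (1 + (AddCircle.toCircle (x k) : ℂ).re) / 2 ≤ 1 :=
    Finset.prod_le_one (fun k _ => by linarith [(toCircle_re_le (x k)).1])
      fun k _ => by linarith [(toCircle_re_le (x k)).2]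
  have h3 := (toCircle_re_le (x i)).1
  calc _ ≤ (1 + (AddCircle.toCircle (x i) : ℂ).re) / 2 * 1 := by gcongr; linarith
    _ < 1 := by linarith

lemma integrable_of_continuous {E : Type*} [NormedAddCommGroup E] {f : Torus d → E}
    (hf : Continuous f) : Integrable f volume :=
  hf.integrable_of_hasCompactSupport (HasCompactSupport.of_compactSpace f)

/-- The `L¹` modulus of continuity is continuous. -/
lemma continuous_integral_translate {f : Torus d → ℝ} (hf : Integrable f volume) :
    Continuous fun y : Torus d => ∫ x, |f (x - y) - f x| := by
  set F : Lp ℝ 1 (volume : Measure (Torus d)) := (memLp_one_iff_integrable.2 hf).toLp f with hF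
  let g : C(Torus d × Torus d, Torus d) := ⟨fun p => p.2 - p.1, by fun_prop⟩
  have hmp : ∀ y, MeasurePreserving (g.curry y) (volume : Measure (Torus d)) volume := fun y =>
    measurePreserving_sub_right volume y
  have h1 := (continuous_const (y := F)).compMeasurePreservingLp g.curry.continuous hmp (by simp)
  have h2 := (h1.sub (continuous_const (y := F))).norm
  refine h2.congr fun y => ?_
  rw [L1.norm_eq_integral_norm]
  refine integral_congr_ae ?_
  have h3 := Lp.coeFn_compMeasurePreserving F (hmp y)
  have h4 := (memLp_one_iff_integrable.2 hf).coeFn_toLp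
  have h5 := (hmp y).quasiMeasurePreserving.ae_eq_comp h4
  filter_upwards [Lp.coeFn_sub (Lp.compMeasurePreserving (g.curry y) (hmp y) F) F, h3, h4, h5]
    with x hx1 hx3 hx4 hx5
  dsimp only [Pi.sub_apply]
  rw [hx1, Pi.sub_apply, hx3, Real.norm_eq_abs]
  change |(F ∘ g.curry y) x - _| = _
  rw [hx5, hx4]
  rfl

/-- A sequence of smooth separable approximate identities. -/
structure Mollifier (d : ℕ) where
  ρ : ℕ → Torus d → ℝ
  nonneg : ∀ j x, 0 ≤ ρ j x
  integral_eq_one : ∀ j, ∫ x, ρ j x = 1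
  m : ℕ → ℕ
  f : ∀ j, Fin (m j) → Torus d → ℝ
  g : ∀ j, Fin (m j) → Torus d → ℝ
  smooth_f : ∀ j k, SmoothX (f j k)
  smooth_g : ∀ j k, SmoothX (g j k)
  sep : ∀ j x y, ρ j (x - y) = ∑ k, f j k x * g j k y
  tendsto_translate : ∀ G : Torus d → ℝ, Continuous G →
    Tendsto (fun j => ∫ y, ρ j y * G y) atTop (𝓝 (G 0))

/-- Normalized powers of `peak` concentrate at its unique maximum, by Laplace's method, and remain
trigonometric polynomials, hence separable. -/
lemma exists_mollifier (d : ℕ) : Nonempty (Mollifier d) := by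
  have hpc : Continuous (peak : Torus d → ℝ) := isSep_peak.smoothX.continuous
  set c : ℕ → ℝ := fun j => ∫ x : Torus d, peak x ^ j with hc
  have hcpos : ∀ j, 0 < c j := by
    intro j
    refine (integral_pos_iff_support_of_nonneg (fun x => pow_nonneg (peak_nonneg x) j)
      (integrable_of_continuous (by fun_prop))).2 ?_
    refine IsOpen.measure_pos _ ((hpc.pow j).isOpen_support) ⟨0, ?_⟩
    simp [peak_zero]
  have hsep : ∀ j, IsSep fun x : Torus d => (c j)⁻¹ * peak x ^ j := fun j =>
    (isSep_const _).mul (isSep_peak.pow j)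
  choose m f g hf hg hk using hsep
  refine ⟨⟨fun j x => (c j)⁻¹ * peak x ^ j, fun j x => ?_, fun j => ?_, m, f, g, hf, hg, hk, ?_⟩⟩
  · have := (hcpos j).le
    have := peak_nonneg x
    positivity
  · rw [integral_const_mul]
    exact inv_mul_cancel₀ (hcpos j).ne'
  · intro G hG
    have := tendsto_setIntegral_pow_smul_of_unique_maximum_of_isCompact_of_continuousOn
      (μ := (volume : Measure (Torus d))) (s := univ) (x₀ := 0) (g := G) isCompact_univ
      hpc.continuousOn (fun y _ hy => by rw [peak_zero]; exact peak_lt_one hy)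
      (fun x _ => peak_nonneg x) (by rw [peak_zero]; exact one_pos) (by simp) hG.continuousOn
    simp only [setIntegral_univ, smul_eq_mul] at this
    refine this.congr fun j => ?_
    rw [← integral_const_mul]
    simp only [hc, mul_assoc]

namespace Mollifier

variable (M : Mollifier d)

lemma sep_zero (j : ℕ) (x : Torus d) : M.ρ j x = ∑ k, M.f j k x * M.g j k 0 := by
  rw [← M.sep j x 0, sub_zero]

lemma smooth (j : ℕ) : SmoothX (M.ρ j) := by
  have : M.ρ j = fun x => ∑ i, M.f j i x * M.g j i 0 := by
    ext x
    exact M.sep_zero j x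
  rw [this]
  exact SmoothX.sum fun i _ => (M.smooth_f j i).mul (smoothX_const _)

lemma continuous (j : ℕ) : Continuous (M.ρ j) := (M.smooth j).continuous

/-- The mollification `ρ_j * f`. -/
def moll (j : ℕ) (f : Torus d → ℝ) (x : Torus d) : ℝ := ∫ y, M.ρ j (x - y) * f y

lemma exists_bound {g : Torus d → ℝ} (hg : Continuous g) : ∃ C, ∀ x, ‖g x‖ ≤ C := by
  obtain ⟨C, hC⟩ := (isCompact_univ (X := Torus d)).exists_bound_of_continuousOn hg.continuousOn
  exact ⟨C, fun x => hC x (mem_univ x)⟩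

lemma integrable_cont_mul {f g : Torus d → ℝ} (hf : Integrable f volume) (hg : Continuous g) :
    Integrable (fun x => g x * f x) volume := by
  obtain ⟨C, hC⟩ := exists_bound hg
  exact hf.bdd_mul hg.aestronglyMeasurable (Eventually.of_forall hC)

lemma integrable_mul_cont {f g : Torus d → ℝ} (hf : Integrable f volume) (hg : Continuous g) :
    Integrable (fun x => f x * g x) volume := by
  simpa only [mul_comm] using integrable_cont_mul hf hg

/-- Separability reduces the convolution to finitely many numbers. Smoothness and the action of
differential operators then need no differentiation under the integral. -/
lemma moll_eq_sum (j : ℕ) {f : Torus d → ℝ} (hf : Integrable f volume) (x : Torus d) :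
    M.moll j f x = ∑ k, M.f j k x * ∫ y, M.g j k y * f y := by
  unfold moll
  simp only [M.sep, Finset.sum_mul, mul_assoc]
  rw [integral_finsetSum]
  · simp only [integral_const_mul]
  · intro k _
    exact (integrable_cont_mul hf (M.smooth_g j k).continuous).const_mul _

lemma smoothX_moll (j : ℕ) {f : Torus d → ℝ} (hf : Integrable f volume) :
    SmoothX (M.moll j f) := by
  have : M.moll j f = fun x => ∑ k, M.f j k x * ∫ y, M.g j k y * f y :=
    funext fun x => M.moll_eq_sum j hf x
  rw [this]
  exact SmoothX.sum fun k _ => (M.smooth_f j k).mul (smoothX_const _)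

instance : (volume : Measure (Torus d)).IsNegInvariant :=
  Measure.IsAddHaarMeasure.isNegInvariant_of_regular _

lemma moll_eq (j : ℕ) (f : Torus d → ℝ) (x : Torus d) :
    M.moll j f x = ∫ y, M.ρ j y * f (x - y) := by
  unfold moll
  rw [← integral_sub_left_eq_self _ _ x]
  simp only [sub_sub_cancel]

lemma integrable_prod (j : ℕ) {f : Torus d → ℝ} (hf : Integrable f volume) :
    Integrable (fun p : Torus d × Torus d => M.ρ j p.2 * (f (p.1 - p.2) - f p.1))
      (volume.prod volume) := by
  obtain ⟨C, hC⟩ := exists_bound (M.continuous j)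
  have h1 : Integrable (fun p : Torus d × Torus d => f p.1)
      ((volume : Measure (Torus d)).prod volume) := hf.comp_fst volume
  have h2 : Integrable (fun p : Torus d × Torus d => f (p.1 - p.2))
      ((volume : Measure (Torus d)).prod volume) :=
    (measurePreserving_sub_prod volume volume).integrable_comp_of_integrable h1
  exact (h2.sub h1).bdd_mul ((M.continuous j).comp continuous_snd).aestronglyMeasurable
    (Eventually.of_forall fun p => hC p.2)

/-- By Fubini the error is at most `∫ ρ_j(y) ω(y) dy`, where the `L¹` modulus `ω` is continuous and
vanishes at `0`. -/
lemma tendsto_moll {f : Torus d → ℝ} (hf : Integrable f volume) :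
    Tendsto (fun j => ∫ x, |M.moll j f x - f x|) atTop (𝓝 0) := by
  have h1 := M.tendsto_translate _ (continuous_integral_translate hf)
  simp only [sub_zero, sub_self, abs_zero, integral_zero] at h1
  refine squeeze_zero (fun j => integral_nonneg fun x => abs_nonneg _) (fun j => ?_) h1
  have hint := (M.integrable_prod j hf).norm
  have h2 : ∀ᵐ x : Torus d, |M.moll j f x - f x| ≤ ∫ y, ‖M.ρ j y * (f (x - y) - f x)‖ := by
    filter_upwards [(M.integrable_prod (d := d) j hf).prod_right_ae] with x hx
    have h3 : Integrable (fun y => M.ρ j y * f x) volume :=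
      (integrable_of_continuous (M.continuous j)).mul_const _
    have h4 : M.moll j f x - f x = ∫ y, M.ρ j y * (f (x - y) - f x) := by
      have h5 : Integrable (fun y => M.ρ j y * f (x - y)) (volume : Measure (Torus d)) := by
        refine (hx.add h3).congr (Eventually.of_forall fun y => ?_)
        simp only [Pi.add_apply]; ring
      simp only [mul_sub]
      rw [integral_sub h5 h3, integral_mul_const, M.integral_eq_one, one_mul, M.moll_eq]
    rw [h4]
    exact norm_integral_le_integral_norm fun y : Torus d => M.ρ j y * (f (x - y) - f x)
  calc ∫ x, |M.moll j f x - f x| ≤ ∫ x, ∫ y, ‖M.ρ j y * (f (x - y) - f x)‖ := by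
        refine integral_mono_of_nonneg (Eventually.of_forall fun x => abs_nonneg _)
          hint.integral_prod_left h2
    _ = ∫ y, ∫ x, ‖M.ρ j y * (f (x - y) - f x)‖ := integral_integral_swap hint
    _ = ∫ y, M.ρ j y * ∫ x, |f (x - y) - f x| := by
        congr 1
        ext y
        rw [← integral_const_mul]
        congr 1
        ext x
        rw [norm_mul, Real.norm_of_nonneg (M.nonneg j y), Real.norm_eq_abs]

/-- The family `g j k` of test functions is countable. This permits the exchange of "for almost
every time" and "for every test function" later on. -/
lemma ae_eq_zero {f : Torus d → ℝ} (hf : Integrable f volume)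
    (h : ∀ j k, ∫ y, M.g j k y * f y = 0) : f =ᵐ[volume] 0 := by
  have h1 := M.tendsto_moll hf
  have h2 : ∀ j x, M.moll j f x = 0 := fun j x => by
    rw [M.moll_eq_sum j hf]
    simp [h]
  simp only [h2, zero_sub, abs_neg] at h1
  have h3 : ∫ x, |f x| = 0 := tendsto_nhds_unique tendsto_const_nhds h1
  rw [integral_eq_zero_iff_of_nonneg (fun x => abs_nonneg _) hf.abs] at h3
  filter_upwards [h3] with x hx
  simpa using hx

end Mollifier

end Mollification


/-! ### Absolutely continuous functions of one variable -/

section AbsolutelyContinuous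

variable {F : Type*} [NormedAddCommGroup F] [NormedSpace ℝ F]

/-- Lets absolute continuity pass to vector-valued primitives, to coordinates, to reciprocals of
weights and to compositions with locally Lipschitz functions. -/
lemma absolutelyContinuousOnInterval_of_dist_le {X Y : Type*} [PseudoMetricSpace X]
    [PseudoMetricSpace Y] {f : ℝ → X} {g : ℝ → Y} {a b C : ℝ} (hC : 0 ≤ C)
    (hg : AbsolutelyContinuousOnInterval g a b)
    (h : ∀ s ∈ uIcc a b, ∀ t ∈ uIcc a b, dist (f s) (f t) ≤ C * dist (g s) (g t)) :
    AbsolutelyContinuousOnInterval f a b := by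
  rw [absolutelyContinuousOnInterval_iff] at hg ⊢
  intro ε hε
  obtain ⟨δ, hδ, hE⟩ := hg (ε / (C + 1)) (by positivity)
  refine ⟨δ, hδ, fun E hEm hEd => ?_⟩
  have h1 := hE E hEm hEd
  calc ∑ i ∈ Finset.range E.1, dist (f (E.2 i).1) (f (E.2 i).2)
      ≤ ∑ i ∈ Finset.range E.1, C * dist (g (E.2 i).1) (g (E.2 i).2) :=
        Finset.sum_le_sum fun i hi => h _ (hEm.1 i hi).1 _ (hEm.1 i hi).2
    _ = C * ∑ i ∈ Finset.range E.1, dist (g (E.2 i).1) (g (E.2 i).2) := by rw [Finset.mul_sum]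
    _ ≤ C * (ε / (C + 1)) := by gcongr
    _ < ε := by
        rw [mul_div_assoc', div_lt_iff₀ (by positivity)]
        linarith

lemma absolutelyContinuousOnInterval_integral_right {e : ℝ → F} {a b : ℝ}
    (he : IntervalIntegrable e volume a b) :
    AbsolutelyContinuousOnInterval (fun t => ∫ s in t..b, e s) a b := by
  refine absolutelyContinuousOnInterval_of_dist_le zero_le_one
    (he.norm.absolutelyContinuousOnInterval_intervalIntegral left_mem_uIcc) fun s hs t ht => ?_
  have hi : ∀ {u v : ℝ}, u ∈ uIcc a b → v ∈ uIcc a b → IntervalIntegrable e volume u v :=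
    fun hu hv => he.mono_set (uIcc_subset_uIcc hu hv)
  have ha : a ∈ uIcc a b := left_mem_uIcc
  have hb : b ∈ uIcc a b := right_mem_uIcc
  have h1 : (∫ r in s..b, e r) - ∫ r in t..b, e r = ∫ r in s..t, e r := by
    rw [← intervalIntegral.integral_add_adjacent_intervals (hi hs ht) (hi ht hb), add_sub_cancel_right]
  rw [one_mul, dist_comm (∫ r in a..s, _), dist_eq_norm, dist_eq_norm, h1,
    intervalIntegral.integral_interval_sub_left (hi ha ht).norm (hi ha hs).norm, Real.norm_eq_abs]
  exact intervalIntegral.norm_integral_le_abs_integral_norm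

lemma ae_hasDerivAt_integral_right [CompleteSpace F] {e : ℝ → F} {a b : ℝ}
    (he : IntervalIntegrable e volume a b) :
    ∀ᵐ t, t ∈ uIcc a b → HasDerivAt (fun t => ∫ s in t..b, e s) (-e t) t := by
  filter_upwards [he.ae_hasDerivAt_integral] with t ht hmem
  have h1 := (ht hmem b right_mem_uIcc).neg
  refine h1.congr_of_eventuallyEq (Eventually.of_forall fun r => ?_)
  simp only [Pi.neg_apply]
  rw [intervalIntegral.integral_symm]

lemma intervalIntegrable_and_integral_eq_sub {f f' : ℝ → ℝ} {a b : ℝ}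
    (hf : AbsolutelyContinuousOnInterval f a b)
    (hd : ∀ᵐ t, t ∈ uIcc a b → HasDerivAt f (f' t) t) :
    IntervalIntegrable f' volume a b ∧ ∫ t in a..b, f' t = f b - f a := by
  have h1 : ∀ᵐ t, t ∈ uIoc a b → deriv f t = f' t := by
    filter_upwards [hd] with t ht hmem
    exact (ht (uIoc_subset_uIcc hmem)).deriv
  refine ⟨hf.intervalIntegrable_deriv.congr_ae ?_, ?_⟩
  · rw [EventuallyEq, ae_restrict_iff' measurableSet_uIoc]
    exact h1
  · rw [← hf.integral_deriv_eq_sub]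
    exact (intervalIntegral.integral_congr_ae h1).symm

lemma _root_.ContDiff.absolutelyContinuousOnInterval {φ : ℝ → ℝ} (hφ : ContDiff ℝ ∞ φ) (a b : ℝ) :
    AbsolutelyContinuousOnInterval φ a b :=
  (hφ.of_le (by exact_mod_cast le_top)).contDiffOn.absolutelyContinuousOnInterval

/-- Integration by parts against a primitive that vanishes at the right end point. -/
lemma integral_primitive_mul_deriv {e φ : ℝ → ℝ} {T : ℝ}
    (he : IntervalIntegrable e volume 0 T) (hφ : ContDiff ℝ ∞ φ) :
    ∫ t in 0..T, (∫ s in t..T, e s) * deriv φ t =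
      -((∫ s in 0..T, e s) * φ 0) + ∫ t in 0..T, e t * φ t := by
  rw [(absolutelyContinuousOnInterval_integral_right he).integral_mul_deriv_eq_deriv_mul
    (hφ.absolutelyContinuousOnInterval 0 T)]
  have : ∫ t in 0..T, deriv (fun t => ∫ s in t..T, e s) t * φ t = ∫ t in 0..T, -(e t * φ t) := by
    refine intervalIntegral.integral_congr_ae ?_
    filter_upwards [ae_hasDerivAt_integral_right he] with t ht hmem
    rw [(ht (uIoc_subset_uIcc hmem)).deriv, neg_mul]
  rw [this, intervalIntegral.integral_neg, intervalIntegral.integral_same]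
  ring

end AbsolutelyContinuous

/-! ### Test functions in time -/

/-- Smooth functions compactly supported in `(0,T)`. -/
structure IsTimeTest (T : ℝ) (η : ℝ → ℝ) : Prop where
  smooth : ContDiff ℝ ∞ η
  compact : HasCompactSupport η
  support : tsupport η ⊆ Ioo 0 T

namespace IsTimeTest

variable {T : ℝ} {η θ : ℝ → ℝ}

lemma mul_left (hη : IsTimeTest T η) {ψ : ℝ → ℝ} (hψ : ContDiff ℝ ∞ ψ) :
    IsTimeTest T fun t => ψ t * η t :=
  ⟨hψ.mul hη.smooth, hη.compact.mul_left, (tsupport_mul_subset_right).trans hη.support⟩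

lemma deriv (hη : IsTimeTest T η) : IsTimeTest T (deriv η) :=
  ⟨(contDiff_infty_iff_deriv.1 hη.smooth).2, hη.compact.deriv,
    (tsupport_deriv_subset).trans hη.support⟩

lemma differentiable (hη : IsTimeTest T η) : Differentiable ℝ η := hη.smooth.differentiable (by simp)

lemma exists_Icc (hη : IsTimeTest T η) (hT : 0 < T) :
    ∃ a b, 0 < a ∧ a < b ∧ b < T ∧ ∀ t, t ∉ Ioo a b → η t = 0 := by
  rcases (tsupport η).eq_empty_or_nonempty with h | h
  · refine ⟨T / 3, T / 2, by positivity, by linarith, by linarith, fun t _ => ?_⟩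
    exact image_eq_zero_of_notMem_tsupport (by simp [h])
  obtain ⟨t₀, h0, hmin⟩ := hη.compact.isCompact.exists_isMinOn h continuousOn_id
  obtain ⟨t₁, h1, hmax⟩ := hη.compact.isCompact.exists_isMaxOn h continuousOn_id
  have h2 := hη.support h0
  have h3 := hη.support h1
  have h4 : t₀ ≤ t₁ := hmin h1
  refine ⟨t₀ / 2, (t₁ + T) / 2, by linarith [h2.1], by linarith [h2.1, h3.2], by linarith [h3.2],
    fun t ht => image_eq_zero_of_notMem_tsupport fun hmem => ht ⟨?_, ?_⟩⟩
  · have : t₀ ≤ t := hmin hmem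
    linarith [h2.1]
  · have : t ≤ t₁ := hmax hmem
    linarith [h3.2]

lemma of_forall_notMem (hη : ContDiff ℝ ∞ η) {a b : ℝ} (ha : 0 < a) (hb : b < T)
    (h : ∀ t, t ∉ Icc a b → η t = 0) : IsTimeTest T η := by
  have hs : tsupport η ⊆ Icc a b := by
    refine closure_minimal (fun t ht => ?_) isClosed_Icc
    by_contra hcon
    exact ht (h t hcon)
  exact ⟨hη, HasCompactSupport.intro isCompact_Icc fun t ht => h t ht,
    hs.trans fun t ht => ⟨ha.trans_le ht.1, ht.2.trans_lt hb⟩⟩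

end IsTimeTest

/-- An exhausting sequence of cut-off functions. -/
lemma exists_cutoff {T : ℝ} (hT : 0 < T) :
    ∃ θ : ℕ → ℝ → ℝ, (∀ k, IsTimeTest T (θ k)) ∧ (∀ k t, 0 ≤ θ k t) ∧
      (∀ k, 0 < ∫ t, θ k t) ∧ ∀ t ∈ Ioo 0 T, ∃ k, θ k t = 1 := by
  -- The `3` keeps `T / (k + 3)` below `T / 2`, so that the inner radius of the bump is positive.
  have hr : ∀ k : ℕ, 0 < T / (k + 3) ∧ T / (k + 3) < T / 2 := fun k => by
    refine ⟨by positivity, ?_⟩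
    apply div_lt_div_of_pos_left hT (by norm_num)
    have : (0 : ℝ) ≤ k := Nat.cast_nonneg k
    linarith
  let f : ℕ → ContDiffBump (T / 2) := fun k =>
    ⟨T / 2 - T / (k + 3), T / 2 - T / (k + 3) / 2, by linarith [(hr k).2], by linarith [(hr k).1]⟩
  refine ⟨fun k => f k, fun k => ⟨(f k).contDiff, (f k).hasCompactSupport, ?_⟩,
    fun k t => (f k).nonneg, fun k => (f k).integral_pos, fun t ht => ?_⟩
  · rw [(f k).tsupport_eq, Real.closedBall_eq_Icc]
    intro t ht
    have h1 : t ∈ Icc (T / 2 - (T / 2 - T / (k + 3) / 2)) (T / 2 + (T / 2 - T / (k + 3) / 2)) := ht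
    exact ⟨by linarith [h1.1, (hr k).1], by linarith [h1.2, (hr k).1]⟩
  · have hpos : 0 < min t (T - t) := lt_min ht.1 (by linarith [ht.2])
    obtain ⟨k, hk⟩ := exists_nat_gt (T / min t (T - t))
    refine ⟨k, (f k).one_of_mem_closedBall ?_⟩
    have h2 : T / (k + 3) ≤ min t (T - t) := by
      rw [div_le_iff₀ (by positivity)]
      rw [div_lt_iff₀ hpos] at hk
      nlinarith
    have h3 := h2.trans (min_le_left _ _)
    have h4 := h2.trans (min_le_right _ _)
    change t ∈ Metric.closedBall (T / 2) (T / 2 - T / (k + 3))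
    rw [Real.closedBall_eq_Icc]
    exact ⟨by linarith, by linarith⟩

lemma intervalIntegrable_of_integrableOn_Ioo {F : Type*} [NormedAddCommGroup F] {e : ℝ → F}
    {T : ℝ} (hT : 0 < T) (he : IntegrableOn e (Ioo 0 T)) : IntervalIntegrable e volume 0 T := by
  rw [intervalIntegrable_iff_integrableOn_Ioo_of_le hT.le]
  exact he

lemma setIntegral_Ioo_eq {F : Type*} [NormedAddCommGroup F] [NormedSpace ℝ F] {e : ℝ → F}
    {T : ℝ} (hT : 0 < T) : ∫ t in Ioo 0 T, e t = ∫ t in 0..T, e t := by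
  rw [intervalIntegral.integral_of_le hT.le, integral_Ioc_eq_integral_Ioo]

/-- The lemma of du Bois-Reymond. -/
lemma exists_ae_eq_const_of_integral_mul_deriv {T : ℝ} (hT : 0 < T) {γ : ℝ → ℝ}
    (hγ : IntegrableOn γ (Ioo 0 T)) (h : ∀ η, IsTimeTest T η → ∫ t in Ioo 0 T, γ t * deriv η t = 0) :
    ∃ c, ∀ᵐ t, t ∈ Ioo 0 T → γ t = c := by
  obtain ⟨θ, hθ, hθ0, hθp, -⟩ := exists_cutoff hT
  set θ₀ : ℝ → ℝ := fun t => (∫ s, θ 0 s)⁻¹ * θ 0 t with hθ₀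
  have hθ₀t : IsTimeTest T θ₀ := (hθ 0).mul_left contDiff_const
  have hθ₀i : ∫ t, θ₀ t = 1 := by
    rw [hθ₀, integral_const_mul, inv_mul_cancel₀ (hθp 0).ne']
  have hint : ∀ η, IsTimeTest T η → IntegrableOn (fun t => γ t * η t) (Ioo 0 T) := fun η hη => by
    obtain ⟨C, hC⟩ := hη.compact.exists_bound_of_continuous hη.smooth.continuous
    exact Integrable.mul_bdd hγ hη.smooth.continuous.aestronglyMeasurable
      (Eventually.of_forall hC)
  set c := ∫ t in Ioo 0 T, γ t * θ₀ t with hc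
  refine ⟨c, ?_⟩
  have key : ∀ η : ℝ → ℝ, ContDiff ℝ ∞ η → HasCompactSupport η → tsupport η ⊆ Ioo 0 T →
      ∫ t, η t • (γ t - c) = 0 := by
    intro η h1 h2 h3
    have hη : IsTimeTest T η := ⟨h1, h2, h3⟩
    set I := ∫ t, η t with hI
    -- Subtracting a multiple of the normalized bump makes the mean vanish, so the primitive `Z` is
    -- again compactly supported and may be used as a test function.
    set ζ : ℝ → ℝ := fun t => η t - I * θ₀ t with hζ
    have hζs : ContDiff ℝ ∞ ζ := h1.sub (contDiff_const.mul hθ₀t.smooth)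
    have hζi : Integrable ζ := (h1.continuous.integrable_of_hasCompactSupport h2).sub
      ((hθ₀t.smooth.continuous.integrable_of_hasCompactSupport hθ₀t.compact).const_mul _)
    have hζ0 : ∫ t, ζ t = 0 := by
      rw [hζ, integral_sub (h1.continuous.integrable_of_hasCompactSupport h2)
        ((hθ₀t.smooth.continuous.integrable_of_hasCompactSupport hθ₀t.compact).const_mul _),
        integral_const_mul, hθ₀i, mul_one, sub_self]
    obtain ⟨a, b, ha, hab, hb, hη0⟩ := hη.exists_Icc hT
    obtain ⟨a', b', ha', hab', hb', hη0'⟩ := hθ₀t.exists_Icc hT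
    have hζz : ∀ t, t ∉ Ioo (min a a') (max b b') → ζ t = 0 := by
      intro t ht
      have e1 : t ∉ Ioo a b := fun hm => ht ⟨(min_le_left _ _).trans_lt hm.1,
        hm.2.trans_le (le_max_left _ _)⟩
      have e2 : t ∉ Ioo a' b' := fun hm => ht ⟨(min_le_right _ _).trans_lt hm.1,
        hm.2.trans_le (le_max_right _ _)⟩
      simp [hζ, hη0 t e1, hη0' t e2]
    set Z : ℝ → ℝ := fun t => ∫ s in (0 : ℝ)..t, ζ s with hZ
    have hZd : ∀ t, HasDerivAt Z (ζ t) t := fun t =>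
      intervalIntegral.integral_hasDerivAt_right (hζi.intervalIntegrable)
        (hζs.continuous.stronglyMeasurableAtFilter _ _) hζs.continuous.continuousAt
    have hZderiv : deriv Z = ζ := funext fun t => (hZd t).deriv
    have hZs : ContDiff ℝ ∞ Z := by
      rw [contDiff_infty_iff_deriv, hZderiv]
      exact ⟨fun t => (hZd t).differentiableAt, hζs⟩
    have hZt : IsTimeTest T Z := by
      refine IsTimeTest.of_forall_notMem hZs (lt_min ha ha') (max_lt hb hb') fun t ht => ?_
      rw [mem_Icc, not_and_or, not_le, not_le] at ht
      rcases ht with ht | ht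
      · refine intervalIntegral.integral_zero_ae (Eventually.of_forall fun s hs => hζz s ?_)
        intro hm
        have h5 : s ≤ max 0 t := (uIoc_subset_uIcc hs).2
        have h6 : max 0 t < min a a' := max_lt (lt_min ha ha') ht
        linarith [hm.1]
      · have h0T : (0:ℝ) ≤ t := by
          have := ha.trans (hab.trans_le (le_max_left b b'))
          linarith
        rw [hZ]
        dsimp only
        rw [intervalIntegral.integral_of_le h0T, setIntegral_eq_integral_of_forall_compl_eq_zero, hζ0]
        intro s hs
        refine hζz s fun hm => hs ⟨?_, ?_⟩
        · exact (lt_min ha ha').trans hm.1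
        · linarith [hm.2]
    have h4 := h Z hZt
    rw [hZderiv] at h4
    have h5 : ∫ t in Ioo 0 T, γ t * η t = I * c := by
      have h6 : ∫ t in Ioo 0 T, γ t * ζ t = (∫ t in Ioo 0 T, γ t * η t) - I * c := by
        rw [hc, ← integral_const_mul, ← integral_sub (hint η hη) ((hint θ₀ hθ₀t).const_mul _)]
        congr 1
        ext t
        simp only [hζ]
        ring
      linarith
    have h7 : ∫ t, η t • (γ t - c) = ∫ t in Ioo 0 T, η t • (γ t - c) := by
      rw [setIntegral_eq_integral_of_forall_compl_eq_zero]
      intro t ht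
      rw [image_eq_zero_of_notMem_tsupport fun hm => ht (h3 hm), zero_smul]
    have h8 : ∫ t in Ioo 0 T, η t = I := by
      rw [setIntegral_eq_integral_of_forall_compl_eq_zero]
      intro t ht
      exact image_eq_zero_of_notMem_tsupport fun hm => ht (h3 hm)
    rw [h7]
    have h9 : ∀ t, η t • (γ t - c) = γ t * η t - η t * c := fun t => by
      rw [smul_eq_mul]; ring
    simp only [h9]
    rw [integral_sub (hint η hη)
      ((h1.continuous.integrable_of_hasCompactSupport h2).integrableOn.mul_const _),
      integral_mul_const, h5, h8, sub_self]
  have hloc : LocallyIntegrableOn (fun t => γ t - c) (Ioo 0 T) :=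
    (hγ.sub (integrableOn_const (by simp))).locallyIntegrableOn
  filter_upwards [isOpen_Ioo.ae_eq_zero_of_integral_contDiff_smul_eq_zero hloc key] with t ht hm
  linarith [ht hm]

/-- Near `T` the function `α` is close to `c`, and `(T - t)⁻¹` is not integrable there. This
replaces a trace condition `α(T) = 0`. -/
lemma eq_zero_of_integrableOn_div {T c : ℝ} (hT : 0 < T) {α B : ℝ → ℝ}
    (hα : ∀ᵐ t, t ∈ Ioo 0 T → α t = c - B t) (hB : Tendsto B (𝓝[<] T) (𝓝 0))
    (hi : IntegrableOn (fun t => (T - t)⁻¹ * α t) (Ioo 0 T)) : c = 0 := by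
  by_contra hc
  have hc' : 0 < |c| / 2 := by positivity
  have h1 : ∀ᶠ t in 𝓝[<] T, |B t| < |c| / 2 := by
    have := hB.abs
    rw [abs_zero] at this
    exact this.eventually_lt_const hc'
  obtain ⟨δ, hδ, hδB⟩ := (mem_nhdsLT_iff_exists_Ioo_subset' (show (0 : ℝ) < T from hT)).1
    (inter_mem h1 (Ioo_mem_nhdsLT hT))
  have h2 : IntegrableOn (fun t => (t - T)⁻¹) (Ioo (max δ 0) T) := by
    refine Integrable.mono' ((hi.mono_set (Ioo_subset_Ioo_left (le_max_right _ _))).norm.const_mul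
      (|c| / 2)⁻¹) (by fun_prop) ?_
    rw [ae_restrict_iff' measurableSet_Ioo]
    filter_upwards [hα] with t ht hmem
    have h3 : t ∈ Ioo 0 T := ⟨(le_max_right _ _).trans_lt hmem.1, hmem.2⟩
    have h4 : |B t| < |c| / 2 := (hδB ⟨(le_max_left _ _).trans_lt hmem.1, hmem.2⟩).1
    have h5 : |c| / 2 ≤ |α t| := by
      rw [ht h3]
      have := abs_sub_abs_le_abs_sub c (B t)
      linarith
    have h6 : 0 < T - t := by linarith [hmem.2]
    rw [norm_mul, norm_inv, norm_inv, Real.norm_eq_abs, Real.norm_eq_abs, Real.norm_eq_abs,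
      abs_sub_comm t T, mul_left_comm]
    refine le_mul_of_one_le_right (by positivity) ?_
    rw [inv_mul_eq_div, one_le_div hc']
    exact h5
  have h3 : max δ 0 < T := max_lt hδ hT
  rw [← intervalIntegrable_iff_integrableOn_Ioo_of_le h3.le] at h2
  rw [intervalIntegrable_sub_inv_iff] at h2
  rcases h2 with h2 | h2
  · exact h3.ne h2
  · exact h2 right_mem_uIcc

/-- A function with integrable weak derivative that is small at the right end point is a
primitive. -/
lemma ae_eq_neg_integral_of_weak_deriv {T : ℝ} (hT : 0 < T) {α β : ℝ → ℝ}
    (hα : IntegrableOn α (Ioo 0 T)) (hβ : IntegrableOn β (Ioo 0 T))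
    (hi : IntegrableOn (fun t => (T - t)⁻¹ * α t) (Ioo 0 T))
    (h : ∀ η, IsTimeTest T η → ∫ t in Ioo 0 T, deriv η t * α t = -∫ t in Ioo 0 T, η t * β t) :
    ∀ᵐ t, t ∈ Ioo 0 T → α t = -∫ s in t..T, β s := by
  have hβi := intervalIntegrable_of_integrableOn_Ioo hT hβ
  have hac := absolutelyContinuousOnInterval_integral_right hβi
  have hBc := hac.continuousOn
  rw [uIcc_of_le hT.le] at hBc
  have hBi : IntegrableOn (fun t => ∫ s in t..T, β s) (Ioo 0 T) :=
    (hBc.integrableOn_Icc).mono_set Ioo_subset_Icc_self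
  -- The sum `α + ∫_t^T β` has zero weak derivative, hence is constant; the integrability of `(T -
  -- t)⁻¹ α` then makes the constant vanish.
  obtain ⟨c, hc⟩ := exists_ae_eq_const_of_integral_mul_deriv hT (hα.add hBi) fun η hη => by
    obtain ⟨C, hC⟩ := hη.deriv.compact.exists_bound_of_continuous hη.deriv.smooth.continuous
    have hm := hη.deriv.smooth.continuous.aestronglyMeasurable (μ := volume.restrict (Ioo 0 T))
    have e1 : IntegrableOn (fun t => α t * deriv η t) (Ioo 0 T) :=
      Integrable.mul_bdd hα hm (Eventually.of_forall hC)
    have e2 : IntegrableOn (fun t => (∫ s in t..T, β s) * deriv η t) (Ioo 0 T) :=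
      Integrable.mul_bdd hBi hm (Eventually.of_forall hC)
    have e3 := integral_primitive_mul_deriv hβi hη.smooth
    have e4 : η 0 = 0 := image_eq_zero_of_notMem_tsupport fun hm => (hη.support hm).1.false
    have e5 := h η hη
    simp only [Pi.add_apply, add_mul]
    rw [integral_add e1 e2, setIntegral_Ioo_eq hT (e := fun t => (∫ s in t..T, β s) * _), e3, e4]
    simp only [mul_comm (α _)]
    rw [e5, setIntegral_Ioo_eq hT]
    simp only [mul_comm (β _)]
    ring
  have hc0 : c = 0 := by
    refine eq_zero_of_integrableOn_div hT (B := fun t => ∫ s in t..T, β s) ?_ ?_ hi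
    · filter_upwards [hc] with t ht hm
      have := ht hm
      simp only [Pi.add_apply] at this
      linarith
    · have h1 := hBc T (right_mem_Icc.2 hT.le)
      have h2 := h1.mono_left (nhdsWithin_le_iff.2 (mem_of_superset (Ioo_mem_nhdsLT hT) Ioo_subset_Icc_self))
      simpa using h2
  filter_upwards [hc] with t ht hm
  have := ht hm
  simp only [Pi.add_apply] at this
  linarith


/-! ### Functions on space-time -/

section SpaceTime

variable {d : ℕ} {T : ℝ}

lemma stMeasure_eq (T : ℝ) (d : ℕ) :
    stMeasure T d = volume.restrict (Ioo 0 T ×ˢ (univ : Set (Torus d))) := by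
  rw [stMeasure, Measure.volume_eq_prod, ← Measure.prod_restrict, Measure.restrict_univ]

instance : IsFiniteMeasure (stMeasure T d) := by
  unfold stMeasure
  infer_instance

lemma ae_mem_stMeasure (T : ℝ) (d : ℕ) : ∀ᵐ z ∂stMeasure T d, z.1 ∈ Ioo 0 T := by
  rw [stMeasure_eq]
  filter_upwards [ae_restrict_mem (measurableSet_Ioo.prod MeasurableSet.univ)] with z hz
  exact hz.1

lemma locallyIntegrableOn_of_integrable {E : Type*} [NormedAddCommGroup E]
    {f : ℝ × Torus d → E} (hf : Integrable f (stMeasure T d)) :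
    LocallyIntegrableOn f (Ioo 0 T ×ˢ univ) volume := by
  rw [stMeasure_eq] at hf
  exact IntegrableOn.locallyIntegrableOn hf

lemma _root_.MeasureTheory.LocallyIntegrableOn.clm_comp {X E F : Type*} [TopologicalSpace X]
    [MeasurableSpace X] [NormedAddCommGroup E] [NormedSpace ℝ E] [NormedAddCommGroup F]
    [NormedSpace ℝ F] {f : X → E} {s : Set X} {μ : Measure X} (hf : LocallyIntegrableOn f s μ)
    (l : E →L[ℝ] F) : LocallyIntegrableOn (fun x => l (f x)) s μ := fun x hx => by
  obtain ⟨u, hu, hi⟩ := hf x hx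
  exact ⟨u, hu, l.integrable_comp hi⟩

lemma _root_.MeasureTheory.LocallyIntegrableOn.vec_apply {X : Type*} [TopologicalSpace X]
    [MeasurableSpace X] {n : ℕ} {f : X → Vec n} {s : Set X} {μ : Measure X}
    (hf : LocallyIntegrableOn f s μ) (i : Fin n) : LocallyIntegrableOn (fun x => f x i) s μ :=
  hf.clm_comp (EuclideanSpace.proj (𝕜 := ℝ) i)

lemma _root_.MeasureTheory.Integrable.vec_apply {X : Type*} [MeasurableSpace X] {n : ℕ}
    {f : X → Vec n} {μ : Measure X} (hf : Integrable f μ) (i : Fin n) :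
    Integrable (fun x => f x i) μ :=
  (EuclideanSpace.proj (𝕜 := ℝ) i).integrable_comp hf

lemma IsTimeTest.integrable_mul {η : ℝ → ℝ} (hη : IsTimeTest T η) {f : ℝ × Torus d → ℝ}
    (hf : LocallyIntegrableOn f (Ioo 0 T ×ˢ univ) volume) :
    Integrable (fun z => η z.1 * f z) (stMeasure T d) := by
  have hK : IsCompact (tsupport η ×ˢ (univ : Set (Torus d))) :=
    hη.compact.isCompact.prod isCompact_univ
  have h1 : IntegrableOn f (tsupport η ×ˢ (univ : Set (Torus d))) volume :=
    hf.integrableOn_compact_subset (prod_mono_left hη.support) hK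
  obtain ⟨C, hC⟩ := hη.compact.exists_bound_of_continuous hη.smooth.continuous
  have h2 : IntegrableOn (fun z : ℝ × Torus d => η z.1 * f z) (tsupport η ×ˢ univ) volume :=
    Integrable.bdd_mul h1 (hη.smooth.continuous.comp continuous_fst).aestronglyMeasurable
      (Eventually.of_forall fun z => hC z.1)
  rw [integrableOn_iff_integrable_of_support_subset] at h2
  · rw [stMeasure_eq]
    exact h2.restrict
  · intro z hz
    refine ⟨subset_tsupport _ fun h0 => hz ?_, mem_univ _⟩
    simp [h0]

lemma integrable_bdd_cont_mul {f : ℝ × Torus d → ℝ} (hf : Integrable f (stMeasure T d))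
    {g : ℝ × Torus d → ℝ} (hg : Continuous g) : Integrable (fun z => g z * f z) (stMeasure T d) := by
  obtain ⟨C, hC⟩ := ((isCompact_Icc (a := (0 : ℝ)) (b := T)).prod
    (isCompact_univ (X := Torus d))).exists_bound_of_continuousOn hg.continuousOn
  refine hf.bdd_mul (c := C) hg.aestronglyMeasurable ?_
  filter_upwards [ae_mem_stMeasure T d] with z hz
  exact hC z ⟨Ioo_subset_Icc_self hz, mem_univ _⟩

/-- If all slices of an integrable function vanish a.e., so does the function. -/
lemma ae_eq_zero_of_ae_slice {f : ℝ × Torus d → ℝ} (hf : Integrable f (stMeasure T d))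
    (h : ∀ᵐ t, t ∈ Ioo 0 T → (fun x => f (t, x)) =ᵐ[volume] 0) : f =ᵐ[stMeasure T d] 0 := by
  have h1 : ∫ z, |f z| ∂stMeasure T d = 0 := by
    rw [stMeasure, integral_prod _ hf.abs]
    refine integral_eq_zero_of_ae ?_
    rw [EventuallyEq, ae_restrict_iff' measurableSet_Ioo]
    filter_upwards [h] with t ht hm
    refine integral_eq_zero_of_ae ?_
    filter_upwards [ht hm] with x hx
    simp [hx]
  rw [integral_eq_zero_iff_of_nonneg (fun x => abs_nonneg _) hf.abs] at h1
  filter_upwards [h1] with z hz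
  simpa using hz

lemma Mollifier.ae_eq_zero_of_slices (M : Mollifier d) {f : ℝ × Torus d → ℝ}
    (hf : Integrable f (stMeasure T d))
    (h : ∀ j k, ∀ᵐ t, t ∈ Ioo 0 T → ∫ x, M.g j k x * f (t, x) = 0) : f =ᵐ[stMeasure T d] 0 := by
  have h1 : ∀ᵐ t, ∀ j k, t ∈ Ioo 0 T → ∫ x, M.g j k x * f (t, x) = 0 := by
    rw [ae_all_iff]
    intro j
    rw [ae_all_iff]
    exact h j
  have h2 := hf.prod_right_ae
  rw [ae_restrict_iff' measurableSet_Ioo] at h2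
  refine ae_eq_zero_of_ae_slice hf ?_
  filter_upwards [h1, h2] with t ht1 ht2 hm
  exact M.ae_eq_zero (ht2 hm) fun j k => ht1 j k hm

lemma integrable_slice_mul {f : ℝ × Torus d → ℝ} (hf : Integrable f (stMeasure T d))
    {g : Torus d → ℝ} (hg : Continuous g) :
    IntegrableOn (fun t => ∫ x, g x * f (t, x)) (Ioo 0 T) ∧
      ∀ η : ℝ → ℝ, Continuous η → ∫ z, η z.1 * (g z.2 * f z) ∂stMeasure T d =
        ∫ t in Ioo 0 T, η t * ∫ x, g x * f (t, x) := by
  have h1 : Integrable (fun z : ℝ × Torus d => g z.2 * f z) (stMeasure T d) :=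
    integrable_bdd_cont_mul hf (hg.comp continuous_snd)
  refine ⟨h1.integral_prod_left, fun η hη => ?_⟩
  have h2 : Integrable (fun z : ℝ × Torus d => η z.1 * (g z.2 * f z)) (stMeasure T d) :=
    integrable_bdd_cont_mul h1 (hη.comp continuous_fst)
  rw [stMeasure, integral_prod _ h2]
  simp only [integral_const_mul]

/-- A fundamental lemma of the calculus of variations with product test functions. -/
lemma ae_eq_zero_of_integral_test (hT : 0 < T) {f : ℝ × Torus d → ℝ}
    (hf : LocallyIntegrableOn f (Ioo 0 T ×ˢ univ) volume)
    (h : ∀ η, IsTimeTest T η → ∀ g : Torus d → ℝ, SmoothX g →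
      ∫ z, η z.1 * (g z.2 * f z) ∂stMeasure T d = 0) : f =ᵐ[stMeasure T d] 0 := by
  obtain ⟨M⟩ := exists_mollifier d
  obtain ⟨θ, hθ, -, -, hθ1⟩ := exists_cutoff hT
  -- Since `f` is only locally integrable, it is first multiplied by cut-off functions in time,
  -- which are absorbed into the test functions.
  have key : ∀ k, (fun z => θ k z.1 * f z) =ᵐ[stMeasure T d] 0 := by
    intro k
    have hi := (hθ k).integrable_mul hf
    refine M.ae_eq_zero_of_slices hi fun j l => ?_
    obtain ⟨h1, h2⟩ := integrable_slice_mul hi (M.smooth_g j l).continuous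
    refine isOpen_Ioo.ae_eq_zero_of_integral_contDiff_smul_eq_zero h1.locallyIntegrableOn
      fun η a1 a2 a3 => ?_
    have h3 := h2 η a1.continuous
    have h4 := h _ ((hθ k).mul_left a1) _ (M.smooth_g j l)
    rw [← setIntegral_eq_integral_of_forall_compl_eq_zero (s := Ioo 0 T)]
    · simp only [smul_eq_mul]
      rw [← h3, ← h4]
      congr 1
      ext z
      ring
    · intro t ht
      rw [image_eq_zero_of_notMem_tsupport fun hm => ht (a3 hm), zero_smul]
  have h5 : ∀ᵐ z ∂stMeasure T d, ∀ k, θ k z.1 * f z = 0 := ae_all_iff.2 key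
  filter_upwards [h5, ae_mem_stMeasure T d] with z hz hm
  obtain ⟨k, hk⟩ := hθ1 z.1 hm
  have := hz k
  rwa [hk, one_mul] at this

lemma ae_eq_of_integral_test (hT : 0 < T) {f f' : ℝ × Torus d → ℝ}
    (hf : LocallyIntegrableOn f (Ioo 0 T ×ˢ univ) volume)
    (hf' : LocallyIntegrableOn f' (Ioo 0 T ×ˢ univ) volume)
    (h : ∀ η, IsTimeTest T η → ∀ g : Torus d → ℝ, SmoothX g →
      ∫ z, η z.1 * (g z.2 * f z) ∂stMeasure T d = ∫ z, η z.1 * (g z.2 * f' z) ∂stMeasure T d) :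
    f =ᵐ[stMeasure T d] f' := by
  have h1 := ae_eq_zero_of_integral_test hT (hf.sub hf') fun η hη g hg => by
    have e1 : ∀ z : ℝ × Torus d, η z.1 * (g z.2 * (f - f') z) =
        g z.2 * (η z.1 * f z) - g z.2 * (η z.1 * f' z) := fun z => by
      simp only [Pi.sub_apply]; ring
    simp only [e1]
    have hgc : Continuous fun z : ℝ × Torus d => g z.2 := hg.continuous.comp continuous_snd
    rw [integral_sub (integrable_bdd_cont_mul (hη.integrable_mul hf) hgc)
      (integrable_bdd_cont_mul (hη.integrable_mul hf') hgc), sub_eq_zero]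
    have := h η hη g hg
    simp only [mul_left_comm (g _)]
    exact this
  filter_upwards [h1] with z hz
  simp only [Pi.sub_apply, Pi.zero_apply] at hz
  linarith

lemma IsTimeTest.compactIn {η : ℝ → ℝ} (hη : IsTimeTest T η) {V : Type*} [Zero V]
    {φ : ℝ × Torus d → V} (h : ∀ z, η z.1 = 0 → φ z = 0) : CompactIn T φ := by
  have hs : tsupport φ ⊆ tsupport η ×ˢ univ := by
    refine closure_minimal (fun z hz => ⟨subset_tsupport _ fun h0 => hz (h z h0), mem_univ _⟩) ?_
    exact (isClosed_tsupport η).prod isClosed_univ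
  exact ⟨(hη.compact.isCompact.prod isCompact_univ).of_isClosed_subset (isClosed_tsupport φ) hs,
    hs.trans (prod_mono_left hη.support)⟩

/-- The scalar weak time derivative, tested with products. -/
def WeakDtScalar (T : ℝ) (u w : ℝ × Torus d → ℝ) : Prop :=
  ∀ η, IsTimeTest T η → ∀ g : Torus d → ℝ, SmoothX g →
    ∫ z, deriv η z.1 * (g z.2 * u z) ∂stMeasure T d = -∫ z, η z.1 * (g z.2 * w z) ∂stMeasure T d

lemma IsWeakDt.scalar {n : ℕ} {u w : ℝ × Torus d → Vec n} (h : IsWeakDt T u w) (i : Fin n) :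
    WeakDtScalar T (fun z => u z i) (fun z => w z i) := by
  intro η hη g hg
  set φ : ℝ × Torus d → Vec n := fun z => (η z.1 * g z.2) • EuclideanSpace.single i (1 : ℝ) with hφ
  have hs : SmoothTX φ :=
    ((smoothTX_time hη.smooth).mul hg.smoothTX).smul (smoothX_const _).smoothTX
  have h1 := h.2.2 φ hs (hη.compactIn fun z hz => by simp [hφ, hz])
  have hd : ∀ z, dtVec φ z = (deriv η z.1 * g z.2) • EuclideanSpace.single i (1 : ℝ) := by
    intro z
    exact (((hη.differentiable z.1).hasDerivAt.mul_const (g z.2)).smul_const _).deriv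
  simp only [hd] at h1
  simp only [hφ, inner_smul_right, EuclideanSpace.inner_single_right, conj_trivial,
    one_mul, mul_assoc] at h1
  exact h1

lemma IsWeakDt.ae_unique {n : ℕ} (hT : 0 < T) {u w w' : ℝ × Torus d → Vec n}
    (h : IsWeakDt T u w) (h' : IsWeakDt T u w') : w =ᵐ[stMeasure T d] w' := by
  have h1 : ∀ᵐ z ∂stMeasure T d, ∀ i, w z i = w' z i := by
    rw [ae_all_iff]
    intro i
    refine ae_eq_of_integral_test hT (h.2.1.vec_apply i) (h'.2.1.vec_apply i) fun η hη g hg => ?_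
    have := (h.scalar i η hη g hg).symm.trans (h'.scalar i η hη g hg)
    linarith
  filter_upwards [h1] with z hz
  ext i
  exact hz i

/-! ### Representation by primitives -/

/-- Right primitives in time of integrable functions are integrable on space-time. -/
lemma integrable_right_primitive {e : ℝ × Torus d → ℝ} (he : Integrable e (stMeasure T d)) :
    Integrable (fun z : ℝ × Torus d => ∫ s in z.1..T, e (s, z.2)) (stMeasure T d) := by
  set ν := (volume.restrict (Ioo 0 T) : Measure ℝ) with hν
  have h1 : Integrable (fun p : ℝ × (Torus d × ℝ) => e (p.2.2, p.2.1))
      (ν.prod ((volume : Measure (Torus d)).prod ν)) := (Integrable.swap he).comp_snd ν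
  have h2 : Integrable (fun p : (ℝ × Torus d) × ℝ => e (p.2, p.1.2))
      ((ν.prod (volume : Measure (Torus d))).prod ν) :=
    (measurePreserving_prodAssoc ν (volume : Measure (Torus d)) ν).integrable_comp_of_integrable h1
  -- The primitive is the integral over a second time variable `s`, with the indicator of `t < s`.
  have hm : MeasurableSet {p : (ℝ × Torus d) × ℝ | p.1.1 < p.2} :=
    measurableSet_lt (by fun_prop) (by fun_prop)
  have h3 := (h2.indicator hm).integral_prod_left
  refine h3.congr ?_
  change _ =ᵐ[stMeasure T d] _
  filter_upwards [ae_mem_stMeasure T d] with z hz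
  rw [intervalIntegral.integral_of_le hz.2.le, integral_Ioc_eq_integral_Ioo]
  have h4 : (fun s => {p : (ℝ × Torus d) × ℝ | p.1.1 < p.2}.indicator
      (fun p => e (p.2, p.1.2)) (z, s)) = (Ioi z.1).indicator fun s => e (s, z.2) := by
    ext s
    simp only [indicator, mem_ofPred_eq, mem_Ioi]
  rw [h4, integral_indicator measurableSet_Ioi, hν, Measure.restrict_restrict measurableSet_Ioi]
  congr 2
  ext s
  simp only [mem_inter_iff, mem_Ioi, mem_Ioo]
  constructor
  · rintro ⟨h5, h6⟩
    exact ⟨h5, h6.2⟩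
  · rintro ⟨h5, h6⟩
    exact ⟨h5, hz.1.trans h5, h6⟩

lemma integral_mul_right_primitive {e : ℝ × Torus d → ℝ} (he : Integrable e (stMeasure T d))
    {g : Torus d → ℝ} (hg : Continuous g) {t : ℝ} (ht : t ∈ Icc 0 T) :
    ∫ x, g x * ∫ s in t..T, e (s, x) = ∫ s in t..T, ∫ x, g x * e (s, x) := by
  have h1 : Integrable (fun z : ℝ × Torus d => g z.2 * e z)
      ((volume.restrict (Ioc t T)).prod volume) := by
    have := integrable_bdd_cont_mul he (hg.comp continuous_snd)
    refine this.mono_measure ?_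
    unfold stMeasure
    refine Measure.prod_mono ?_ le_rfl
    rw [restrict_Ioo_eq_restrict_Ioc]
    exact Measure.restrict_mono (Ioc_subset_Ioc_left ht.1) le_rfl
  simp only [intervalIntegral.integral_of_le ht.2]
  rw [integral_integral_swap h1]
  simp only [integral_const_mul]

/-- A function on space-time with integrable weak time derivative that is small at the final time
is a primitive in time. -/
lemma WeakDtScalar.ae_eq (hT : 0 < T) {a e : ℝ × Torus d → ℝ} (ha : Integrable a (stMeasure T d))
    (he : Integrable e (stMeasure T d))
    (hi : Integrable (fun z => (T - z.1)⁻¹ * a z) (stMeasure T d)) (h : WeakDtScalar T a e) :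
    ∀ᵐ z ∂stMeasure T d, a z = -∫ s in z.1..T, e (s, z.2) := by
  obtain ⟨M⟩ := exists_mollifier d
  have hp := integrable_right_primitive he
  -- Pairing in space with each `g j k` reduces the claim to functions of time alone; the pairings
  -- determine the sum of `a` and its primitive on almost every slice.
  have h1 := M.ae_eq_zero_of_slices (ha.add hp) fun j k => by
    have hg := (M.smooth_g j k).continuous
    obtain ⟨a1, a2⟩ := integrable_slice_mul ha hg
    obtain ⟨b1, b2⟩ := integrable_slice_mul he hg
    obtain ⟨c1, -⟩ := integrable_slice_mul hi hg
    have h2 := ae_eq_neg_integral_of_weak_deriv hT a1 b1 (by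
      refine c1.congr (Eventually.of_forall fun t => ?_)
      dsimp only
      rw [← integral_const_mul]
      congr 1
      ext x
      ring) fun η hη => by
        rw [← a2 _ hη.deriv.smooth.continuous, ← b2 _ hη.smooth.continuous]
        exact h η hη _ (M.smooth_g j k)
    have h3 := ha.prod_right_ae
    have h4 := hp.prod_right_ae
    rw [ae_restrict_iff' measurableSet_Ioo] at h3 h4
    filter_upwards [h2, h3, h4] with t ht1 ht3 ht4 hm
    have h5 := ht1 hm
    rw [← integral_mul_right_primitive he hg (Ioo_subset_Icc_self hm)] at h5
    simp only [Pi.add_apply, mul_add]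
    rw [integral_add (Mollifier.integrable_cont_mul (ht3 hm) hg)
      (Mollifier.integrable_cont_mul (ht4 hm) hg), h5]
    ring
  filter_upwards [h1] with z hz
  simp only [Pi.add_apply, Pi.zero_apply] at hz
  linarith

lemma ae_intervalIntegrable_slice {E : Type*} [NormedAddCommGroup E] (hT : 0 < T)
    {e : ℝ × Torus d → E} (he : Integrable e (stMeasure T d)) :
    ∀ᵐ x, IntervalIntegrable (fun s => e (s, x)) volume 0 T := by
  filter_upwards [he.prod_left_ae] with x hx
  exact intervalIntegrable_of_integrableOn_Ioo hT hx

lemma intervalIntegral_vec_apply {n : ℕ} {e : ℝ → Vec n} {a b : ℝ}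
    (he : IntervalIntegrable e volume a b) (i : Fin n) :
    (∫ s in a..b, e s) i = ∫ s in a..b, e s i :=
  ((EuclideanSpace.proj (𝕜 := ℝ) i).intervalIntegral_comp_comm he).symm

lemma ae_stMeasure_of_ae_snd {p : Torus d → Prop} (h : ∀ᵐ x, p x) :
    ∀ᵐ z ∂stMeasure T d, p z.2 :=
  Measure.quasiMeasurePreserving_snd.ae h

lemma IsWeakDt.ae_eq {n : ℕ} (hT : 0 < T) {a e : ℝ × Torus d → Vec n}
    (ha : Integrable a (stMeasure T d)) (he : Integrable e (stMeasure T d))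
    (hi : Integrable (fun z => (T - z.1)⁻¹ • a z) (stMeasure T d)) (h : IsWeakDt T a e) :
    ∀ᵐ z ∂stMeasure T d, a z = -∫ s in z.1..T, e (s, z.2) := by
  have h1 : ∀ᵐ z ∂stMeasure T d, ∀ i, a z i = -∫ s in z.1..T, e (s, z.2) i :=
    ae_all_iff.2 fun i => (h.scalar i).ae_eq hT (ha.vec_apply i) (he.vec_apply i) (hi.vec_apply i)
  filter_upwards [h1, ae_stMeasure_of_ae_snd (ae_intervalIntegrable_slice hT he),
    ae_mem_stMeasure T d] with z hz1 hz2 hz3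
  ext i
  rw [hz1 i, PiLp.neg_apply, intervalIntegral_vec_apply]
  refine hz2.mono_set ?_
  rw [uIcc_of_le hz3.2.le, uIcc_of_le (hz3.1.trans hz3.2).le]
  exact Icc_subset_Icc_left hz3.1.le

lemma ae_time_ae_space {p : ℝ × Torus d → Prop} (h : ∀ᵐ z ∂stMeasure T d, p z) :
    ∀ᵐ t, t ∈ Ioo 0 T → ∀ᵐ x, p (t, x) := by
  have := Measure.ae_ae_of_ae_prod h
  rwa [ae_restrict_iff' measurableSet_Ioo] at this

lemma ae_space_ae_time {p : ℝ × Torus d → Prop} (h : ∀ᵐ z ∂stMeasure T d, p z) :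
    ∀ᵐ x, ∀ᵐ t, t ∈ Ioo 0 T → p (t, x) := by
  have h1 : ∀ᵐ z ∂((volume : Measure (Torus d)).prod (volume.restrict (Ioo 0 T))), p z.swap := by
    have h2 : Measure.QuasiMeasurePreserving Prod.swap
        ((volume : Measure (Torus d)).prod (volume.restrict (Ioo 0 T))) (stMeasure T d) :=
      Measure.measurePreserving_swap.quasiMeasurePreserving
    exact h2.ae h
  have := Measure.ae_ae_of_ae_prod h1
  filter_upwards [this] with x hx
  rwa [ae_restrict_iff' measurableSet_Ioo] at hx

end SpaceTime


/-! ### The Frobenius product -/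

section Frob

variable {N : ℕ}

lemma frob_comm (A B : Mat N) : frob A B = frob B A := by
  simp only [frob, mul_comm]

lemma frob_add_left (A A' B : Mat N) : frob (A + A') B = frob A B + frob A' B := by
  simp only [frob, Matrix.add_apply, add_mul, Finset.sum_add_distrib]

lemma frob_add_right (A B B' : Mat N) : frob A (B + B') = frob A B + frob A B' := by
  rw [frob_comm, frob_add_left, frob_comm B, frob_comm B']

lemma frob_smul_left (c : ℝ) (A B : Mat N) : frob (c • A) B = c * frob A B := by
  simp only [frob, Matrix.smul_apply, smul_eq_mul, Finset.mul_sum, mul_assoc]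

lemma frob_smul_right (c : ℝ) (A B : Mat N) : frob A (c • B) = c * frob A B := by
  rw [frob_comm, frob_smul_left, frob_comm]

lemma frob_sub_left (A A' B : Mat N) : frob (A - A') B = frob A B - frob A' B := by
  simp only [frob, Matrix.sub_apply, sub_mul, Finset.sum_sub_distrib]

lemma frob_sub_right (A B B' : Mat N) : frob A (B - B') = frob A B - frob A B' := by
  rw [frob_comm, frob_sub_left, frob_comm B, frob_comm B']

lemma frob_one_right (A : Mat N) : frob A 1 = A.trace := by
  simp [frob, Matrix.trace, Matrix.one_apply]

lemma frob_zero_left (A : Mat N) : frob 0 A = 0 := by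
  simp [frob]

lemma inner_matVec (A B : Mat N) : inner ℝ (matVec N A) (matVec N B) = frob A B := by
  simp only [frob, PiLp.inner_apply, Fintype.sum_prod_type]
  refine Finset.sum_congr rfl fun l _ => Finset.sum_congr rfl fun m _ => ?_
  exact mul_comm _ _

/-- The symmetrized unit matrices. -/
def symUnit (l m : Fin N) : Mat N :=
  Matrix.of fun a b => ((if a = l ∧ b = m then 1 else 0) + (if a = m ∧ b = l then 1 else 0)) / 2

lemma symUnit_isSymm (l m : Fin N) : (symUnit l m).IsSymm := by
  ext a b
  simp only [symUnit, Matrix.transpose_apply, Matrix.of_apply]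
  rw [add_comm]
  simp only [and_comm]

lemma frob_symUnit (A : Mat N) (l m : Fin N) : frob A (symUnit l m) = (A l m + A m l) / 2 := by
  have h : ∀ l m : Fin N, ∑ a, ∑ b, A a b * (if a = l ∧ b = m then (1 : ℝ) else 0) = A l m := by
    intro l m
    simp only [mul_ite, mul_one, mul_zero, ite_and]
    simp
  simp only [frob, symUnit, Matrix.of_apply, mul_div_assoc', mul_add, ← Finset.sum_div,
    Finset.sum_add_distrib, h]

lemma frob_symUnit_of_isSymm {A : Mat N} (hA : A.IsSymm) (l m : Fin N) :
    frob A (symUnit l m) = A l m := by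
  rw [frob_symUnit, hA.apply l m]
  ring

/-- The symmetric part. -/
def symPart (A : Mat N) : Mat N := (1 / 2 : ℝ) • (A + A.transpose)

lemma symPart_isSymm (A : Mat N) : (symPart A).IsSymm := by
  ext l m
  simp only [symPart, Matrix.transpose_apply, Matrix.smul_apply, Matrix.add_apply, add_comm]

lemma frob_transpose_right {A : Mat N} (hA : A.IsSymm) (B : Mat N) :
    frob A B.transpose = frob A B := by
  simp only [frob, Matrix.transpose_apply]
  rw [Finset.sum_comm]
  refine Finset.sum_congr rfl fun l _ => Finset.sum_congr rfl fun m _ => ?_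
  rw [hA.apply l m]

lemma frob_symPart {A : Mat N} (hA : A.IsSymm) (B : Mat N) : frob A (symPart B) = frob A B := by
  rw [symPart, frob_smul_right, frob_add_right, frob_transpose_right hA]
  ring

end Frob

/-! ### Weak values of `L*` -/

section WeakLstar

variable {d : ℕ} {T : ℝ}

lemma locallyIntegrableOn_sum {X ι : Type*} [TopologicalSpace X] [MeasurableSpace X]
    {f : ι → X → ℝ} {s : Set X} {μ : Measure X} (t : Finset ι)
    (hf : ∀ i, LocallyIntegrableOn (f i) s μ) :
    LocallyIntegrableOn (fun x => ∑ i ∈ t, f i x) s μ := by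
  classical
  induction t using Finset.induction_on with
  | empty =>
    simp only [Finset.sum_empty]
    exact fun x _ => ⟨univ, univ_mem, integrableOn_zero⟩
  | insert a t ha ih =>
    simp only [Finset.sum_insert ha]
    exact (hf a).add ih

lemma isOpen_strip (T : ℝ) (d : ℕ) : IsOpen (Ioo 0 T ×ˢ (univ : Set (Torus d))) :=
  isOpen_Ioo.prod isOpen_univ

lemma locallyIntegrableOn_mul_cont {f φ : ℝ × Torus d → ℝ}
    (hf : LocallyIntegrableOn f (Ioo 0 T ×ˢ univ) volume) (hφ : Continuous φ) :
    LocallyIntegrableOn (fun z => f z * φ z) (Ioo 0 T ×ˢ univ) volume :=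
  hf.mul_continuousOn hφ.continuousOn (isOpen_strip T d).isLocallyClosed

lemma inner_eq_sum {n : ℕ} (u w : Vec n) : inner ℝ u w = ∑ i, u i * w i := by
  rw [PiLp.inner_apply]
  refine Finset.sum_congr rfl fun i _ => ?_
  simp [mul_comm]

lemma integrable_mul_of_compactIn {f φ : ℝ × Torus d → ℝ}
    (hf : LocallyIntegrableOn f (Ioo 0 T ×ˢ univ) volume) (hφ : Continuous φ)
    (hc : CompactIn T φ) : Integrable (fun z => f z * φ z) (stMeasure T d) := by
  have h1 : IntegrableOn f (tsupport φ) volume := hf.integrableOn_compact_subset hc.2 hc.1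
  obtain ⟨C, hC⟩ := hc.1.exists_bound_of_continuous hφ
  have h2 : IntegrableOn (fun z => f z * φ z) (tsupport φ) volume :=
    Integrable.mul_bdd h1 hφ.aestronglyMeasurable (Eventually.of_forall hC)
  rw [integrableOn_iff_integrable_of_support_subset] at h2
  · rw [stMeasure_eq]
    exact h2.restrict
  · intro z hz
    refine subset_tsupport _ fun h0 => hz ?_
    simp [h0]

/-- If a function is orthogonal to all time test functions, its space integrals vanish. -/
lemma ae_integral_slice_eq_zero (hT : 0 < T) {f : ℝ × Torus d → ℝ}
    (hf : LocallyIntegrableOn f (Ioo 0 T ×ˢ univ) volume)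
    (h : ∀ η, IsTimeTest T η → ∫ z, η z.1 * f z ∂stMeasure T d = 0) :
    ∀ᵐ t, t ∈ Ioo 0 T → ∫ x, f (t, x) = 0 := by
  obtain ⟨θ, hθ, -, -, hθ1⟩ := exists_cutoff hT
  have key : ∀ k, ∀ᵐ t, t ∈ Ioo 0 T → ∫ x, θ k t * f (t, x) = 0 := by
    intro k
    have hi := (hθ k).integrable_mul hf
    refine isOpen_Ioo.ae_eq_zero_of_integral_contDiff_smul_eq_zero
      (IntegrableOn.locallyIntegrableOn hi.integral_prod_left) fun η a1 a2 a3 => ?_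
    have h2 : Integrable (fun z : ℝ × Torus d => η z.1 * (θ k z.1 * f z)) (stMeasure T d) :=
      integrable_bdd_cont_mul hi (a1.continuous.comp continuous_fst)
    have h3 := h _ ((hθ k).mul_left a1)
    simp only [mul_assoc] at h3
    rw [stMeasure, integral_prod _ h2] at h3
    rw [← setIntegral_eq_integral_of_forall_compl_eq_zero (s := Ioo 0 T)]
    · simp only [integral_const_mul] at h3
      simpa only [smul_eq_mul, integral_const_mul] using h3
    · intro t ht
      rw [image_eq_zero_of_notMem_tsupport fun hm => ht (a3 hm), zero_smul]
  filter_upwards [ae_all_iff.2 key] with t ht hm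
  obtain ⟨k, hk⟩ := hθ1 t hm
  have := ht k hm
  simpa [hk] using this

lemma integral_time_mul_eq_zero {f : ℝ × Torus d → ℝ}
    (h : ∀ᵐ t, t ∈ Ioo 0 T → ∫ x, f (t, x) = 0) {c : ℝ → ℝ}
    (hi : Integrable (fun z => c z.1 * f z) (stMeasure T d)) :
    ∫ z, c z.1 * f z ∂stMeasure T d = 0 := by
  unfold stMeasure at hi ⊢
  rw [integral_prod _ hi]
  refine integral_eq_zero_of_ae ?_
  rw [EventuallyEq, ae_restrict_iff' measurableSet_Ioo]
  filter_upwards [h] with t ht hm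
  simp [integral_const_mul, ht hm]

end WeakLstar

lemma SmoothSymTX.smul {d N : ℕ} {Ψ : ℝ × Torus d → Mat N} (hΨ : SmoothSymTX Ψ) {η : ℝ → ℝ}
    (hη : ContDiff ℝ ∞ η) : SmoothSymTX fun z => η z.1 • Ψ z :=
  ⟨fun l m => (smoothTX_time hη).mul (hΨ.1 l m), fun z => (hΨ.2 z).smul _⟩

lemma smoothSymTX_const {d N : ℕ} {g : Torus d → ℝ} (hg : SmoothX g) {A : Mat N}
    (hA : A.IsSymm) : SmoothSymTX fun z : ℝ × Torus d => g z.2 • A :=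
  ⟨fun l m => hg.smoothTX.mul (smoothX_const (A l m)).smoothTX, fun _ => hA.smul _⟩

lemma SmoothSymTX.dtMat {d N : ℕ} {Ψ : ℝ × Torus d → Mat N} (hΨ : SmoothSymTX Ψ) :
    SmoothSymTX (dtMat Ψ) := by
  refine ⟨fun l m => (hΨ.1 l m).deriv_time, fun z => ?_⟩
  ext l m
  simp only [DualConsistency.dtMat, Matrix.transpose_apply, Matrix.of_apply]
  congr 1
  ext s
  exact ((hΨ.2 (s, z.2)).apply l m)

namespace System

variable {d n N : ℕ} (S : System d n N) {T : ℝ}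

lemma L_slice_smul (η : ℝ → ℝ) (Ψ : ℝ × Torus d → Mat N) (z : ℝ × Torus d) :
    S.L (fun y => η z.1 • Ψ (z.1, y)) z.2 = η z.1 • S.L (fun y => Ψ (z.1, y)) z.2 :=
  S.L_smul _ _ _

/-- The defect in the weak formulation of `G = L* u`. -/
def defect (u : ℝ × Torus d → Vec n) (G Ψ : ℝ × Torus d → Mat N) (z : ℝ × Torus d) : ℝ :=
  inner ℝ (u z) (S.L (fun y => Ψ (z.1, y)) z.2) - frob (G z) (Ψ z)

lemma locallyIntegrableOn_inner {u φ : ℝ × Torus d → Vec n}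
    (hu : LocallyIntegrableOn u (Ioo 0 T ×ˢ univ) volume) (hφ : Continuous φ) :
    LocallyIntegrableOn (fun z => inner ℝ (u z) (φ z)) (Ioo 0 T ×ˢ univ) volume := by
  simp only [inner_eq_sum]
  exact locallyIntegrableOn_sum _ fun i => locallyIntegrableOn_mul_cont (hu.vec_apply i)
    ((EuclideanSpace.proj (𝕜 := ℝ) i).continuous.comp hφ)

lemma locallyIntegrableOn_frob {G Ψ : ℝ × Torus d → Mat N}
    (hG : ∀ l m, LocallyIntegrableOn (fun z => G z l m) (Ioo 0 T ×ˢ univ) volume)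
    (hΨ : ∀ l m, Continuous fun z => Ψ z l m) :
    LocallyIntegrableOn (fun z => frob (G z) (Ψ z)) (Ioo 0 T ×ˢ univ) volume :=
  locallyIntegrableOn_sum _ fun l => locallyIntegrableOn_sum _ fun m =>
    locallyIntegrableOn_mul_cont (hG l m) (hΨ l m)

lemma locallyIntegrableOn_defect {u : ℝ × Torus d → Vec n} {G Ψ : ℝ × Torus d → Mat N}
    (hu : LocallyIntegrableOn u (Ioo 0 T ×ˢ univ) volume)
    (hG : ∀ l m, LocallyIntegrableOn (fun z => G z l m) (Ioo 0 T ×ˢ univ) volume)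
    (hΨ : SmoothSymTX Ψ) :
    LocallyIntegrableOn (S.defect u G Ψ) (Ioo 0 T ×ˢ univ) volume :=
  (locallyIntegrableOn_inner hu (S.smoothTX_L hΨ.1).continuous).sub
    (locallyIntegrableOn_frob hG fun l m => (hΨ.1 l m).continuous)

/-- `L` acts in space only, so time factors pass through it. Varying the factor localizes the weak
identity to almost every time, for each fixed `Ψ`, with no condition on `Ψ` near `0` and `T`. -/
lemma IsWeakLstar.ae_integral_defect {S : System d n N} (hT : 0 < T) {u : ℝ × Torus d → Vec n}
    {G Ψ : ℝ × Torus d → Mat N} (h : S.IsWeakLstar T u G) (hΨ : SmoothSymTX Ψ) :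
    ∀ᵐ t, t ∈ Ioo 0 T → ∫ x, S.defect u G Ψ (t, x) = 0 := by
  refine ae_integral_slice_eq_zero hT (S.locallyIntegrableOn_defect h.1 h.2.1 hΨ) fun η hη => ?_
  have h1 := h.2.2.2 _ (hΨ.smul hη.smooth) (hη.compactIn fun _ hz => by simp [hz])
  simp only [S.L_slice_smul, inner_smul_right, frob_smul_right] at h1
  have e1 := hη.integrable_mul (locallyIntegrableOn_inner h.1 (S.smoothTX_L hΨ.1).continuous)
  have e2 := hη.integrable_mul
    (locallyIntegrableOn_frob h.2.1 fun l m => (hΨ.1 l m).continuous)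
  simp only [defect, mul_sub]
  rw [integral_sub e1 e2, h1, sub_self]

/-- Weak values of `L*` may be multiplied by functions of time. -/
lemma IsWeakLstar.time_mul {S : System d n N} (hT : 0 < T) {u u' : ℝ × Torus d → Vec n}
    {G G' : ℝ × Torus d → Mat N} (h : S.IsWeakLstar T u G) (c : ℝ → ℝ)
    (hu : ∀ z, u' z = c z.1 • u z) (hG : ∀ z, G' z = c z.1 • G z)
    (hul : LocallyIntegrableOn u' (Ioo 0 T ×ˢ univ) volume)
    (hGl : ∀ l m, LocallyIntegrableOn (fun z => G' z l m) (Ioo 0 T ×ˢ univ) volume) :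
    S.IsWeakLstar T u' G' := by
  refine ⟨hul, hGl, ?_, fun Ψ hΨ hc => ?_⟩
  · filter_upwards [h.2.2.1] with z hz
    rw [hG]
    exact hz.smul _
  -- A time slice on which `Ψ` vanishes is mapped to zero by `L`; hence the time projection of the
  -- support is preserved, which is enough for integrability of each term separately.
  have hLc : ∀ i, CompactIn T fun z : ℝ × Torus d => S.L (fun y => Ψ (z.1, y)) z.2 i := by
    intro i
    have hs : tsupport (fun z : ℝ × Torus d => S.L (fun y => Ψ (z.1, y)) z.2 i) ⊆
        (Prod.fst '' tsupport Ψ) ×ˢ univ := by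
      refine closure_minimal (fun z hz => ⟨?_, mem_univ _⟩)
        ((hc.1.isCompact.image continuous_fst).isClosed.prod isClosed_univ)
      by_contra hcon
      apply hz
      have : (fun y => Ψ (z.1, y)) = fun _ => 0 := by
        ext1 y
        exact image_eq_zero_of_notMem_tsupport fun hm => hcon ⟨_, hm, rfl⟩
      dsimp only
      rw [this, S.L_zero]
      rfl
    refine ⟨((hc.1.isCompact.image continuous_fst).prod isCompact_univ).of_isClosed_subset
      (isClosed_tsupport _) hs, hs.trans (prod_mono_left ?_)⟩
    rintro _ ⟨z, hz, rfl⟩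
    exact (hc.2 hz).1
  have hΨc : ∀ l m, CompactIn T fun z => Ψ z l m := by
    intro l m
    have hs : tsupport (fun z => Ψ z l m) ⊆ tsupport Ψ := by
      refine closure_mono fun z hz h0 => hz ?_
      simp [h0]
    exact ⟨hc.1.isCompact.of_isClosed_subset (isClosed_tsupport _) hs, hs.trans hc.2⟩
  have e1 : Integrable (fun z : ℝ × Torus d => inner ℝ (u' z) (S.L (fun y => Ψ (z.1, y)) z.2))
      (stMeasure T d) := by
    simp only [inner_eq_sum]
    exact integrable_finsetSum _ fun i _ => integrable_mul_of_compactIn (hul.vec_apply i)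
      (smoothTX_vec_iff.1 (S.smoothTX_L hΨ.1) i).continuous (hLc i)
  have e2 : Integrable (fun z => frob (G' z) (Ψ z)) (stMeasure T d) :=
    integrable_finsetSum _ fun l _ => integrable_finsetSum _ fun m _ =>
      integrable_mul_of_compactIn (hGl l m) (hΨ.1 l m).continuous (hΨc l m)
  have e3 : ∀ z : ℝ × Torus d, inner ℝ (u' z) (S.L (fun y => Ψ (z.1, y)) z.2) -
      frob (G' z) (Ψ z) = c z.1 * S.defect u G Ψ z := by
    intro z
    rw [hu, hG, real_inner_smul_left, frob_smul_left, defect, mul_sub]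
  have e4 := integral_time_mul_eq_zero (h.ae_integral_defect hT hΨ)
    ((e1.sub e2).congr (Eventually.of_forall e3))
  rw [← sub_eq_zero, ← integral_sub e1 e2, ← e4]
  exact integral_congr_ae (Eventually.of_forall e3)

lemma IsWeakLstar.ae_unique {S : System d n N} (hT : 0 < T) {u : ℝ × Torus d → Vec n}
    {G G' : ℝ × Torus d → Mat N} (h : S.IsWeakLstar T u G) (h' : S.IsWeakLstar T u G') :
    G =ᵐ[stMeasure T d] G' := by
  have h1 : ∀ l m, (fun z => frob (G z) (symUnit l m)) =ᵐ[stMeasure T d]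
      fun z => frob (G' z) (symUnit l m) := by
    intro l m
    refine ae_eq_of_integral_test hT (locallyIntegrableOn_frob h.2.1 fun _ _ => continuous_const)
      (locallyIntegrableOn_frob h'.2.1 fun _ _ => continuous_const) fun η hη g hg => ?_
    have hs : SmoothSymTX fun z : ℝ × Torus d => η z.1 • g z.2 • (symUnit l m : Mat N) :=
      (smoothSymTX_const hg (symUnit_isSymm l m)).smul hη.smooth
    have hc : CompactIn T fun z : ℝ × Torus d => η z.1 • g z.2 • (symUnit l m : Mat N) :=
      hη.compactIn fun z hz => by simp [hz]
    have e1 := h.2.2.2 _ hs hc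
    have e2 := h'.2.2.2 _ hs hc
    rw [e1] at e2
    simpa only [frob_smul_right] using e2
  have h2 : ∀ᵐ z ∂stMeasure T d, ∀ l m, frob (G z) (symUnit l m) = frob (G' z) (symUnit l m) := by
    rw [ae_all_iff]
    intro l
    rw [ae_all_iff]
    exact h1 l
  filter_upwards [h2, h.2.2.1, h'.2.2.1] with z hz hs hs'
  ext l m
  have := hz l m
  rwa [frob_symUnit_of_isSymm hs, frob_symUnit_of_isSymm hs'] at this

/-! ### The constraint -/

/-- Integration by parts in time for almost every `x`. Both boundary terms vanish: the primitive is
zero at `T` and the test function is zero at `0`. -/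
lemma integral_primitive_mul_dt (hT : 0 < T) {a e φ : ℝ × Torus d → ℝ}
    (ha : Integrable a (stMeasure T d)) (he : Integrable e (stMeasure T d))
    (hae : ∀ᵐ z ∂stMeasure T d, a z = -∫ s in z.1..T, e (s, z.2)) (hφ : SmoothTX φ)
    (h0 : ∀ x, φ (0, x) = 0) :
    ∫ z, a z * deriv (fun s => φ (s, z.2)) z.1 ∂stMeasure T d = -∫ z, e z * φ z ∂stMeasure T d := by
  have e1 : Integrable (fun z => a z * deriv (fun s => φ (s, z.2)) z.1) (stMeasure T d) := by
    simpa only [mul_comm] using integrable_bdd_cont_mul ha hφ.deriv_time.continuous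
  have e2 : Integrable (fun z => e z * φ z) (stMeasure T d) := by
    simpa only [mul_comm] using integrable_bdd_cont_mul he hφ.continuous
  unfold stMeasure at e1 e2 ⊢
  rw [integral_prod_symm _ e1, integral_prod_symm _ e2, ← integral_neg]
  refine integral_congr_ae ?_
  filter_upwards [ae_space_ae_time hae, ae_intervalIntegrable_slice hT he] with x hx1 hx2
  have h1 := integral_primitive_mul_deriv hx2 (hφ.contDiff_time x)
  rw [h0, mul_zero, neg_zero, zero_add] at h1
  rw [setIntegral_Ioo_eq hT (e := fun t => e (t, x) * φ (t, x)), ← h1, ← setIntegral_Ioo_eq hT,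
    ← integral_neg]
  refine setIntegral_congr_ae measurableSet_Ioo ?_
  filter_upwards [hx1] with t ht hm
  rw [ht hm]
  ring

/-- Formally `∂ₜ B = ∂ₜ L* a = L* E`. The weak identity on slices is applied to `∂ₜ Ψ`, then `L ∂ₜ Ψ
= ∂ₜ L Ψ` is integrated by parts. The terminal condition on `B` is encoded in `a` being a primitive
from `T`. -/
lemma constraint_of_weak (hT : 0 < T) {a E : ℝ × Torus d → Vec n} {B : ℝ × Torus d → Mat N}
    (ha : Integrable a (stMeasure T d)) (hE : Integrable E (stMeasure T d))
    (hB : ∀ l m, Integrable (fun z => B z l m) (stMeasure T d))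
    (haE : ∀ᵐ z ∂stMeasure T d, a z = -∫ s in z.1..T, E (s, z.2))
    (h : S.IsWeakLstar T a B) : S.Constraint T E B := by
  intro Ψ hΨ h0
  have hL := S.smoothTX_L hΨ.1
  have hLc := smoothTX_vec_iff.1 hL
  have hdt := hΨ.dtMat
  have i1 : Integrable (fun z : ℝ × Torus d => inner ℝ (E z) (S.L (fun y => Ψ (z.1, y)) z.2))
      (stMeasure T d) := by
    simp only [inner_eq_sum]
    refine integrable_finsetSum _ fun i _ => ?_
    simpa only [mul_comm] using integrable_bdd_cont_mul (hE.vec_apply i) (hLc i).continuous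
  have i2 : Integrable (fun z => frob (B z) (dtMat Ψ z)) (stMeasure T d) := by
    refine integrable_finsetSum _ fun l _ => integrable_finsetSum _ fun m _ => ?_
    simpa only [mul_comm] using integrable_bdd_cont_mul (hB l m) (hdt.1 l m).continuous
  have i3 : Integrable (fun z : ℝ × Torus d => inner ℝ (a z)
      (S.L (fun y => dtMat Ψ (z.1, y)) z.2)) (stMeasure T d) := by
    simp only [inner_eq_sum]
    refine integrable_finsetSum _ fun i _ => ?_
    simpa only [mul_comm] using integrable_bdd_cont_mul (ha.vec_apply i)
      (smoothTX_vec_iff.1 (S.smoothTX_L hdt.1) i).continuous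
  have e1 : ∫ z, frob (B z) (dtMat Ψ z) ∂stMeasure T d =
      ∫ z, inner ℝ (a z) (S.L (fun y => dtMat Ψ (z.1, y)) z.2) ∂stMeasure T d := by
    have := integral_time_mul_eq_zero (c := fun _ => 1) (h.ae_integral_defect hT hdt)
      (by
        simp only [one_mul]
        exact i3.sub i2)
    simp only [one_mul, defect] at this
    rw [integral_sub i3 i2, sub_eq_zero] at this
    exact this.symm
  have hcomp : ∀ᵐ z ∂stMeasure T d, ∀ i, a z i = -∫ s in z.1..T, E (s, z.2) i := by
    filter_upwards [haE, ae_stMeasure_of_ae_snd (ae_intervalIntegrable_slice hT hE),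
      ae_mem_stMeasure T d] with z hz1 hz2 hz3 i
    rw [hz1, PiLp.neg_apply, intervalIntegral_vec_apply]
    refine hz2.mono_set ?_
    rw [uIcc_of_le hz3.2.le, uIcc_of_le (hz3.1.trans hz3.2).le]
    exact Icc_subset_Icc_left hz3.1.le
  have e2 : ∫ z, inner ℝ (a z) (S.L (fun y => dtMat Ψ (z.1, y)) z.2) ∂stMeasure T d =
      -∫ z, inner ℝ (E z) (S.L (fun y => Ψ (z.1, y)) z.2) ∂stMeasure T d := by
    simp only [← S.dtVec_L hΨ.1, inner_eq_sum, SmoothTX.dtVec_apply hL]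
    rw [integral_finsetSum, integral_finsetSum, ← Finset.sum_neg_distrib]
    · refine Finset.sum_congr rfl fun i _ => ?_
      refine integral_primitive_mul_dt hT (ha.vec_apply i) (hE.vec_apply i)
        (hcomp.mono fun _ hz => hz i) (hLc i) fun x => ?_
      have : (fun y => Ψ ((0 : ℝ), y)) = fun _ => 0 := funext h0
      simp only [this, S.L_zero]
      rfl
    · intro i _
      simpa only [mul_comm] using integrable_bdd_cont_mul (hE.vec_apply i) (hLc i).continuous
    · intro i _
      simpa only [mul_comm] using integrable_bdd_cont_mul (ha.vec_apply i) (hLc i).deriv_time.continuous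
  rw [integral_add i2 i1, e1, e2, neg_add_cancel]

/-! ### `L*` on smooth fields and the space `Λ` -/

/-- The reflection `y ↦ -y` produces the signs `(-1)^j` of the adjoint, and the symmetry of `A`
undoes the symmetrization of the coefficients. Statements about `L*` thereby reduce to statements
about `L`. -/
lemma frob_Lstar_eq {u : Torus d → Vec n} {A : Mat N} (hA : A.IsSymm) (x : Torus d) :
    frob (S.Lstar u x) A = ∑ i, S.L (fun y => u (-y) i • A) (-x) i := by
  have h1 : ∀ (b : Fin N → Fin N → ℝ), ∑ l, ∑ m, (b l m + b m l) / 2 * A l m =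
      ∑ l, ∑ m, b l m * A l m := by
    intro b
    have h2 : ∑ l, ∑ m, b m l * A l m = ∑ l, ∑ m, b l m * A l m := by
      rw [Finset.sum_comm]
      refine Finset.sum_congr rfl fun l _ => Finset.sum_congr rfl fun m _ => ?_
      rw [hA.apply l m]
    have h3 : ∑ l, ∑ m, (b l m + b m l) / 2 * A l m =
        (∑ l, ∑ m, b l m * A l m + ∑ l, ∑ m, b m l * A l m) / 2 := by
      simp only [← Finset.sum_add_distrib, Finset.sum_div]
      refine Finset.sum_congr rfl fun l _ => Finset.sum_congr rfl fun m _ => by ring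
    rw [h3, h2]
    ring
  have h4 : ∀ (j : ℕ) (i : Fin n), ∀ α ∈ Finset.piAntidiag (Finset.univ : Finset (Fin d)) j,
      torusDeriv α (fun y => u (-y) i) (-x) = (-1) ^ j * torusDeriv α (fun y => u y i) x := by
    intro j i α hα
    rw [(isDiffOp_torusDeriv α).neg (fun y => u y i)]
    dsimp only
    rw [neg_neg, (Finset.mem_piAntidiag.1 hα).1]
  simp only [S.L_smul_const]
  rw [Finset.sum_comm]
  simp only [frob, Lstar, Matrix.of_apply, Finset.sum_mul]
  have h5 : ∀ (f : Fin N → Fin N → ℕ → ℝ), ∑ l, ∑ m, ∑ j ∈ Finset.range (S.ν + 1), f l m j =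
      ∑ j ∈ Finset.range (S.ν + 1), ∑ l, ∑ m, f l m j := by
    intro f
    rw [Finset.sum_comm]
    rw [Finset.sum_congr rfl fun m _ => Finset.sum_comm, Finset.sum_comm]
    refine Finset.sum_congr rfl fun j _ => Finset.sum_comm
  rw [h5]
  refine Finset.sum_congr rfl fun j _ => ?_
  have h6 : ∀ (f : Fin N → Fin N → Fin n → ℝ), ∑ l, ∑ m, ∑ i, f l m i = ∑ i, ∑ l, ∑ m, f l m i := by
    intro f
    rw [Finset.sum_congr rfl fun m _ => Finset.sum_comm, Finset.sum_comm]
  rw [h6]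
  refine Finset.sum_congr rfl fun i _ => ?_
  have h7 : ∀ (s : Finset (Fin d → ℕ)) (f : Fin N → Fin N → (Fin d → ℕ) → ℝ),
      ∑ l, ∑ m, ∑ α ∈ s, f l m α = ∑ α ∈ s, ∑ l, ∑ m, f l m α := by
    intro s f
    rw [Finset.sum_congr rfl fun m _ => Finset.sum_comm, Finset.sum_comm]
  rw [h7, h7]
  refine Finset.sum_congr rfl fun α hα => ?_
  rw [h4 j i α hα]
  have h8 := h1 fun l m => S.b i l m α
  calc _ = (-1) ^ j * torusDeriv α (fun y => u y i) x *
        ∑ l, ∑ m, (S.b i l m α + S.b i m l α) / 2 * A l m := by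
        simp only [Finset.mul_sum]
        refine Finset.sum_congr rfl fun l _ => Finset.sum_congr rfl fun m _ => by ring
    _ = _ := by
        rw [h8]
        simp only [Finset.mul_sum]
        refine Finset.sum_congr rfl fun l _ => Finset.sum_congr rfl fun m _ => by ring

lemma L_sum_smul_const {ι : Type*} (s : Finset ι) (c : ι → ℝ) {f : ι → Torus d → ℝ}
    (hf : ∀ k, SmoothX (f k)) (A : Mat N) (x : Torus d) (i : Fin n) :
    S.L (fun y => (∑ k ∈ s, c k * f k y) • A) x i = ∑ k ∈ s, c k * S.L (fun y => f k y • A) x i := by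
  simp only [S.L_smul_const, (isDiffOp_torusDeriv _).sum s fun k => (hf k).const_mul (c k),
    (isDiffOp_torusDeriv _).const_mul, Finset.mul_sum]
  symm
  rw [Finset.sum_comm]
  refine Finset.sum_congr rfl fun j _ => ?_
  rw [Finset.sum_comm]
  refine Finset.sum_congr rfl fun l _ => ?_
  rw [Finset.sum_comm]
  refine Finset.sum_congr rfl fun m _ => ?_
  rw [Finset.sum_comm]
  refine Finset.sum_congr rfl fun α _ => Finset.sum_congr rfl fun k _ => by ring

lemma L_translate (r : Torus d → ℝ) (A : Mat N) (x₀ x : Torus d) :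
    S.L (fun y => r (y - x₀) • A) x = S.L (fun y => r y • A) (x - x₀) := by
  ext i
  simp only [S.L_smul_const, (isDiffOp_torusDeriv _).sub_const]

lemma Lam_isSymm {P : Mat N} (hP : P ∈ S.Lam) : P.IsSymm := by
  induction hP using Submodule.span_induction with
  | mem A hA =>
    rcases hA with rfl | ⟨u, -, x, rfl⟩
    · exact Matrix.isSymm_one
    · exact S.Lstar_isSymm u x
  | zero => exact Matrix.isSymm_zero
  | add A B _ _ hA hB => exact hA.add hB
  | smul c A _ hA => exact hA.smul c

lemma one_mem_Lam : (1 : Mat N) ∈ S.Lam := Submodule.subset_span (Or.inl rfl)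

lemma Lstar_mem_Lam {u : Torus d → Vec n} (hu : SmoothX u) (x : Torus d) : S.Lstar u x ∈ S.Lam :=
  Submodule.subset_span (Or.inr ⟨u, hu, x, rfl⟩)

/-- Each component of `L(g A)` is a value `L* u : A` for a reflected field `u` with a single nonzero
component, and such values vanish when `A` is orthogonal to `Λ`. -/
lemma L_smul_eq_zero {A : Mat N} (hA : A.IsSymm) (hp : ∀ P ∈ S.Lam, frob P A = 0)
    {g : Torus d → ℝ} (hg : SmoothX g) (x : Torus d) : S.L (fun y => g y • A) x = 0 := by
  ext i
  set u : Torus d → Vec n := fun y => EuclideanSpace.single i (g (-y)) with hu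
  have hus : SmoothX u := by
    rw [smoothX_vec_iff]
    intro j
    by_cases hij : j = i
    · subst hij
      simpa [hu] using hg.comp_neg
    · simpa [hu, hij] using smoothX_const (d := d) (0 : ℝ)
  have h1 := hp _ (S.Lstar_mem_Lam hus (-x))
  rw [S.frob_Lstar_eq hA, neg_neg, Finset.sum_eq_single i] at h1
  · simpa [hu] using h1
  · intro j _ hj
    have : (fun y => u (-y) j • A) = fun _ => (0 : Mat N) := by
      ext1 y
      simp [hu, hj]
    rw [this, S.L_zero]
    rfl
  · simp

end System


/-! ### Convergence of integrals -/

lemma exists_subseq_ae_tendsto {X : Type*} [MeasurableSpace X] {μ : Measure X} {f : ℕ → X → ℝ}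
    (hf : ∀ j, Integrable (f j) μ) (h : Tendsto (fun j => ∫ x, |f j x| ∂μ) atTop (𝓝 0)) :
    ∃ ns : ℕ → ℕ, StrictMono ns ∧ ∀ᵐ x ∂μ, Tendsto (fun k => f (ns k) x) atTop (𝓝 0) := by
  have h1 : Tendsto (fun j => eLpNorm (f j - fun _ => (0 : ℝ)) 1 μ) atTop (𝓝 0) := by
    have h2 := ENNReal.tendsto_ofReal h
    rw [ENNReal.ofReal_zero] at h2
    refine h2.congr fun j => ?_
    rw [eLpNorm_one_eq_lintegral_enorm, ← ofReal_integral_norm_eq_lintegral_enorm]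
    · simp
    · exact (hf j).sub (integrable_zero _ _ _)
  exact (tendstoInMeasure_of_tendsto_eLpNorm one_ne_zero (fun j => (hf j).aestronglyMeasurable)
    aestronglyMeasurable_const h1).exists_seq_tendsto_ae

/-- Dominated convergence with a convergent sequence of majorants. -/
lemma tendsto_integral_of_tendsto_majorant {X : Type*} [MeasurableSpace X] {μ : Measure X}
    {f : ℕ → X → ℝ} {f₀ g₀ : X → ℝ} {g : ℕ → X → ℝ} (hf : ∀ j, AEStronglyMeasurable (f j) μ)
    (hg : ∀ j, Integrable (g j) μ) (hg₀ : Integrable g₀ μ) (hfg : ∀ j x, |f j x| ≤ g j x)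
    (hlim : ∀ᵐ x ∂μ, Tendsto (fun j => f j x) atTop (𝓝 (f₀ x)))
    (hglim : ∀ᵐ x ∂μ, Tendsto (fun j => g j x) atTop (𝓝 (g₀ x)))
    (hL1 : Tendsto (fun j => ∫ x, |g j x - g₀ x| ∂μ) atTop (𝓝 0)) :
    Tendsto (fun j => ∫ x, f j x ∂μ) atTop (𝓝 (∫ x, f₀ x ∂μ)) := by
  -- Truncation at `±|g₀|`: the truncated functions have a fixed majorant, and what is cut off is at
  -- most `|g_j - g₀|`, which tends to zero in `L¹`.
  set h : ℕ → X → ℝ := fun j x => max (-|g₀ x|) (min (f j x) |g₀ x|) with hh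
  have hm : ∀ j, AEStronglyMeasurable (h j) μ := fun j => by
    have h1 := hg₀.aestronglyMeasurable.norm
    exact h1.neg.sup ((hf j).inf h1)
  have hb : ∀ j x, ‖h j x‖ ≤ |g₀ x| := fun j x => by
    rw [Real.norm_eq_abs, abs_le]
    refine ⟨le_max_left _ _, max_le ?_ (min_le_right _ _)⟩
    linarith [abs_nonneg (g₀ x)]
  have hhi : ∀ j, Integrable (h j) μ := fun j =>
    hg₀.abs.mono' (hm j) (Eventually.of_forall (hb j))
  have hfi : ∀ j, Integrable (f j) μ := fun j =>
    (hg j).mono' (hf j) (Eventually.of_forall (hfg j))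
  have hhlim : ∀ᵐ x ∂μ, Tendsto (fun j => h j x) atTop (𝓝 (f₀ x)) := by
    filter_upwards [hlim, hglim] with x h1 h2
    have h3 : |f₀ x| ≤ g₀ x := le_of_tendsto_of_tendsto' h1.abs h2 fun j => hfg j x
    have h4 : |f₀ x| ≤ |g₀ x| := h3.trans (le_abs_self _)
    have h5 : max (-|g₀ x|) (min (f₀ x) |g₀ x|) = f₀ x := by
      rw [min_eq_left ((le_abs_self _).trans h4), max_eq_right (abs_le.1 h4).1]
    rw [← h5]
    exact tendsto_const_nhds.max (h1.min tendsto_const_nhds)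
  have hdct := tendsto_integral_of_dominated_convergence (fun x => |g₀ x|) hm hg₀.abs
    (fun j => Eventually.of_forall (hb j)) hhlim
  have hdiff : ∀ j x, |f j x - h j x| ≤ |g j x - g₀ x| := fun j x => by
    have h1 := hfg j x
    simp only [hh]
    rcases le_total (f j x) |g₀ x| with h2 | h2
    · rw [min_eq_left h2]
      rcases le_total (-|g₀ x|) (f j x) with h3 | h3
      · rw [max_eq_right h3, sub_self, abs_zero]
        exact abs_nonneg _
      · rw [max_eq_left h3, abs_of_nonpos (by linarith)]
        have := neg_abs_le (f j x)
        linarith [le_abs_self (g j x - g₀ x), le_abs_self (g₀ x)]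
    · rw [min_eq_right h2, max_eq_right (by linarith [abs_nonneg (g₀ x)]),
        abs_of_nonneg (by linarith)]
      linarith [le_abs_self (g j x - g₀ x), le_abs_self (g₀ x), le_abs_self (f j x)]
  have hz : Tendsto (fun j => ∫ x, (f j x - h j x) ∂μ) atTop (𝓝 0) := by
    refine squeeze_zero_norm (fun j => ?_) hL1
    refine (norm_integral_le_integral_norm _).trans (integral_mono_of_nonneg
      (Eventually.of_forall fun x => norm_nonneg _) ((hg j).sub hg₀).abs
      (Eventually.of_forall (hdiff j)))
  have := hdct.add hz
  rw [add_zero] at this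
  refine this.congr fun j => ?_
  rw [integral_sub (hfi j) (hhi j)]
  ring

/-! ### Consequences of the standing assumptions -/

section PosSemidef

variable {N : ℕ}

lemma posSemidef_of_sum_abs_le {A : Mat N} (hA : A.IsSymm) {c : ℝ} (hc : ∑ l, ∑ m, |A l m| ≤ c) :
    (c • (1 : Mat N) + A).PosSemidef := by
  refine Matrix.PosSemidef.of_dotProduct_mulVec_nonneg ?_ fun x => ?_
  · rw [Matrix.IsHermitian, Matrix.conjTranspose_eq_transpose_of_trivial, Matrix.transpose_add,
      Matrix.transpose_smul, Matrix.transpose_one, hA]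
  · have h1 : star x ⬝ᵥ (c • (1 : Mat N) + A).mulVec x =
        c * ∑ l, x l ^ 2 + ∑ l, ∑ m, A l m * (x l * x m) := by
      rw [Matrix.add_mulVec, dotProduct_add, Matrix.smul_mulVec, Matrix.one_mulVec, dotProduct_smul]
      simp only [dotProduct, Matrix.mulVec, star_trivial, smul_eq_mul, Finset.mul_sum]
      congr 1
      · refine Finset.sum_congr rfl fun l _ => by ring
      · refine Finset.sum_congr rfl fun l _ => Finset.sum_congr rfl fun m _ => by ring
    rw [h1]
    set s := ∑ l, x l ^ 2 with hs
    have hs0 : 0 ≤ s := Finset.sum_nonneg fun l _ => sq_nonneg _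
    have h2 : ∀ l, x l ^ 2 ≤ s := fun l =>
      Finset.single_le_sum (f := fun l => x l ^ 2) (fun l _ => sq_nonneg _) (Finset.mem_univ l)
    have h3 : -((∑ l, ∑ m, |A l m|) * s) ≤ ∑ l, ∑ m, A l m * (x l * x m) := by
      rw [Finset.sum_mul, ← Finset.sum_neg_distrib]
      refine Finset.sum_le_sum fun l _ => ?_
      rw [Finset.sum_mul, ← Finset.sum_neg_distrib]
      refine Finset.sum_le_sum fun m _ => ?_
      have h4 : |x l * x m| ≤ s := by
        rw [abs_mul]
        nlinarith [h2 l, h2 m, sq_abs (x l), sq_abs (x m), sq_nonneg (|x l| - |x m|)]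
      have h5 : |A l m * (x l * x m)| ≤ |A l m| * s := by
        rw [abs_mul]
        gcongr
      exact (abs_le.1 h5).1
    nlinarith

end PosSemidef

namespace System

variable {d n N : ℕ} {S : System d n N}

namespace Assumptions

lemma contDiff_K (hS : S.Assumptions) : ContDiff ℝ 2 S.K := by
  unfold System.K
  simp only [Matrix.trace, Matrix.diag_apply, Matrix.sub_apply]
  exact contDiff_const.mul (ContDiff.sum fun l _ => (hS.F_smooth l l).sub contDiff_const)

lemma differentiable_K (hS : S.Assumptions) : Differentiable ℝ S.K :=
  hS.contDiff_K.differentiable (by simp)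

lemma continuous_sharp (hS : S.Assumptions) : Continuous S.sharp := by
  unfold System.sharp gradient
  exact (InnerProductSpace.toDual ℝ (Vec n)).symm.continuous.comp
    (hS.contDiff_K.continuous_fderiv (by simp))

lemma trace_F (v : Vec n) : (S.F v).trace = 2 * S.K v + (S.F 0).trace := by
  rw [System.K, Matrix.trace_sub]
  ring

lemma trace_F_nonneg (hS : S.Assumptions) (v : Vec n) : 0 ≤ (S.F v).trace := by
  have := (hS.lam_nonneg v).2 1 S.one_mem_Lam Matrix.PosSemidef.one
  rwa [frob_one_right] at this

/-- Both `c I + P` and `c I - P` are nonnegative definite elements of `Λ` when `c` is the sum of the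
moduli of the entries of `P`; the nonnegativity of the flux is tested with them. Only components of
`F` along `Λ` are controlled in this way. -/
lemma abs_frob_F_le (hS : S.Assumptions) (v : Vec n) {P : Mat N} (hP : P ∈ S.Lam) :
    |frob (S.F v) P| ≤ (∑ l, ∑ m, |P l m|) * (S.F v).trace := by
  have hs := S.Lam_isSymm hP
  set c := ∑ l, ∑ m, |P l m| with hc
  have h1 := (hS.lam_nonneg v).2 _ (S.Lam.add_mem (S.Lam.smul_mem c S.one_mem_Lam) hP)
    (posSemidef_of_sum_abs_le hs le_rfl)
  have h2 := (hS.lam_nonneg v).2 _ (S.Lam.add_mem (S.Lam.smul_mem c S.one_mem_Lam)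
    (S.Lam.neg_mem hP)) (posSemidef_of_sum_abs_le hs.neg (by simp [hc]))
  rw [frob_add_right, frob_smul_right, frob_one_right] at h1 h2
  have h3 : frob (S.F v) (-P) = -frob (S.F v) P := by
    simpa using frob_smul_right (-1) (S.F v) P
  rw [h3] at h2
  exact abs_le.2 ⟨by linarith, by linarith⟩

lemma hasGradientAt_Kstar (hS : S.Assumptions) (x : Vec n) :
    HasGradientAt S.Kstar x (S.sharp x) :=
  hS.K_nFunction.hasGradientAt_legendre hS.differentiable_K hS.K_strictConvex x

lemma exists_sharp_eq (hS : S.Assumptions) (y : Vec n) : ∃ x, S.sharp x = y :=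
  hS.K_nFunction.exists_gradient_eq hS.differentiable_K y

lemma gradient_Kstar_sharp (hS : S.Assumptions) (x : Vec n) :
    gradient S.Kstar (S.sharp x) = x :=
  (hS.hasGradientAt_Kstar x).gradient

lemma differentiable_Kstar (hS : S.Assumptions) : Differentiable ℝ S.Kstar := fun y => by
  obtain ⟨x, rfl⟩ := hS.exists_sharp_eq y
  exact (hS.hasGradientAt_Kstar x).differentiableAt

lemma continuous_gradient_Kstar (hS : S.Assumptions) : Continuous (gradient S.Kstar) :=
  hS.K_nFunction.continuous_gradient_legendre hS.differentiable_K hS.K_strictConvex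

lemma continuous_Kstar (hS : S.Assumptions) : Continuous S.Kstar :=
  hS.K_nFunction.legendre_continuous

lemma convex_Kstar (hS : S.Assumptions) : ConvexOn ℝ univ S.Kstar :=
  hS.K_nFunction.legendre_convex

lemma Kstar_nonneg (hS : S.Assumptions) (y : Vec n) : 0 ≤ S.Kstar y :=
  hS.K_nFunction.legendre_nonneg y

lemma continuous_F (hS : S.Assumptions) (l m : Fin N) : Continuous fun v => S.F v l m :=
  (hS.F_smooth l m).continuous

end Assumptions

lemma smoothX_L (S : System d n N) {g : Torus d → ℝ} (hg : SmoothX g) (A : Mat N) :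
    SmoothX (S.L fun y => g y • A) := by
  have : SmoothTX fun z : ℝ × Torus d => S.L (fun y => g y • A) z.2 :=
    S.smoothTX_L (Ψ := fun z => g z.2 • A) fun l m => hg.smoothTX.mul (smoothX_const _).smoothTX
  exact this.slice 0

lemma integrable_inner_cont {u φ : Torus d → Vec n} (hu : Integrable u volume)
    (hφ : Continuous φ) : Integrable (fun y => inner ℝ (u y) (φ y)) volume := by
  simp only [inner_eq_sum]
  exact integrable_finsetSum _ fun i _ => Mollifier.integrable_mul_cont (hu.vec_apply i)
    ((EuclideanSpace.proj (𝕜 := ℝ) i).continuous.comp hφ)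

/-! ### Conservativity for nonsmooth fields -/

section Conservative

variable (M : Mollifier d)

/-- The componentwise mollification. -/
def mollVec (j : ℕ) (u : Torus d → Vec n) (x : Torus d) : Vec n :=
  WithLp.toLp 2 fun i => M.moll j (fun y => u y i) x

lemma smoothX_mollVec (j : ℕ) {u : Torus d → Vec n} (hu : Integrable u volume) :
    SmoothX (mollVec M j u) :=
  smoothX_vec_iff.2 fun i => M.smoothX_moll j (hu.vec_apply i)

/-- The kernel of `L ∘ ρ_j`. -/
lemma frob_Lstar_mollVec (S : System d n N) (j : ℕ) {u : Torus d → Vec n}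
    (hu : Integrable u volume) {A : Mat N} (hA : A.IsSymm) (x : Torus d) :
    frob (S.Lstar (mollVec M j u) x) A =
      ∫ y, inner ℝ (u y) (S.L (fun w => M.ρ j (-w) • A) (y - x)) := by
  rw [S.frob_Lstar_eq hA]
  have hf : ∀ k, SmoothX fun y => M.f j k (-y) := fun k => (M.smooth_f j k).comp_neg
  have h1 : ∀ i, S.L (fun y => mollVec M j u (-y) i • A) (-x) i =
      ∫ y, u y i * S.L (fun w => M.ρ j (-w) • A) (y - x) i := by
    intro i
    have h2 : (fun y => mollVec M j u (-y) i • A) = fun y =>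
        (∑ k, (∫ w, M.g j k w * u w i) * M.f j k (-y)) • A := by
      ext1 y
      congr 1
      change M.moll j (fun y => u y i) (-y) = _
      rw [M.moll_eq_sum j (hu.vec_apply i)]
      exact Finset.sum_congr rfl fun k _ => mul_comm _ _
    rw [h2, S.L_sum_smul_const _ _ hf]
    -- Expanding a translate of the reflected kernel separates `x` from `y`, so `L` falls on
    -- finitely many fixed functions.
    have h3 : ∀ y, S.L (fun w => M.ρ j (-w) • A) (y - x) i =
        ∑ k, M.g j k y * S.L (fun w => M.f j k (-w) • A) (-x) i := by
      intro y
      rw [← S.L_sum_smul_const _ _ hf]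
      have h4 := S.L_translate (fun w => M.ρ j (-w)) A (-y) (-x)
      have h5 : -x - -y = y - x := by abel
      have h7 : (fun w => M.ρ j (-(w - -y)) • A) =
          fun w => (∑ k, M.g j k y * M.f j k (-w)) • A := by
        ext1 w
        have h6 : -(w - -y) = -w - y := by abel
        rw [h6, M.sep, Finset.sum_congr rfl fun k _ => mul_comm _ _]
      rw [h5, h7] at h4
      rw [h4]
    simp only [h3, Finset.mul_sum]
    rw [integral_finsetSum]
    · refine Finset.sum_congr rfl fun k _ => ?_
      rw [← integral_mul_const]
      congr 1
      ext y
      ring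
    · intro k _
      have := (Mollifier.integrable_mul_cont (hu.vec_apply i)
        (M.smooth_g j k).continuous).mul_const (S.L (fun w => M.f j k (-w) • A) (-x) i)
      refine this.congr (Eventually.of_forall fun y => ?_)
      dsimp only
      ring
  simp only [h1, inner_eq_sum]
  rw [integral_finsetSum]
  intro i _
  have hc : Continuous fun y => S.L (fun w => M.ρ j (-w) • A) (y - x) i :=
    ((EuclideanSpace.proj (𝕜 := ℝ) i).continuous.comp
      (S.smoothX_L (M.smooth j).comp_neg A).continuous).comp (continuous_sub_right x)
  exact Mollifier.integrable_mul_cont (hu.vec_apply i) hc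

/-- Mollification commutes with the weak `L*`. -/
lemma Lstar_mollVec (S : System d n N) (j : ℕ) {u : Torus d → Vec n} {G : Torus d → Mat N}
    (hu : Integrable u volume) (hG : ∀ l m, Integrable (fun y => G y l m) volume)
    (hs : ∀ᵐ y, (G y).IsSymm)
    (hw : ∀ k l m, ∫ y, (inner ℝ (u y) (S.L (fun w => M.g j k w • symUnit l m) y) -
      frob (G y) (M.g j k y • symUnit l m)) = 0) (x : Torus d) (l m : Fin N) :
    S.Lstar (mollVec M j u) x l m = M.moll j (fun y => G y l m) x := by
  have hA : (symUnit l m : Mat N).IsSymm := symUnit_isSymm l m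
  rw [← frob_symUnit_of_isSymm (S.Lstar_isSymm _ _) l m, frob_Lstar_mollVec M S j hu hA,
    M.moll_eq_sum j (hG l m)]
  -- The hypothesis with the functions `g j k` suffices, because the test function that is needed,
  -- `ρ_j(x - ·)`, is a finite combination of them with coefficients `f j k x`.
  have h1 : ∀ k, ∫ y, M.g j k y * G y l m =
      ∫ y, inner ℝ (u y) (S.L (fun w => M.g j k w • symUnit l m) y) := by
    intro k
    have h2 : (fun y => frob (G y) (M.g j k y • symUnit l m)) =ᵐ[volume]
        fun y => M.g j k y * G y l m := by
      filter_upwards [hs] with y hy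
      rw [frob_smul_right, frob_symUnit_of_isSymm hy]
    have h3 := Mollifier.integrable_cont_mul (hG l m) (M.smooth_g j k).continuous
    have h4 := hw k l m
    rw [integral_sub (integrable_inner_cont hu (S.smoothX_L (M.smooth_g j k) _).continuous)
      (h3.congr h2.symm), sub_eq_zero, integral_congr_ae h2] at h4
    exact h4.symm
  simp only [h1, ← integral_const_mul]
  rw [← integral_finsetSum]
  · congr 1
    ext y
    simp only [← inner_smul_right, ← inner_sum]
    congr 1
    rw [← S.L_translate (fun w => M.ρ j (-w))]
    ext i
    have h5 : (fun w => M.ρ j (-(w - x)) • (symUnit l m : Mat N)) =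
        fun w => (∑ k, M.f j k x * M.g j k w) • symUnit l m := by
      ext1 w
      rw [neg_sub, M.sep]
    rw [h5, S.L_sum_smul_const _ _ (M.smooth_g j), WithLp.ofLp_sum, Finset.sum_apply]
    rfl
  · intro k _
    exact (integrable_inner_cont hu (S.smoothX_L (M.smooth_g j k) _).continuous).const_mul _

lemma abs_moll_le (j : ℕ) {f : Torus d → ℝ} (hf : Integrable f volume) {C : ℝ}
    (hC : ∀ᵐ x, |f x| ≤ C) (x : Torus d) : |M.moll j f x| ≤ C := by
  have h0 : Continuous fun y => M.ρ j (x - y) := (M.continuous j).comp (continuous_sub_left x)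
  have h1 : ∫ y, M.ρ j (x - y) = 1 := by
    rw [integral_sub_left_eq_self (M.ρ j) volume x, M.integral_eq_one]
  calc |M.moll j f x| ≤ ∫ y, ‖M.ρ j (x - y) * f y‖ :=
        norm_integral_le_integral_norm fun y => M.ρ j (x - y) * f y
    _ ≤ ∫ y, M.ρ j (x - y) * C := by
        refine integral_mono_ae (Mollifier.integrable_cont_mul hf h0).norm
          ((integrable_of_continuous h0).mul_const C) ?_
        filter_upwards [hC] with y hy
        rw [norm_mul, Real.norm_of_nonneg (M.nonneg _ _)]
        exact mul_le_mul_of_nonneg_left hy (M.nonneg _ _)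
    _ = C := by rw [integral_mul_const, h1, one_mul]

/-- Jensen's inequality for mollifications. -/
lemma Kstar_mollVec_le (hS : S.Assumptions) (j : ℕ) {u : Torus d → Vec n}
    (hu : Integrable u volume) (hK : Integrable (fun x => S.Kstar (u x)) volume) (x : Torus d) :
    S.Kstar (mollVec M j u x) ≤ M.moll j (fun y => S.Kstar (u y)) x := by
  set w := mollVec M j u x with hw
  set p := gradient S.Kstar w with hp
  have h0 : Continuous fun y => M.ρ j (x - y) := (M.continuous j).comp (continuous_sub_left x)
  have h1 : ∫ y, M.ρ j (x - y) = 1 := by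
    rw [integral_sub_left_eq_self (M.ρ j) volume x, M.integral_eq_one]
  have hi : ∀ i, Integrable (fun y => p i * (M.ρ j (x - y) * u y i)) volume := fun i =>
    (Mollifier.integrable_cont_mul (hu.vec_apply i) h0).const_mul _
  have hc := (integrable_of_continuous h0).mul_const (S.Kstar w - inner ℝ p w)
  -- The affine function supporting `K*` at the mollified value averages to `K*` of that value; the
  -- remaining inequality is the pointwise tangent inequality weighted by the kernel.
  have h2 : ∫ y, (M.ρ j (x - y) * (S.Kstar w - inner ℝ p w) + ∑ i, p i * (M.ρ j (x - y) * u y i)) =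
      S.Kstar w := by
    rw [integral_add hc (integrable_finsetSum _ fun i _ => hi i), integral_mul_const, h1, one_mul,
      integral_finsetSum _ fun i _ => hi i]
    simp only [integral_const_mul]
    have : inner ℝ p w = ∑ i, p i * ∫ y, M.ρ j (x - y) * u y i := inner_eq_sum p w
    rw [← this]
    ring
  rw [← h2]
  refine integral_mono (hc.add (integrable_finsetSum _ fun i _ => hi i))
    (Mollifier.integrable_cont_mul hK h0) fun y => ?_
  have h3 := tangent_le_gradient hS.convex_Kstar hS.differentiable_Kstar w (u y)
  rw [inner_sub_right, inner_eq_sum _ (u y)] at h3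
  have h4 := mul_le_mul_of_nonneg_left h3 (M.nonneg j (x - y))
  refine le_trans (le_of_eq ?_) h4
  dsimp only
  rw [mul_add, mul_sub, mul_sub, Finset.mul_sum]
  have h5 : ∑ i, p i * (M.ρ j (x - y) * u y i) = ∑ i, M.ρ j (x - y) * (p i * u y i) :=
    Finset.sum_congr rfl fun i _ => by ring
  rw [h5]
  ring

end Conservative

end System


namespace System

variable {d n N : ℕ} {S : System d n N}

lemma tendsto_vec {ι : Type*} {l : Filter ι} {f : ι → Vec n} {a : Vec n}
    (h : ∀ i, Tendsto (fun k => f k i) l (𝓝 (a i))) : Tendsto f l (𝓝 a) := by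
  have h1 : Tendsto (fun k => WithLp.toLp 2 (fun i => f k i)) l (𝓝 (WithLp.toLp 2 fun i => a i)) :=
    ((PiLp.continuous_toLp 2 _).tendsto _).comp (tendsto_pi_nhds.2 h)
  exact h1

lemma Assumptions.exists_K_le (hS : S.Assumptions) :
    ∃ C, 0 ≤ C ∧ ∀ y, S.K (gradient S.Kstar y) ≤ C * (S.Kstar y + 1) := by
  obtain ⟨C, hC⟩ := hS.K_nFunction.exists_le_legendre hS.differentiable_K hS.K_strictConvex
    hS.Kstar_delta2
  refine ⟨C, ?_, hC⟩
  have h1 := (hS.K_nFunction.nonneg _).trans (hC 0)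
  exact nonneg_of_mul_nonneg_left h1 (by linarith [hS.K_nFunction.legendre_nonneg 0])

/-- Conservativity extends to integrable fields with bounded weak `L*`. -/
lemma Assumptions.conservative_of_weak (hS : S.Assumptions) (M : Mollifier d)
    {u : Torus d → Vec n} {G : Torus d → Mat N}
    (hu : Integrable u volume) (hK : Integrable (fun x => S.Kstar (u x)) volume)
    (hG : ∀ l m, Integrable (fun y => G y l m) volume) {C : ℝ}
    (hC : ∀ l m, ∀ᵐ y, |G y l m| ≤ C) (hs : ∀ᵐ y, (G y).IsSymm)
    (hw : ∀ j k l m, ∫ y, (inner ℝ (u y) (S.L (fun w => M.g j k w • symUnit l m) y) -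
      frob (G y) (M.g j k y • symUnit l m)) = 0) :
    ∫ x, frob (S.F (gradient S.Kstar (u x))) (G x) = 0 := by
  set h : Torus d → ℝ := fun x => S.Kstar (u x) with hh
  -- All mollification errors are added, so that a single subsequence converges almost everywhere
  -- for `u`, `G` and `K*(u)` at once.
  set D : ℕ → Torus d → ℝ := fun j x => (∑ i, |M.moll j (fun y => u y i) x - u x i|) +
    (∑ l, ∑ m, |M.moll j (fun y => G y l m) x - G x l m|) + |M.moll j h x - h x| with hD
  have hmi : ∀ j (f : Torus d → ℝ), Integrable f volume →
      Integrable (fun x => |M.moll j f x - f x|) volume := fun j f hf =>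
    ((integrable_of_continuous (M.smoothX_moll j hf).continuous).sub hf).abs
  have i1 : ∀ j, Integrable (fun x => ∑ i, |M.moll j (fun y => u y i) x - u x i|) volume :=
    fun j => integrable_finsetSum _ fun i _ => hmi j _ (hu.vec_apply i)
  have i2 : ∀ j, Integrable (fun x => ∑ l, ∑ m, |M.moll j (fun y => G y l m) x - G x l m|) volume :=
    fun j => integrable_finsetSum _ fun l _ => integrable_finsetSum _ fun m _ => hmi j _ (hG l m)
  have i12 : ∀ j, Integrable (fun x => (∑ i, |M.moll j (fun y => u y i) x - u x i|) +
      ∑ l, ∑ m, |M.moll j (fun y => G y l m) x - G x l m|) volume := fun j => (i1 j).add (i2 j)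
  have hDi : ∀ j, Integrable (D j) volume := fun j => (i12 j).add (hmi j h hK)
  have hD0 : ∀ j x, 0 ≤ D j x := fun j x => by
    simp only [hD]
    positivity
  have hDt : Tendsto (fun j => ∫ x, |D j x|) atTop (𝓝 0) := by
    have e1 : ∀ j, ∫ x, |D j x| = (∑ i, ∫ x, |M.moll j (fun y => u y i) x - u x i|) +
        (∑ l, ∑ m, ∫ x, |M.moll j (fun y => G y l m) x - G x l m|) +
        ∫ x, |M.moll j h x - h x| := by
      intro j
      simp only [abs_of_nonneg (hD0 j _)]
      simp only [hD]
      rw [integral_add (i12 j) (hmi j h hK), integral_add (i1 j) (i2 j),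
        integral_finsetSum _ fun i _ => hmi j _ (hu.vec_apply i),
        integral_finsetSum _ fun l _ => integrable_finsetSum _ fun m _ => hmi j _ (hG l m)]
      congr 2
      refine Finset.sum_congr rfl fun l _ => ?_
      rw [integral_finsetSum _ fun m _ => hmi j _ (hG l m)]
    simp only [e1]
    have t1 : Tendsto (fun j => ∑ i, ∫ x, |M.moll j (fun y => u y i) x - u x i|) atTop
        (𝓝 (∑ _i : Fin n, 0)) := tendsto_finsetSum _ fun i _ => M.tendsto_moll (hu.vec_apply i)
    have t2 : Tendsto (fun j => ∑ l, ∑ m, ∫ x, |M.moll j (fun y => G y l m) x - G x l m|) atTop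
        (𝓝 (∑ _l : Fin N, ∑ _m : Fin N, 0)) :=
      tendsto_finsetSum _ fun l _ => tendsto_finsetSum _ fun m _ => M.tendsto_moll (hG l m)
    have := (t1.add t2).add (M.tendsto_moll hK)
    simpa using this
  obtain ⟨ns, hmono, hns⟩ := exists_subseq_ae_tendsto hDi hDt
  -- a subsequence converges almost everywhere
  have hsq : ∀ {a : ℕ → ℝ} {b : ℕ → ℝ} {c : ℝ}, (∀ k, |a k - c| ≤ b k) → Tendsto b atTop (𝓝 0) →
      Tendsto a atTop (𝓝 c) := fun {a b c} h1 h2 => by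
    have := squeeze_zero_norm (a := b) (f := fun k => a k - c) h1 h2
    simpa using this.add_const c
  have hbound : ∀ j x, (∀ i, |M.moll j (fun y => u y i) x - u x i| ≤ D j x) ∧
      (∀ l m, |M.moll j (fun y => G y l m) x - G x l m| ≤ D j x) ∧
      |M.moll j h x - h x| ≤ D j x := by
    intro j x
    have p1 : 0 ≤ ∑ i, |M.moll j (fun y => u y i) x - u x i| := by positivity
    have p2 : 0 ≤ ∑ l, ∑ m, |M.moll j (fun y => G y l m) x - G x l m| := by positivity
    have p3 := abs_nonneg (M.moll j h x - h x)
    refine ⟨fun i => ?_, fun l m => ?_, ?_⟩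
    · have := Finset.single_le_sum (f := fun i => |M.moll j (fun y => u y i) x - u x i|)
        (fun i _ => abs_nonneg _) (Finset.mem_univ i)
      simp only [hD]
      linarith
    · have q1 := Finset.single_le_sum (f := fun m => |M.moll j (fun y => G y l m) x - G x l m|)
        (fun i _ => abs_nonneg _) (Finset.mem_univ m)
      have q2 := Finset.single_le_sum
        (f := fun l => ∑ m, |M.moll j (fun y => G y l m) x - G x l m|)
        (fun i _ => by positivity) (Finset.mem_univ l)
      simp only [hD]
      linarith
    · simp only [hD]
      linarith
  obtain ⟨C1, hC10, hC1⟩ := hS.exists_K_le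
  set c0 : ℝ := ∑ _l : Fin N, ∑ _m : Fin N, |C| with hc0
  have hc00 : 0 ≤ c0 := by positivity
  set f : ℕ → Torus d → ℝ := fun j x =>
    frob (S.F (gradient S.Kstar (mollVec M j u x))) (S.Lstar (mollVec M j u) x) with hf
  have hP : ∀ j x l m, S.Lstar (mollVec M j u) x l m = M.moll j (fun y => G y l m) x :=
    fun j x l m => Lstar_mollVec M S j hu hG hs (hw j) x l m
  -- The values of `L*` lie in `Λ` and are bounded by the bound on `G`. The trace of the flux is
  -- controlled by `K(∇K*) ≤ C1 (K* + 1)`, and Jensen's inequality moves the mollification outside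
  -- `K*`.
  have hfle : ∀ j x, |f j x| ≤ c0 * (2 * C1 * (M.moll j h x + 1) + (S.F 0).trace) := by
    intro j x
    refine (hS.abs_frob_F_le _ (S.Lstar_mem_Lam (smoothX_mollVec M j hu) x)).trans ?_
    have e1 : ∑ l, ∑ m, |S.Lstar (mollVec M j u) x l m| ≤ c0 := by
      refine Finset.sum_le_sum fun l _ => Finset.sum_le_sum fun m _ => ?_
      rw [hP]
      refine (abs_moll_le M j (hG l m) (hC l m) x).trans (le_abs_self C)
    have e2 : (S.F (gradient S.Kstar (mollVec M j u x))).trace ≤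
        2 * C1 * (M.moll j h x + 1) + (S.F 0).trace := by
      rw [Assumptions.trace_F]
      have e3 := hC1 (mollVec M j u x)
      have e4 := Kstar_mollVec_le M hS j hu hK x
      have e5 := mul_le_mul_of_nonneg_left e4 hC10
      linarith
    exact mul_le_mul e1 e2 (hS.trace_F_nonneg _) hc00
  have hf0 : ∀ j, ∫ x, f j x = 0 := fun j => hS.conservative _ (smoothX_mollVec M j hu)
  have hmc : ∀ j, Continuous (M.moll j h) := fun j => (M.smoothX_moll j hK).continuous
  have hfm : ∀ j, AEStronglyMeasurable (f j) volume := by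
    intro j
    refine Continuous.aestronglyMeasurable ?_
    simp only [hf, frob, hP]
    refine continuous_finsetSum _ fun l _ => continuous_finsetSum _ fun m _ => ?_
    exact (((hS.continuous_F l m).comp hS.continuous_gradient_Kstar).comp
      (smoothX_mollVec M j hu).continuous).mul (M.smoothX_moll j (hG l m)).continuous
  have hglim : ∀ᵐ x, Tendsto (fun k => M.moll (ns k) h x) atTop (𝓝 (h x)) := by
    filter_upwards [hns] with x hx
    exact hsq (fun k => (hbound (ns k) x).2.2) hx
  -- The majorants contain mollifications of `K*(u)`, which converge in `L¹` but need not have a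
  -- common integrable majorant; ordinary dominated convergence does not apply directly.
  have hmain := tendsto_integral_of_tendsto_majorant (μ := volume) (f := fun k => f (ns k))
    (f₀ := fun x => frob (S.F (gradient S.Kstar (u x))) (G x))
    (g := fun k x => c0 * (2 * C1 * (M.moll (ns k) h x + 1) + (S.F 0).trace))
    (g₀ := fun x => c0 * (2 * C1 * (h x + 1) + (S.F 0).trace))
    (fun k => hfm (ns k))
    (fun k => integrable_of_continuous (by have := hmc (ns k); fun_prop))
    ((((hK.add (integrable_const _)).const_mul _).add (integrable_const _)).const_mul _)
    (fun k x => hfle (ns k) x) ?_ ?_ ?_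
  · simp only [hf0] at hmain
    exact tendsto_nhds_unique hmain tendsto_const_nhds
  · filter_upwards [hns] with x hx
    have hul : Tendsto (fun k => mollVec M (ns k) u x) atTop (𝓝 (u x)) :=
      tendsto_vec fun i => hsq (fun k => (hbound (ns k) x).1 i) hx
    simp only [hf, frob, hP]
    refine tendsto_finsetSum _ fun l _ => tendsto_finsetSum _ fun m _ => ?_
    refine Tendsto.mul ?_ (hsq (fun k => (hbound (ns k) x).2.1 l m) hx)
    exact (((hS.continuous_F l m).comp hS.continuous_gradient_Kstar).tendsto _).comp hul
  · filter_upwards [hglim] with x hx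
    exact (((hx.add_const 1).const_mul _).add_const _).const_mul _
  · have hDns := hDt.comp hmono.tendsto_atTop
    have hz := (hDns.const_mul (c0 * (2 * C1)))
    rw [mul_zero] at hz
    refine squeeze_zero (fun k => integral_nonneg fun x => abs_nonneg _) (fun k => ?_) hz
    rw [Function.comp, ← integral_const_mul]
    refine integral_mono_of_nonneg (Eventually.of_forall fun x => abs_nonneg _)
      ((hDi (ns k)).abs.const_mul _) (Eventually.of_forall fun x => ?_)
    have e1 : c0 * (2 * C1 * (M.moll (ns k) h x + 1) + (S.F 0).trace) -
        c0 * (2 * C1 * (h x + 1) + (S.F 0).trace) = c0 * (2 * C1) * (M.moll (ns k) h x - h x) := by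
      ring
    dsimp only
    rw [e1, abs_mul, abs_of_nonneg (by positivity : 0 ≤ c0 * (2 * C1)), abs_of_nonneg (hD0 _ _)]
    exact mul_le_mul_of_nonneg_left (hbound (ns k) x).2.2 (by positivity)

end System

/-! ### Weights -/

lemma exists_ae_abs_le_of_memLp_top {X : Type*} [MeasurableSpace X] {μ : Measure X} {f : X → ℝ}
    (hf : MemLp f ⊤ μ) : ∃ C, ∀ᵐ x ∂μ, |f x| ≤ C := by
  refine ⟨(eLpNormEssSup f μ).toReal, ?_⟩
  have h1 : eLpNormEssSup f μ ≠ ⊤ := by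
    rw [← eLpNorm_exponent_top]
    exact hf.2.ne
  filter_upwards [ae_le_eLpNormEssSup (f := f) (μ := μ)] with x hx
  have := ENNReal.toReal_mono h1 hx
  rwa [toReal_enorm, Real.norm_eq_abs] at this


namespace IsWeight

variable {T : ℝ} {ϰ : ℝ → ℝ}

lemma intervalIntegrable (h : IsWeight T ϰ) (hT : 0 < T) : IntervalIntegrable ϰ volume 0 T := by
  obtain ⟨hm, c, C, hc, hb⟩ := h
  rw [intervalIntegrable_iff_integrableOn_Icc_of_le hT.le]
  refine Integrable.of_bound hm.aestronglyMeasurable C ?_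
  rw [ae_restrict_iff' measurableSet_Icc]
  refine Eventually.of_forall fun t ht => ?_
  rw [Real.norm_of_nonneg (hc.le.trans (hb t ht).1)]
  exact (hb t ht).2

lemma bounds (h : IsWeight T ϰ) (hT : 0 < T) : ∃ c C : ℝ, 0 < c ∧ 0 < C ∧
    (∀ t ∈ Icc 0 T, c ≤ ϰ t ∧ ϰ t ≤ C) ∧
    ∀ t ∈ Icc 0 T, c * (T - t) ≤ bigWeight T ϰ t ∧ bigWeight T ϰ t ≤ C * (T - t) := by
  have hi := h.intervalIntegrable hT
  obtain ⟨hm, c, C, hc, hb⟩ := h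
  have h0 := hb 0 (left_mem_Icc.2 hT.le)
  refine ⟨c, C, hc, by linarith [h0.1, h0.2], hb, fun t ht => ?_⟩
  have hit : IntervalIntegrable ϰ volume t T := by
    refine hi.mono_set ?_
    rw [uIcc_of_le ht.2, uIcc_of_le hT.le]
    exact Icc_subset_Icc_left ht.1
  have e1 := intervalIntegral.integral_mono_on ht.2 (intervalIntegrable_const (c := c)) hit
    fun s hs => (hb s ⟨ht.1.trans hs.1, hs.2⟩).1
  have e2 := intervalIntegral.integral_mono_on ht.2 hit (intervalIntegrable_const (c := C))
    fun s hs => (hb s ⟨ht.1.trans hs.1, hs.2⟩).2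
  rw [intervalIntegral.integral_const, smul_eq_mul, mul_comm] at e1 e2
  exact ⟨e1, e2⟩

lemma bigWeight_pos (h : IsWeight T ϰ) (hT : 0 < T) {t : ℝ} (ht : t ∈ Ico 0 T) :
    0 < bigWeight T ϰ t := by
  obtain ⟨c, C, hc, -, -, hb⟩ := h.bounds hT
  have h1 : 0 < T - t := by linarith [ht.2]
  exact (mul_pos hc h1).trans_le (hb t ⟨ht.1, ht.2.le⟩).1

lemma absolutelyContinuous (h : IsWeight T ϰ) (hT : 0 < T) :
    AbsolutelyContinuousOnInterval (bigWeight T ϰ) 0 T :=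
  absolutelyContinuousOnInterval_integral_right (h.intervalIntegrable hT)

lemma continuousOn (h : IsWeight T ϰ) (hT : 0 < T) : ContinuousOn (bigWeight T ϰ) (Icc 0 T) := by
  have := (h.absolutelyContinuous hT).continuousOn
  rwa [uIcc_of_le hT.le] at this

lemma aestronglyMeasurable (h : IsWeight T ϰ) (d : ℕ) :
    AEStronglyMeasurable (fun z : ℝ × Torus d => ϰ z.1) (stMeasure T d) := by
  have h1 : AEStronglyMeasurable ϰ (volume.restrict (Ioo 0 T)) :=
    (h.1.mono_measure (Measure.restrict_mono Ioo_subset_Icc_self le_rfl)).aestronglyMeasurable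
  exact h1.comp_fst

lemma bigWeight_aestronglyMeasurable (h : IsWeight T ϰ) (hT : 0 < T) (d : ℕ) :
    AEStronglyMeasurable (fun z : ℝ × Torus d => bigWeight T ϰ z.1) (stMeasure T d) := by
  have h1 : AEStronglyMeasurable (bigWeight T ϰ) (volume.restrict (Ioo 0 T)) :=
    ((h.continuousOn hT).mono Ioo_subset_Icc_self).aestronglyMeasurable measurableSet_Ioo
  exact h1.comp_fst

end IsWeight

namespace System

variable {d n N : ℕ} {S : System d n N} {T : ℝ} {ϰ : ℝ → ℝ}

/-- Space-time conservativity. -/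
lemma Assumptions.integral_frob_F_eq_zero (hS : S.Assumptions) (hT : 0 < T) (hϰ : IsWeight T ϰ)
    {v : ℝ × Torus d → Vec n} {G : ℝ × Torus d → Mat N}
    (hu : Integrable (fun z => S.sharp (v z)) (stMeasure T d))
    (hK : Integrable (fun z => S.Kstar (S.sharp (v z))) (stMeasure T d))
    (hG : S.IsWeakLstar T (fun z => S.sharp (v z)) G)
    (hb : ∀ l m, MemLp (fun z => bigWeight T ϰ z.1 * G z l m) ⊤ (stMeasure T d)) :
    ∫ z, frob (S.F (v z)) (bigWeight T ϰ z.1 • G z) ∂stMeasure T d = 0 := by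
  obtain ⟨M⟩ := exists_mollifier d
  -- If the integrand is not integrable, its Bochner integral is `0` by convention and there is
  -- nothing to prove.
  by_cases hint : Integrable (fun z => frob (S.F (v z)) (bigWeight T ϰ z.1 • G z)) (stMeasure T d)
  swap
  · exact integral_undef hint
  have key : ∀ᵐ t, t ∈ Ioo 0 T → ∫ x, frob (S.F (v (t, x))) (G (t, x)) = 0 := by
    have h1 : ∀ᵐ t, ∀ j k l m, t ∈ Ioo 0 T → ∫ x, S.defect (fun z => S.sharp (v z)) G
        (fun z => M.g j k z.2 • symUnit l m) (t, x) = 0 := by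
      refine ae_all_iff.2 fun j => ae_all_iff.2 fun k => ae_all_iff.2 fun l => ae_all_iff.2 fun m => ?_
      exact hG.ae_integral_defect hT (smoothSymTX_const (M.smooth_g j k) (symUnit_isSymm l m))
    have hu' := hu.prod_right_ae
    have hK' := hK.prod_right_ae
    rw [ae_restrict_iff' measurableSet_Ioo] at hu' hK'
    have hbi : ∀ᵐ t, ∀ l m, t ∈ Ioo 0 T →
        Integrable (fun x => bigWeight T ϰ t * G (t, x) l m) volume := by
      refine ae_all_iff.2 fun l => ae_all_iff.2 fun m => ?_
      have := ((hb l m).integrable le_top).prod_right_ae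
      rwa [ae_restrict_iff' measurableSet_Ioo] at this
    have hbd : ∀ l m, ∃ C, ∀ᵐ z ∂stMeasure T d, |bigWeight T ϰ z.1 * G z l m| ≤ C := fun l m =>
      exists_ae_abs_le_of_memLp_top (hb l m)
    choose C hC using hbd
    have hC' : ∀ᵐ t, ∀ l m, t ∈ Ioo 0 T → ∀ᵐ x, |bigWeight T ϰ t * G (t, x) l m| ≤ C l m :=
      ae_all_iff.2 fun l => ae_all_iff.2 fun m => ae_time_ae_space (hC l m)
    filter_upwards [h1, hu', hK', hbi, hC', ae_time_ae_space hG.2.2.1] with t k1 k2 k3 k4 k5 k6 hm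
    have hpos : 0 < bigWeight T ϰ t := hϰ.bigWeight_pos hT ⟨hm.1.le, hm.2⟩
    have hGi : ∀ l m, Integrable (fun x => G (t, x) l m) volume := fun l m => by
      refine ((k4 l m hm).const_mul (bigWeight T ϰ t)⁻¹).congr (Eventually.of_forall fun x => ?_)
      dsimp only
      rw [inv_mul_cancel_left₀ hpos.ne']
    -- The bound for `G` deteriorates as `t → T`, which is harmless because the argument is carried
    -- out for one time at a time.
    have := hS.conservative_of_weak M (C := ∑ l, ∑ m, |C l m| / bigWeight T ϰ t) (k2 hm) (k3 hm) hGi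
      (fun l m => ?_) (k6 hm) fun j k l m => k1 j k l m hm
    · simpa only [hS.gradient_Kstar_sharp] using this
    · filter_upwards [k5 l m hm] with x hx
      rw [abs_mul, abs_of_pos hpos] at hx
      have e1 : |G (t, x) l m| ≤ |C l m| / bigWeight T ϰ t := by
        rw [le_div_iff₀ hpos, mul_comm]
        exact hx.trans (le_abs_self _)
      refine e1.trans ?_
      have q1 := Finset.single_le_sum (f := fun m => |C l m| / bigWeight T ϰ t)
        (fun i _ => by positivity) (Finset.mem_univ m)
      have q2 := Finset.single_le_sum (f := fun l => ∑ m, |C l m| / bigWeight T ϰ t)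
        (fun i _ => by positivity) (Finset.mem_univ l)
      exact q1.trans q2
  simp only [frob_smul_right] at hint ⊢
  exact integral_time_mul_eq_zero key hint

end System


/-! ### Backward primitives -/

/-- The field `y` with `(Ϙ y)' = e` and `(Ϙ y)(T) = 0`. -/
def backward {n : ℕ} (T : ℝ) (ϰ : ℝ → ℝ) (e : ℝ → Vec n) (t : ℝ) : Vec n :=
  -((bigWeight T ϰ t)⁻¹ • ∫ s in t..T, e s)

namespace IsWeight

variable {T : ℝ} {ϰ : ℝ → ℝ} {n : ℕ} {e : ℝ → Vec n}

lemma inv_absolutelyContinuous (h : IsWeight T ϰ) (hT : 0 < T) {b : ℝ} (hb : b ∈ Ico 0 T) :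
    AbsolutelyContinuousOnInterval (fun t => (bigWeight T ϰ t)⁻¹) 0 b := by
  obtain ⟨c, C, hc, -, -, hq⟩ := h.bounds hT
  have hm : 0 < c * (T - b) := mul_pos hc (by linarith [hb.2])
  have hq' : ∀ t ∈ uIcc 0 b, c * (T - b) ≤ bigWeight T ϰ t := fun t ht => by
    rw [uIcc_of_le hb.1] at ht
    refine le_trans ?_ (hq t ⟨ht.1, ht.2.trans hb.2.le⟩).1
    have := ht.2
    gcongr
  refine absolutelyContinuousOnInterval_of_dist_le (C := (c * (T - b))⁻¹ * (c * (T - b))⁻¹)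
    (by positivity) ((h.absolutelyContinuous hT).mono ?_) fun s hs t ht => ?_
  · rw [uIcc_of_le hb.1, uIcc_of_le hT.le]
    exact Icc_subset_Icc_right hb.2.le
  · have h1 := hm.trans_le (hq' s hs)
    have h2 := hm.trans_le (hq' t ht)
    rw [Real.dist_eq, Real.dist_eq, inv_sub_inv h1.ne' h2.ne', abs_div, abs_sub_comm,
      abs_of_pos (mul_pos h1 h2), div_eq_inv_mul, mul_inv]
    have h3 := inv_anti₀ hm (hq' s hs)
    have h4 := inv_anti₀ hm (hq' t ht)
    have h5 : 0 ≤ (bigWeight T ϰ t)⁻¹ := (inv_pos.2 h2).le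
    gcongr

lemma backward_absolutelyContinuous (h : IsWeight T ϰ) (hT : 0 < T)
    (he : IntervalIntegrable e volume 0 T) {b : ℝ} (hb : b ∈ Ico 0 T) :
    AbsolutelyContinuousOnInterval (backward T ϰ e) 0 b := by
  have h1 : AbsolutelyContinuousOnInterval (fun t => ∫ s in t..T, e s) 0 b := by
    refine (absolutelyContinuousOnInterval_integral_right he).mono ?_
    rw [uIcc_of_le hb.1, uIcc_of_le hT.le]
    exact Icc_subset_Icc_right hb.2.le
  exact ((h.inv_absolutelyContinuous hT hb).smul h1).neg

lemma ae_hasDerivAt (h : IsWeight T ϰ) (hT : 0 < T) :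
    ∀ᵐ t, t ∈ Ico 0 T → HasDerivAt (bigWeight T ϰ) (-ϰ t) t := by
  filter_upwards [ae_hasDerivAt_integral_right (h.intervalIntegrable hT)] with t ht hm
  refine ht ?_
  rw [uIcc_of_le hT.le]
  exact ⟨hm.1, hm.2.le⟩

lemma backward_ae_hasDerivAt (h : IsWeight T ϰ) (hT : 0 < T)
    (he : IntervalIntegrable e volume 0 T) :
    ∀ᵐ t, t ∈ Ico 0 T → HasDerivAt (backward T ϰ e)
      ((bigWeight T ϰ t)⁻¹ • (e t + ϰ t • backward T ϰ e t)) t := by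
  filter_upwards [h.ae_hasDerivAt hT, ae_hasDerivAt_integral_right he] with t h1 h2 hm
  have hq := (h.bigWeight_pos hT hm).ne'
  have h3 := ((((h1 hm).inv hq).smul (h2 (by
    rw [uIcc_of_le hT.le]
    exact ⟨hm.1, hm.2.le⟩))).neg)
  refine h3.congr_deriv ?_
  rw [backward]
  ext i
  simp only [PiLp.neg_apply, PiLp.add_apply, PiLp.smul_apply, smul_eq_mul, Pi.inv_apply]
  field_simp
  ring

/-- Integration by parts for backward primitives. -/
lemma integral_deriv_mul_backward (h : IsWeight T ϰ) (hT : 0 < T)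
    (he : IntervalIntegrable e volume 0 T) {η : ℝ → ℝ} (hη : IsTimeTest T η) (i : Fin n) :
    ∫ t in Ioo 0 T, deriv η t * backward T ϰ e t i =
      -∫ t in Ioo 0 T, η t * ((bigWeight T ϰ t)⁻¹ • (e t + ϰ t • backward T ϰ e t)) i := by
  obtain ⟨a1, b1, ha1, hab1, hb1, h1⟩ := hη.exists_Icc hT
  obtain ⟨a2, b2, ha2, hab2, hb2, h2⟩ := hη.deriv.exists_Icc hT
  -- Absolute continuity of the backward primitive is available only up to some `b < T`; this `b`
  -- lies beyond the supports of `η` and its derivative.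
  set b := max b1 b2 with hb
  have hbI : b ∈ Ico 0 T := ⟨by rw [hb]; exact le_max_of_le_left (by linarith), max_lt hb1 hb2⟩
  have hb0 : 0 < b := lt_max_of_lt_left (by linarith)
  have hY := h.backward_absolutelyContinuous hT he hbI
  have hYi : AbsolutelyContinuousOnInterval (fun t => backward T ϰ e t i) 0 b := by
    refine absolutelyContinuousOnInterval_of_dist_le zero_le_one hY fun s _ t _ => ?_
    rw [one_mul, dist_eq_norm, dist_eq_norm, ← PiLp.sub_apply]
    exact PiLp.norm_apply_le _ i
  have hf := (hη.smooth.absolutelyContinuousOnInterval 0 b).mul hYi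
  have hd : ∀ᵐ t, t ∈ uIcc 0 b → HasDerivAt (η * fun t => backward T ϰ e t i)
      (deriv η t * backward T ϰ e t i +
        η t * ((bigWeight T ϰ t)⁻¹ • (e t + ϰ t • backward T ϰ e t)) i) t := by
    filter_upwards [h.backward_ae_hasDerivAt hT he] with t ht hm
    rw [uIcc_of_le hb0.le] at hm
    have h3 := ht ⟨hm.1, hm.2.trans_lt hbI.2⟩
    exact (hη.differentiable t).hasDerivAt.mul
      ((EuclideanSpace.proj (𝕜 := ℝ) i).hasFDerivAt.comp_hasDerivAt t h3)
  obtain ⟨i1, i2⟩ := intervalIntegrable_and_integral_eq_sub hf hd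
  have j1 : IntervalIntegrable (fun t => deriv η t * backward T ϰ e t i) volume 0 b :=
    (hη.deriv.smooth.continuous.continuousOn.mul hYi.continuousOn).intervalIntegrable
  have j2 : IntervalIntegrable (fun t => η t * ((bigWeight T ϰ t)⁻¹ •
      (e t + ϰ t • backward T ϰ e t)) i) volume 0 b := by
    refine (i1.sub j1).congr fun t _ => ?_
    simp
  rw [intervalIntegral.integral_add j1 j2] at i2
  have e0 : η 0 = 0 := h1 0 fun hh => by linarith [hh.1]
  have eb : η b = 0 := h1 b fun hh => by linarith [hh.2, le_max_left b1 b2]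
  simp only [Pi.mul_apply, e0, eb, zero_mul, sub_zero] at i2
  have red : ∀ f : ℝ → ℝ, (∀ t, b ≤ t → f t = 0) → ∫ t in Ioo 0 T, f t = ∫ t in 0..b, f t := by
    intro f hf0
    rw [intervalIntegral.integral_of_le hb0.le]
    refine setIntegral_eq_of_subset_of_forall_sdiff_eq_zero measurableSet_Ioo
      (fun t ht => ⟨ht.1, ht.2.trans_lt hbI.2⟩) fun t ht => hf0 t ?_
    by_contra hlt
    exact ht.2 ⟨ht.1.1, (not_le.1 hlt).le⟩
  rw [red _ fun t ht => ?_, red _ fun t ht => ?_]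
  · linarith
  · rw [h1 t fun hh => by linarith [hh.2, le_max_left b1 b2], zero_mul]
  · rw [h2 t fun hh => by linarith [hh.2, le_max_right b1 b2], zero_mul]

end IsWeight

/-! ### The energy identity along one trajectory -/

namespace System

variable {d n N : ℕ} {S : System d n N} {T : ℝ} {ϰ : ℝ → ℝ}

lemma Assumptions.contDiff_Kstar (hS : S.Assumptions) : ContDiff ℝ 1 S.Kstar := by
  rw [contDiff_one_iff_fderiv]
  refine ⟨hS.differentiable_Kstar, ?_⟩
  have : fderiv ℝ S.Kstar = fun y => InnerProductSpace.toDual ℝ (Vec n) (gradient S.Kstar y) := by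
    ext1 y
    simp [gradient]
  rw [this]
  exact (InnerProductSpace.toDual ℝ (Vec n)).continuous.comp hS.continuous_gradient_Kstar

lemma Assumptions.K_gradient_Kstar (hS : S.Assumptions) (y : Vec n) :
    S.K (gradient S.Kstar y) = inner ℝ (gradient S.Kstar y) y - S.Kstar y := by
  obtain ⟨x, rfl⟩ := hS.exists_sharp_eq y
  rw [hS.gradient_Kstar_sharp]
  have := hS.K_nFunction.legendre_gradient hS.differentiable_K x
  change S.Kstar (S.sharp x) = inner ℝ x (S.sharp x) - S.K x at this
  rw [this]
  ring

lemma Assumptions.hasDerivAt_Kstar_comp (hS : S.Assumptions) {y : ℝ → Vec n} {y' : Vec n} {t : ℝ}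
    (h : HasDerivAt y y' t) :
    HasDerivAt (fun t => S.Kstar (y t)) (inner ℝ (gradient S.Kstar (y t)) y') t := by
  have h1 := (hS.differentiable_Kstar (y t)).hasGradientAt.hasFDerivAt.comp_hasDerivAt t h
  exact h1

/-- The energy identity along a single trajectory. -/
lemma Assumptions.integral_energy (hS : S.Assumptions) (hϰ : IsWeight T ϰ) (hT : 0 < T)
    {e : ℝ → Vec n} (he : IntervalIntegrable e volume 0 T)
    (hf : IntegrableOn (fun t => inner ℝ (gradient S.Kstar (backward T ϰ e t)) (e t) +
      ϰ t * S.K (gradient S.Kstar (backward T ϰ e t))) (Ioo 0 T))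
    (hk : IntegrableOn (fun t => S.Kstar (backward T ϰ e t)) (Ioo 0 T)) :
    ∫ t in Ioo 0 T, (inner ℝ (gradient S.Kstar (backward T ϰ e t)) (e t) +
      ϰ t * S.K (gradient S.Kstar (backward T ϰ e t))) =
      -(bigWeight T ϰ 0 * S.Kstar (backward T ϰ e 0)) := by
  set f : ℝ → ℝ := fun t => inner ℝ (gradient S.Kstar (backward T ϰ e t)) (e t) +
      ϰ t * S.K (gradient S.Kstar (backward T ϰ e t)) with hfdef
  -- With `Ϙ y' = e + ϰ y`, `Ϙ' = -ϰ` and `K(∇K*(y)) = ∇K*(y)·y - K*(y)`, the derivative of `m` is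
  -- exactly `f`.
  set m : ℝ → ℝ := fun t => bigWeight T ϰ t * S.Kstar (backward T ϰ e t) with hm
  have hfi : IntervalIntegrable f volume 0 T := intervalIntegrable_of_integrableOn_Ioo hT hf
  have hmb : ∀ b ∈ Ico 0 T, ∫ t in 0..b, f t = m b - m 0 := by
    intro b hb
    have hY := hϰ.backward_absolutelyContinuous hT he hb
    obtain ⟨R, hR⟩ := hY.exists_bound
    -- The trajectory stays in a ball on `[0,b]`, where `K*` is Lipschitz; the composition is
    -- therefore absolutely continuous.
    obtain ⟨L, hL⟩ := hS.contDiff_Kstar.contDiffOn.exists_lipschitzOnWith (by decide)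
      (convex_closedBall (0 : Vec n) R) (isCompact_closedBall 0 R)
    have hKY : AbsolutelyContinuousOnInterval (fun t => S.Kstar (backward T ϰ e t)) 0 b := by
      refine absolutelyContinuousOnInterval_of_dist_le L.2 hY fun s hs t ht => ?_
      exact hL.dist_le_mul _ (mem_closedBall_zero_iff.2 (hR s hs)) _
        (mem_closedBall_zero_iff.2 (hR t ht))
    have hq : AbsolutelyContinuousOnInterval (bigWeight T ϰ) 0 b := by
      refine (hϰ.absolutelyContinuous hT).mono ?_
      rw [uIcc_of_le hb.1, uIcc_of_le hT.le]
      exact Icc_subset_Icc_right hb.2.le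
    refine (intervalIntegrable_and_integral_eq_sub (f' := f) (hq.mul hKY) ?_).2
    filter_upwards [hϰ.ae_hasDerivAt hT, hϰ.backward_ae_hasDerivAt hT he] with t h1 h2 ht
    rw [uIcc_of_le hb.1] at ht
    have htI : t ∈ Ico 0 T := ⟨ht.1, ht.2.trans_lt hb.2⟩
    refine ((h1 htI).mul (hS.hasDerivAt_Kstar_comp (h2 htI))).congr_deriv ?_
    have hq0 := (hϰ.bigWeight_pos hT htI).ne'
    rw [inner_smul_right, inner_add_right, inner_smul_right, mul_inv_cancel_left₀ hq0, hfdef]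
    dsimp only
    rw [hS.K_gradient_Kstar]
    ring
  rw [setIntegral_Ioo_eq hT]
  obtain ⟨c, C, hc, hC, -, hq⟩ := hϰ.bounds hT
  -- The limit of `m` at `T` vanishes because `(T - t)⁻¹ m ≤ C K*(y)` is integrable; no pointwise
  -- control of `y` near `T` is required.
  have key := eq_zero_of_integrableOn_div hT (c := (∫ t in 0..T, f t) + m 0) (α := m)
    (B := fun t => ∫ s in t..T, f s) (Eventually.of_forall fun t ht => ?_) ?_ ?_
  · linarith
  · have h1 := hmb t ⟨ht.1.le, ht.2⟩
    have h2 := intervalIntegral.integral_add_adjacent_intervals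
      (hfi.mono_set (c := 0) (d := t) (by
        rw [uIcc_of_le ht.1.le, uIcc_of_le hT.le]; exact Icc_subset_Icc_right ht.2.le))
      (hfi.mono_set (c := t) (d := T) (by
        rw [uIcc_of_le ht.2.le, uIcc_of_le hT.le]; exact Icc_subset_Icc_left ht.1.le))
    linarith
  · have h1 := (absolutelyContinuousOnInterval_integral_right hfi).continuousOn T right_mem_uIcc
    rw [uIcc_of_le hT.le] at h1
    have h2 := h1.mono_left (nhdsWithin_le_iff.2
      (mem_of_superset (Ioo_mem_nhdsLT hT) Ioo_subset_Icc_self))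
    simpa using h2
  · refine (hk.const_mul C).mono' ?_ ?_
    · refine AEStronglyMeasurable.mul ?_ (AEStronglyMeasurable.mul ?_ hk.1)
      · exact (by fun_prop : Measurable fun t : ℝ => (T - t)⁻¹).aestronglyMeasurable
      · exact ((hϰ.continuousOn hT).mono Ioo_subset_Icc_self).aestronglyMeasurable measurableSet_Ioo
    · rw [ae_restrict_iff' measurableSet_Ioo]
      refine Eventually.of_forall fun t ht => ?_
      have h1 : 0 < T - t := by linarith [ht.2]
      have h2 := hϰ.bigWeight_pos hT ⟨ht.1.le, ht.2⟩
      have h3 := hS.Kstar_nonneg (backward T ϰ e t)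
      rw [Real.norm_of_nonneg (by positivity), ← mul_assoc]
      refine mul_le_mul_of_nonneg_right ?_ h3
      rw [inv_mul_le_iff₀ h1, mul_comm]
      exact (hq t ⟨ht.1.le, ht.2.le⟩).2

end System


/-! ### Strong solutions as backward primitives in time -/

lemma InOrlicz.integrable {X : Type*} [MeasurableSpace X] {μ : Measure X} [IsFiniteMeasure μ]
    {n : ℕ} {K : Vec n → ℝ} (hK : ∃ C : ℝ, ∀ y, 1 * ‖y‖ ≤ K y + C) {f : X → Vec n}
    (hf : InOrlicz K μ f) : Integrable f μ := by
  obtain ⟨C, hC⟩ := hK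
  refine (hf.2.add (integrable_const C)).mono' hf.1 (Eventually.of_forall fun x => ?_)
  simpa using hC (f x)

/-- Right neighbourhoods have positive measure. Hence essential limits are taken along a nontrivial
filter and carry information. -/
lemma neBot_nhdsGT_inf_ae (t : ℝ) : (𝓝[>] t ⊓ ae (volume : Measure ℝ)).NeBot := by
  rw [inf_neBot_iff]
  intro s hs u hu
  obtain ⟨b, hb, hsub⟩ := (mem_nhdsGT_iff_exists_Ioo_subset).1 hs
  by_contra hemp
  have h1 : Ioo t b ⊆ uᶜ := fun r hr hru => hemp ⟨r, hsub hr, hru⟩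
  have h2 := measure_mono_null h1 (mem_ae_iff.1 hu)
  rw [Real.volume_Ioo, ENNReal.ofReal_eq_zero] at h2
  have : t < b := hb
  linarith

lemma tendsto_lintegral_enorm_of_dominated {ι X V : Type*} [MeasurableSpace X] {μ : Measure X}
    [NormedAddCommGroup V] {l : Filter ι} [l.IsCountablyGenerated] {F : ι → X → V} {b : X → ℝ}
    (hm : ∀ᶠ t in l, AEStronglyMeasurable (F t) μ) (hb : ∀ᶠ t in l, ∀ᵐ x ∂μ, ‖F t x‖ ≤ b x)
    (hbi : Integrable b μ) (hlim : ∀ᵐ x ∂μ, Tendsto (fun t => F t x) l (𝓝 0)) :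
    Tendsto (fun t => ∫⁻ x, ‖F t x‖ₑ ∂μ) l (𝓝 0) := by
  have h1 := tendsto_integral_filter_of_dominated_convergence (F := fun t x => ‖F t x‖)
    (f := fun _ => (0 : ℝ)) b (by filter_upwards [hm] with t ht using ht.norm)
    (by simpa only [norm_norm] using hb) hbi (by
      filter_upwards [hlim] with x hx
      simpa using hx.norm)
  rw [integral_zero] at h1
  have h2 := ENNReal.tendsto_ofReal h1
  rw [ENNReal.ofReal_zero] at h2
  refine h2.congr' ?_
  filter_upwards [hm, hb] with t h3 h4
  exact ofReal_integral_norm_eq_lintegral_enorm (hbi.mono' h3 h4)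

namespace System

variable {d n N : ℕ} {S : System d n N} {T : ℝ} {ϰ : ℝ → ℝ}

namespace Assumptions

lemma integrable_of_inOrlicz_Kstar (hS : S.Assumptions) {X : Type*} [MeasurableSpace X]
    {μ : Measure X} [IsFiniteMeasure μ] {f : X → Vec n} (hf : InOrlicz S.Kstar μ f) :
    Integrable f μ :=
  hf.integrable (hS.K_nFunction.legendre_linear_bound 1 zero_le_one)

lemma inOrlicz_sharp (hS : S.Assumptions) {X : Type*} [MeasurableSpace X]
    {μ : Measure X} [IsFiniteMeasure μ] {f : X → Vec n} (hf : InOrlicz S.K μ f) :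
    InOrlicz S.Kstar μ fun x => S.sharp (f x) := by
  obtain ⟨C, hC⟩ := hS.K_nFunction.exists_legendre_gradient_le hS.differentiable_K hS.K_delta2
  have hm : AEStronglyMeasurable (fun x => S.sharp (f x)) μ :=
    hS.continuous_sharp.comp_aestronglyMeasurable hf.1
  refine ⟨hm, ((hf.2.add (integrable_const 1)).const_mul C).mono'
    (hS.continuous_Kstar.comp_aestronglyMeasurable hm) (Eventually.of_forall fun x => ?_)⟩
  rw [Real.norm_of_nonneg (hS.Kstar_nonneg _)]
  exact hC (f x)

lemma integrable_inner (hS : S.Assumptions) {X : Type*} [MeasurableSpace X]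
    {μ : Measure X} {f g : X → Vec n} (hf : InOrlicz S.K μ f)
    (hg : InOrlicz S.Kstar μ g) : Integrable (fun x => inner ℝ (f x) (g x)) μ := by
  refine (hf.2.add hg.2).mono' (hf.1.inner hg.1) (Eventually.of_forall fun x => ?_)
  exact hS.K_nFunction.abs_inner_le _ _

variable {v : ℝ × Torus d → Vec n} {E W : ℝ × Torus d → Vec n} {v₀ : Torus d → Vec n}

/-- The second integrability, due to `Ϙ ≤ C (T - t)`, is the substitute for `Ϙ v^# = 0` at time `T`.
-/
lemma integrable_weightedSharp (hS : S.Assumptions) (hT : 0 < T) (hϰ : IsWeight T ϰ)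
    (hv : InOrlicz S.K (stMeasure T d) v) :
    Integrable (S.weightedSharp T ϰ v) (stMeasure T d) ∧
      Integrable (fun z => (T - z.1)⁻¹ • S.weightedSharp T ϰ v z) (stMeasure T d) := by
  have hu := hS.integrable_of_inOrlicz_Kstar (hS.inOrlicz_sharp hv)
  obtain ⟨c, C, hc, hC, -, hq⟩ := hϰ.bounds hT
  have hm : AEStronglyMeasurable (S.weightedSharp T ϰ v) (stMeasure T d) :=
    (hϰ.bigWeight_aestronglyMeasurable hT d).smul hu.1
  constructor
  · refine (hu.norm.const_mul (C * T)).mono' hm ?_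
    filter_upwards [ae_mem_stMeasure T d] with z hz
    have h1 := hϰ.bigWeight_pos hT ⟨hz.1.le, hz.2⟩
    rw [weightedSharp, norm_smul, Real.norm_of_nonneg h1.le]
    refine mul_le_mul_of_nonneg_right ((hq _ ⟨hz.1.le, hz.2.le⟩).2.trans ?_) (norm_nonneg _)
    exact mul_le_mul_of_nonneg_left (by linarith [hz.1]) hC.le
  · have hm' : AEStronglyMeasurable (fun z : ℝ × Torus d => (T - z.1)⁻¹) (stMeasure T d) :=
      (by fun_prop : Measurable fun z : ℝ × Torus d => (T - z.1)⁻¹).aestronglyMeasurable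
    refine (hu.norm.const_mul C).mono' (hm'.smul hm) ?_
    filter_upwards [ae_mem_stMeasure T d] with z hz
    have h1 := hϰ.bigWeight_pos hT ⟨hz.1.le, hz.2⟩
    have h2 : 0 < T - z.1 := by linarith [hz.2]
    rw [weightedSharp, norm_smul, norm_smul, Real.norm_of_nonneg h1.le,
      Real.norm_of_nonneg (inv_pos.2 h2).le, ← mul_assoc]
    refine mul_le_mul_of_nonneg_right ?_ (norm_nonneg _)
    rw [inv_mul_le_iff₀ h2, mul_comm]
    exact (hq _ ⟨hz.1.le, hz.2.le⟩).2

lemma sharp_ae_eq_backward (hS : S.Assumptions) (hT : 0 < T) (hϰ : IsWeight T ϰ)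
    (hv : InOrlicz S.K (stMeasure T d) v) (hE : IsWeakDt T (S.weightedSharp T ϰ v) E)
    (hEi : Integrable E (stMeasure T d)) :
    ∀ᵐ z ∂stMeasure T d, S.sharp (v z) = backward T ϰ (fun s => E (s, z.2)) z.1 := by
  obtain ⟨h1, h2⟩ := hS.integrable_weightedSharp hT hϰ hv
  filter_upwards [hE.ae_eq hT h1 hEi h2, ae_mem_stMeasure T d] with z hz hz'
  have hq := (hϰ.bigWeight_pos hT ⟨hz'.1.le, hz'.2⟩).ne'
  rw [backward, ← smul_neg, ← hz, weightedSharp, inv_smul_smul₀ hq]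

/-- This is `∂ₜ(Ϙ v^#) = Ϙ ∂ₜ v^# - ϰ v^#`. As `ϰ` is merely measurable, `Ϙ` need not be smooth and
cannot be moved onto test functions; the product rule is taken from the backward representation
instead. -/
lemma dt_sharp_ae_eq (hS : S.Assumptions) (hT : 0 < T) (hϰ : IsWeight T ϰ)
    (hv : InOrlicz S.K (stMeasure T d) v) (hE : IsWeakDt T (S.weightedSharp T ϰ v) E)
    (hEi : Integrable E (stMeasure T d)) (hW : IsWeakDt T (fun z => S.sharp (v z)) W) :
    ∀ᵐ z ∂stMeasure T d,
      W z = (bigWeight T ϰ z.1)⁻¹ • (E z + ϰ z.1 • S.sharp (v z)) := by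
  have hu := hS.integrable_of_inOrlicz_Kstar (hS.inOrlicz_sharp hv)
  have hϰu : Integrable (fun z => ϰ z.1 • S.sharp (v z)) (stMeasure T d) := by
    obtain ⟨c, C, hc, hC, hb, -⟩ := hϰ.bounds hT
    refine (hu.norm.const_mul C).mono' ((hϰ.aestronglyMeasurable d).smul hu.1) ?_
    filter_upwards [ae_mem_stMeasure T d] with z hz
    have h1 := hb z.1 ⟨hz.1.le, hz.2.le⟩
    rw [norm_smul, Real.norm_of_nonneg (hc.le.trans h1.1)]
    exact mul_le_mul_of_nonneg_right h1.2 (norm_nonneg _)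
  have hcont : ContinuousOn (fun z : ℝ × Torus d => (bigWeight T ϰ z.1)⁻¹) (Ioo 0 T ×ˢ univ) := by
    refine ContinuousOn.inv₀ ?_ fun z hz => (hϰ.bigWeight_pos hT ⟨hz.1.1.le, hz.1.2⟩).ne'
    exact (hϰ.continuousOn hT).comp continuousOn_fst fun z hz => ⟨hz.1.1.le, hz.1.2.le⟩
  have hloc : LocallyIntegrableOn
      (fun z => (bigWeight T ϰ z.1)⁻¹ • (E z + ϰ z.1 • S.sharp (v z))) (Ioo 0 T ×ˢ univ) volume :=
    (locallyIntegrableOn_of_integrable (hEi.add hϰu)).continuousOn_smul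
      (isOpen_strip T d).isLocallyClosed hcont
  have hrep := hS.sharp_ae_eq_backward hT hϰ hv hE hEi
  have key : ∀ i, ∀ᵐ z ∂stMeasure T d,
      W z i = ((bigWeight T ϰ z.1)⁻¹ • (E z + ϰ z.1 • S.sharp (v z))) i := by
    intro i
    refine ae_eq_of_integral_test hT (hW.2.1.vec_apply i) (hloc.vec_apply i) fun η hη g hg => ?_
    have h1 := hW.scalar i η hη g hg
    suffices h2 : ∫ z, deriv η z.1 * (g z.2 * S.sharp (v z) i) ∂stMeasure T d =
        -∫ z, η z.1 * (g z.2 * ((bigWeight T ϰ z.1)⁻¹ • (E z + ϰ z.1 • S.sharp (v z))) i)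
          ∂stMeasure T d by
      rw [h1] at h2
      exact neg_injective h2
    have hgc : Continuous fun z : ℝ × Torus d => g z.2 := hg.continuous.comp continuous_snd
    have i1 : Integrable (fun z => deriv η z.1 * (g z.2 * S.sharp (v z) i)) (stMeasure T d) :=
      integrable_bdd_cont_mul (integrable_bdd_cont_mul (hu.vec_apply i) hgc)
        (hη.deriv.smooth.continuous.comp continuous_fst)
    have i2 : Integrable (fun z => η z.1 *
        (g z.2 * ((bigWeight T ϰ z.1)⁻¹ • (E z + ϰ z.1 • S.sharp (v z))) i)) (stMeasure T d) := by
      refine hη.integrable_mul ?_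
      have := locallyIntegrableOn_mul_cont (hloc.vec_apply i) hgc
      simpa only [mul_comm] using this
    rw [stMeasure] at i1 i2 ⊢
    rw [integral_prod_symm _ i1, integral_prod_symm _ i2, ← integral_neg]
    refine integral_congr_ae ?_
    filter_upwards [ae_space_ae_time hrep, ae_intervalIntegrable_slice hT hEi] with x hx hex
    have h3 := hϰ.integral_deriv_mul_backward hT hex hη i
    have e1 : ∫ t in Ioo 0 T, deriv η t * (g x * S.sharp (v (t, x)) i) =
        g x * ∫ t in Ioo 0 T, deriv η t * backward T ϰ (fun s => E (s, x)) t i := by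
      rw [← integral_const_mul]
      refine setIntegral_congr_ae measurableSet_Ioo ?_
      filter_upwards [hx] with t ht hm
      rw [ht hm]
      ring
    have e2 : ∫ t in Ioo 0 T, η t *
          (g x * ((bigWeight T ϰ t)⁻¹ • (E (t, x) + ϰ t • S.sharp (v (t, x)))) i) =
        g x * ∫ t in Ioo 0 T, η t * ((bigWeight T ϰ t)⁻¹ • (E (t, x) +
          ϰ t • backward T ϰ (fun s => E (s, x)) t)) i := by
      rw [← integral_const_mul]
      refine setIntegral_congr_ae measurableSet_Ioo ?_
      filter_upwards [hx] with t ht hm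
      rw [ht hm]
      ring
    rw [e1, e2, h3]
    ring
  filter_upwards [ae_all_iff.2 key] with z hz
  ext i
  exact hz i

/-- The initial value of a strong solution. -/
lemma sharp_initial_ae_eq (hS : S.Assumptions) (hT : 0 < T) (hϰ : IsWeight T ϰ)
    (hv : InOrlicz S.K (stMeasure T d) v) (hE : IsWeakDt T (S.weightedSharp T ϰ v) E)
    (hEi : Integrable E (stMeasure T d)) (hv₀ : InOrlicz S.K volume v₀)
    (hi : Tendsto (fun t : ℝ => ∫⁻ x, ‖S.sharp (v (t, x)) - S.sharp (v₀ x)‖ₑ)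
      (𝓝[>] 0 ⊓ ae volume) (𝓝 0)) :
    ∀ᵐ x, S.sharp (v₀ x) = backward T ϰ (fun s => E (s, x)) 0 := by
  have hT2 : T / 2 ∈ Ico 0 T := ⟨by linarith, by linarith⟩
  have hu₀ : AEStronglyMeasurable (fun x => S.sharp (v₀ x)) volume :=
    (hS.inOrlicz_sharp hv₀).1
  have hm : ∀ t ∈ Icc 0 T, AEStronglyMeasurable
      (fun x => backward T ϰ (fun s => E (s, x)) t) volume := by
    intro t ht
    have h1 : AEStronglyMeasurable (fun x => ∫ s in Ioc t T, E (s, x)) volume := by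
      have h2 : AEStronglyMeasurable E ((volume.restrict (Ioo t T)).prod volume) := by
        refine hEi.1.mono_measure ?_
        exact Measure.prod_mono (Measure.restrict_mono (Ioo_subset_Ioo_left ht.1) le_rfl) le_rfl
      have h3 := h2.prod_swap.integral_prod_right'
      refine h3.congr (Eventually.of_forall fun x => ?_)
      dsimp only
      rw [integral_Ioc_eq_integral_Ioo]
      rfl
    have h4 := (h1.const_smul (bigWeight T ϰ t)⁻¹).neg
    refine h4.congr (Eventually.of_forall fun x => ?_)
    simp only [Pi.neg_apply, Pi.smul_apply, backward]
    rw [intervalIntegral.integral_of_le ht.2]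
  -- The backward version is continuous at `0` for almost every `x`, with an integrable bound
  -- uniform on `[0,T/2]`; hence it is continuous at `0` in `L¹`.
  have hconv : Tendsto (fun t : ℝ => ∫⁻ x, ‖backward T ϰ (fun s => E (s, x)) t -
      backward T ϰ (fun s => E (s, x)) 0‖ₑ) (𝓝[>] 0) (𝓝 0) := by
    obtain ⟨R, hR⟩ := (hϰ.inv_absolutelyContinuous hT hT2).exists_bound
    have h0T : (0 : ℝ) ∈ Icc 0 T := left_mem_Icc.2 hT.le
    set F : Torus d → ℝ := fun x => ∫ s in Ioo 0 T, ‖E (s, x)‖ with hF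
    have hFi : Integrable F volume := hEi.norm.integral_prod_right
    have hF0 : ∀ x, 0 ≤ F x := fun x => integral_nonneg fun s => norm_nonneg _
    have hR0 : 0 ≤ R := (norm_nonneg _).trans (hR 0 left_mem_uIcc)
    have hle : ∀ t ∈ Icc 0 (T / 2), ∀ᵐ x, ‖backward T ϰ (fun s => E (s, x)) t‖ ≤ R * F x := by
      intro t ht
      filter_upwards [ae_intervalIntegrable_slice hT hEi] with x hx
      rw [backward, norm_neg, norm_smul]
      refine mul_le_mul (hR t ?_) ?_ (norm_nonneg _) hR0
      · rwa [uIcc_of_le hT2.1]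
      · have htT : t ≤ T := ht.2.trans hT2.2.le
        refine (intervalIntegral.norm_integral_le_integral_norm htT).trans ?_
        rw [hF]
        dsimp only
        rw [setIntegral_Ioo_eq hT]
        exact intervalIntegral.integral_mono_interval ht.1 htT le_rfl
          (Eventually.of_forall fun _ => norm_nonneg _) hx.norm
    refine tendsto_lintegral_enorm_of_dominated (b := fun x => R * F x + R * F x) ?_ ?_
      ((hFi.const_mul R).add (hFi.const_mul R)) ?_
    · filter_upwards [Ioo_mem_nhdsGT hT] with t ht
      exact (hm t ⟨ht.1.le, ht.2.le⟩).sub (hm 0 h0T)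
    · filter_upwards [Ioo_mem_nhdsGT (by linarith : (0 : ℝ) < T / 2)] with t ht
      filter_upwards [hle t ⟨ht.1.le, ht.2.le⟩, hle 0 ⟨le_rfl, by linarith⟩] with x h1 h2
      exact (norm_sub_le _ _).trans (add_le_add h1 h2)
    · filter_upwards [ae_intervalIntegrable_slice hT hEi] with x hx
      have h1 := (hϰ.backward_absolutelyContinuous hT hx hT2).continuousOn 0 left_mem_uIcc
      rw [uIcc_of_le hT2.1] at h1
      have h2 := h1.mono_left (nhdsWithin_le_iff.2
        (mem_of_superset (Ioo_mem_nhdsGT (by linarith : (0 : ℝ) < T / 2)) Ioo_subset_Icc_self))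
      have h3 := h2.sub_const (backward T ϰ (fun s => E (s, x)) 0)
      rwa [sub_self] at h3
  have := neBot_nhdsGT_inf_ae 0
  have hsum := hi.add (hconv.mono_left inf_le_left)
  rw [add_zero] at hsum
  -- The left side is independent of `t`, so passing to the limit makes it zero. The almost
  -- everywhere filter excludes the times at which `v^#` and its backward version may differ.
  have hle : ∀ᶠ t in 𝓝[>] 0 ⊓ ae volume,
      ∫⁻ x, ‖S.sharp (v₀ x) - backward T ϰ (fun s => E (s, x)) 0‖ₑ ≤
      (∫⁻ x, ‖S.sharp (v (t, x)) - S.sharp (v₀ x)‖ₑ) + ∫⁻ x, ‖backward T ϰ (fun s => E (s, x)) t -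
      backward T ϰ (fun s => E (s, x)) 0‖ₑ := by
    have h1 := ae_time_ae_space (hS.sharp_ae_eq_backward hT hϰ hv hE hEi)
    have h2 : ∀ᶠ t in 𝓝[>] (0 : ℝ) ⊓ ae volume, t ∈ Ioo 0 T :=
      Filter.mem_inf_of_left (Ioo_mem_nhdsGT hT)
    filter_upwards [h2, Filter.mem_inf_of_right h1] with t ht h3
    have h4 := h3 ht
    have h5 : ∫⁻ x, ‖S.sharp (v (t, x)) - S.sharp (v₀ x)‖ₑ =
        ∫⁻ x, ‖backward T ϰ (fun s => E (s, x)) t - S.sharp (v₀ x)‖ₑ := by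
      refine lintegral_congr_ae ?_
      filter_upwards [h4] with x hx
      rw [hx]
    have h6 : AEMeasurable (fun x => ‖backward T ϰ (fun s => E (s, x)) t - S.sharp (v₀ x)‖ₑ)
        volume := ((hm t ⟨ht.1.le, ht.2.le⟩).sub hu₀).enorm
    rw [h5, ← lintegral_add_left' h6]
    refine lintegral_mono fun x => ?_
    rw [← enorm_neg (backward T ϰ (fun s => E (s, x)) t - S.sharp (v₀ x))]
    refine le_trans (le_of_eq ?_) (enorm_add_le _ _)
    congr 1
    abel
  have hzero : ∫⁻ x, ‖S.sharp (v₀ x) - backward T ϰ (fun s => E (s, x)) 0‖ₑ = 0 :=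
    le_antisymm (ge_of_tendsto hsum hle) bot_le
  have h7 : AEMeasurable (fun x => ‖S.sharp (v₀ x) - backward T ϰ (fun s => E (s, x)) 0‖ₑ)
      volume := (hu₀.sub (hm 0 (left_mem_Icc.2 hT.le))).enorm
  rw [lintegral_eq_zero_iff' h7] at hzero
  filter_upwards [hzero] with x hx
  simpa [sub_eq_zero] using hx

end Assumptions

end System


lemma InOrlicz.congr {X : Type*} [MeasurableSpace X] {μ : Measure X} {n : ℕ} {K : Vec n → ℝ}
    {f g : X → Vec n} (hf : InOrlicz K μ f) (h : f =ᵐ[μ] g) : InOrlicz K μ g := by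
  refine ⟨hf.1.congr h, hf.2.congr ?_⟩
  filter_upwards [h] with x hx
  rw [hx]

lemma InOrlicz.comp_snd {d n : ℕ} {K : Vec n → ℝ} {f : Torus d → Vec n} (T : ℝ)
    (hf : InOrlicz K volume f) : InOrlicz K (stMeasure T d) fun z => f z.2 :=
  ⟨hf.1.comp_snd, hf.2.comp_snd _⟩

namespace System

variable {d n N : ℕ} {S : System d n N} {T : ℝ} {ϰ : ℝ → ℝ}

/-! ### The projection onto `Λ` -/

variable (S) in
/-- The Frobenius-orthogonal projection onto `Λ`. -/
def projLam (A : Mat N) : Mat N :=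
  Matrix.of fun l m => (S.Lam.map (matVec N)).starProjection (matVec N A) (l, m)

lemma matVec_projLam (A : Mat N) :
    matVec N (S.projLam A) = (S.Lam.map (matVec N)).starProjection (matVec N A) := by
  ext p
  rfl

lemma matVec_injective : Function.Injective (matVec N) := by
  intro A B h
  ext l m
  exact congrArg (fun w : EuclideanSpace ℝ (Fin N × Fin N) => w (l, m)) h

lemma projLam_mem (A : Mat N) : S.projLam A ∈ S.Lam := by
  have h : matVec N (S.projLam A) ∈ S.Lam.map (matVec N) := by
    rw [matVec_projLam]
    exact Submodule.starProjection_apply_mem _ _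
  obtain ⟨B, hB, he⟩ := h
  rwa [← matVec_injective he]

lemma frob_projLam_comm (A B : Mat N) : frob (S.projLam A) B = frob A (S.projLam B) := by
  rw [← inner_matVec, ← inner_matVec, matVec_projLam, matVec_projLam,
    Submodule.inner_starProjection_left_eq_right]

lemma projLam_of_mem {P : Mat N} (hP : P ∈ S.Lam) : S.projLam P = P := by
  apply matVec_injective
  rw [matVec_projLam]
  exact Submodule.starProjection_eq_self_iff.2 (Submodule.mem_map_of_mem hP)

lemma frob_projLam_of_mem (A : Mat N) {P : Mat N} (hP : P ∈ S.Lam) :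
    frob (S.projLam A) P = frob A P := by
  rw [frob_projLam_comm, projLam_of_mem hP]

lemma frob_single (A : Mat N) (l m : Fin N) : frob A (Matrix.single l m 1) = A l m := by
  simp only [frob, Matrix.single_apply]
  rw [Finset.sum_eq_single l (fun i _ hi => Finset.sum_eq_zero fun j _ => by
    simp [hi.symm]) (by simp), Finset.sum_eq_single m (fun j _ hj => by
    simp [hj.symm]) (by simp)]
  simp

lemma projLam_apply (A : Mat N) (l m : Fin N) :
    S.projLam A l m = frob A (S.projLam (Matrix.single l m 1)) := by
  rw [← frob_projLam_comm, frob_single]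

lemma contDiff_primitive {η : ℝ → ℝ} (hη : ContDiff ℝ ∞ η) :
    ContDiff ℝ ∞ (fun t => ∫ s in (0 : ℝ)..t, η s) ∧ ∀ t, deriv (fun t => ∫ s in (0 : ℝ)..t, η s) t = η t := by
  have h1 : ∀ t, deriv (fun t => ∫ s in (0 : ℝ)..t, η s) t = η t := fun t =>
    hη.continuous.deriv_integral η 0 t
  refine ⟨?_, h1⟩
  rw [contDiff_infty_iff_deriv]
  refine ⟨fun t => (intervalIntegral.integral_hasDerivAt_right
    (hη.continuous.intervalIntegrable 0 t) (hη.continuous.stronglyMeasurableAtFilter _ _)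
    hη.continuous.continuousAt).differentiableAt, ?_⟩
  rw [funext h1]
  exact hη

/-- The matrix part of an admissible pair takes values in `Λ`. -/
lemma Admissible.ae_mem_Lam (hT : 0 < T) {p : (ℝ × Torus d → Vec n) × (ℝ × Torus d → Mat N)}
    (hp : p ∈ S.Admissible T) : ∀ᵐ z ∂stMeasure T d, p.2 z ∈ S.Lam := by
  obtain ⟨⟨hE, hB, hsym⟩, hcon⟩ := hp
  have hBi : ∀ l m, LocallyIntegrableOn (fun z => p.2 z l m) (Ioo 0 T ×ˢ univ) volume :=
    fun l m => locallyIntegrableOn_of_integrable ((hB l m).integrable le_top)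
  have key : ∀ l m, ∀ᵐ z ∂stMeasure T d,
      frob (p.2 z) (symPart (Matrix.single l m 1 - S.projLam (Matrix.single l m 1))) = 0 := by
    intro l m
    -- The part of a unit matrix orthogonal to `Λ`; it is symmetrized below because test fields must
    -- be symmetric.
    set C : Mat N := Matrix.single l m 1 - S.projLam (Matrix.single l m 1) with hC
    have hCperp : ∀ P ∈ S.Lam, frob P (symPart C) = 0 := by
      intro P hP
      rw [frob_symPart (S.Lam_isSymm hP), hC, frob_sub_right, ← frob_projLam_comm,
        projLam_of_mem hP, sub_self]
    refine ae_eq_of_integral_test (f' := fun _ => 0) hT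
      (locallyIntegrableOn_frob hBi fun _ _ => continuous_const)
      (locallyIntegrableOn_of_integrable (integrable_const 0)) fun η hη g hg => ?_
    obtain ⟨hθ, hd⟩ := contDiff_primitive hη.smooth
    set θ : ℝ → ℝ := fun t => ∫ s in (0 : ℝ)..t, η s with hθdef
    -- The primitive of `η` from `0` satisfies the initial condition on test fields, which need not
    -- vanish at `T`. Since `L` annihilates this field, the constraint reduces to the pairing of `B`
    -- with `η g C`.
    have hΨ := (smoothSymTX_const (d := d) hg (symPart_isSymm C)).smul hθ
    have h1 := hcon _ hΨ fun x => by simp [hθdef]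
    simp only [mul_zero, integral_zero]
    rw [← h1]
    refine integral_congr_ae (Eventually.of_forall fun z => ?_)
    have e1 : S.L (fun y => θ z.1 • g y • symPart C) z.2 = 0 := by
      rw [S.L_slice_smul θ (fun z => g z.2 • symPart C) z]
      simp only
      rw [S.L_smul_eq_zero (symPart_isSymm C) hCperp hg, smul_zero]
    have e2 : dtMat (fun z : ℝ × Torus d => θ z.1 • g z.2 • symPart C) z =
        (η z.1 * g z.2) • symPart C := by
      ext i j
      simp only [dtMat, Matrix.of_apply, Matrix.smul_apply, smul_eq_mul]
      rw [deriv_mul_const (hθ.differentiable (by simp) _), hd]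
      ring
    dsimp only
    rw [e1, e2, inner_zero_right, add_zero, frob_smul_right]
    ring
  have key' : ∀ᵐ z ∂stMeasure T d, ∀ l m,
      frob (p.2 z) (symPart (Matrix.single l m 1 - S.projLam (Matrix.single l m 1))) = 0 :=
    ae_all_iff.2 fun l => ae_all_iff.2 fun m => key l m
  filter_upwards [key', hsym] with z hz hs
  have : p.2 z = S.projLam (p.2 z) := by
    ext l m
    have h1 := hz l m
    rw [frob_symPart hs, frob_sub_right, frob_single, ← projLam_apply] at h1
    linarith
  rw [this]
  exact projLam_mem _

/-! ### Integrability in the payoff -/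

lemma integrable_frob_of_memLp_top {M Q : ℝ × Torus d → Mat N}
    (hM : ∀ l m, Integrable (fun z => M z l m) (stMeasure T d))
    (hQ : ∀ l m, MemLp (fun z => Q z l m) ⊤ (stMeasure T d)) :
    Integrable (fun z => frob (M z) (Q z)) (stMeasure T d) :=
  integrable_finsetSum _ fun l _ => integrable_finsetSum _ fun m _ =>
    (hM l m).mul_of_top_left (hQ l m)

lemma Assumptions.integrable_frob_F_const (hS : S.Assumptions) {v : ℝ × Torus d → Vec n}
    (hv : InOrlicz S.K (stMeasure T d) v) {P : Mat N} (hP : P ∈ S.Lam) :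
    Integrable (fun z => frob (S.F (v z)) P) (stMeasure T d) := by
  have hm : AEStronglyMeasurable (fun z => frob (S.F (v z)) P) (stMeasure T d) := by
    have hc : Continuous fun w => frob (S.F w) P := by
      have := hS.continuous_F
      simp only [frob]
      fun_prop
    exact hc.comp_aestronglyMeasurable hv.1
  refine (((hv.2.const_mul 2).add (integrable_const (S.F 0).trace)).const_mul
    (∑ l, ∑ m, |P l m|)).mono' hm (Eventually.of_forall fun z => ?_)
  have := hS.abs_frob_F_le (v z) hP
  rwa [Assumptions.trace_F] at this

lemma Assumptions.integrable_projLam_F (hS : S.Assumptions) {v : ℝ × Torus d → Vec n}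
    (hv : InOrlicz S.K (stMeasure T d) v) (l m : Fin N) :
    Integrable (fun z => S.projLam (S.F (v z)) l m) (stMeasure T d) := by
  simp only [projLam_apply (S := S) (S.F _)]
  exact hS.integrable_frob_F_const hv (projLam_mem _)

/-- `F(v)` itself is not known to be integrable, only its components along `Λ` are. The projection
leaves all pairings with elements of `Λ` unchanged, so it may replace `F(v)` as the matrix of a
subsolution. -/
lemma Assumptions.projLam_F_mem_subClass (hS : S.Assumptions) {v : ℝ × Torus d → Vec n}
    (hv : InOrlicz S.K (stMeasure T d) v) :
    (v, fun z => S.projLam (S.F (v z))) ∈ S.SubClass T := by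
  refine ⟨hv, fun l m => hS.integrable_projLam_F hv l m, Eventually.of_forall fun z => ⟨?_, ?_⟩⟩
  · exact (S.Lam_isSymm (projLam_mem _)).sub (hS.F_symm _)
  · intro P hP _
    dsimp only
    rw [frob_sub_left, frob_projLam_of_mem _ hP, sub_self]

variable {p : (ℝ × Torus d → Vec n) × (ℝ × Torus d → Mat N)}

lemma Admissible.integrable_frob_F (hS : S.Assumptions) (hT : 0 < T) {v : ℝ × Torus d → Vec n}
    (hv : InOrlicz S.K (stMeasure T d) v) (hp : p ∈ S.Admissible T) :
    Integrable (fun z => frob (S.F (v z)) (p.2 z)) (stMeasure T d) := by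
  refine (integrable_frob_of_memLp_top (hS.integrable_projLam_F hv) hp.1.2.1).congr ?_
  filter_upwards [Admissible.ae_mem_Lam hT hp] with z hz
  exact frob_projLam_of_mem _ hz

lemma memLp_top_slope (hϰ : IsWeight T ϰ) (hp : p ∈ S.Admissible T) (l m : Fin N) :
    MemLp (fun z => (ϰ z.1 • (1 : Mat N) + (2 : ℝ) • p.2 z) l m) ⊤ (stMeasure T d) := by
  have h1 : MemLp (fun z : ℝ × Torus d => ϰ z.1) ⊤ (stMeasure T d) := by
    obtain ⟨c, C, hc, hb⟩ := hϰ.2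
    refine MemLp.of_bound (hϰ.aestronglyMeasurable d) C ?_
    filter_upwards [ae_mem_stMeasure T d] with z hz
    have h1 := hb z.1 ⟨hz.1.le, hz.2.le⟩
    rw [Real.norm_of_nonneg (hc.le.trans h1.1)]
    exact h1.2
  have h2 := (h1.mul_const ((1 : Mat N) l m)).add ((hp.1.2.1 l m).const_mul 2)
  exact h2

lemma slope_mem_Lam {ϰ : ℝ} {B : Mat N} (hB : B ∈ S.Lam) :
    ϰ • (1 : Mat N) + (2 : ℝ) • B ∈ S.Lam :=
  S.Lam.add_mem (S.Lam.smul_mem _ S.one_mem_Lam) (S.Lam.smul_mem _ hB)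

lemma payoff_projLam (hT : 0 < T) {v₀ : Torus d → Vec n} {v : ℝ × Torus d → Vec n}
    (hp : p ∈ S.Admissible T) :
    payoff T ϰ v₀ v (fun z => S.projLam (S.F (v z))) p.1 p.2 =
      payoff T ϰ v₀ v (fun z => S.F (v z)) p.1 p.2 := by
  refine integral_congr_ae ?_
  filter_upwards [Admissible.ae_mem_Lam hT hp] with z hz
  rw [frob_projLam_of_mem _ (slope_mem_Lam hz)]

lemma integrable_payoff (hS : S.Assumptions) (hϰ : IsWeight T ϰ) {v₀ : Torus d → Vec n}
    (hv₀ : InOrlicz S.K volume v₀) (hp : p ∈ S.Admissible T)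
    {q : (ℝ × Torus d → Vec n) × (ℝ × Torus d → Mat N)} (hq : q ∈ S.SubClass T) :
    Integrable (fun z => inner ℝ (q.1 z) (p.1 z) +
      1 / 2 * frob (q.2 z) (ϰ z.1 • (1 : Mat N) + (2 : ℝ) • p.2 z)) (stMeasure T d) ∧
    Integrable (fun z => inner ℝ (v₀ z.2) (p.1 z)) (stMeasure T d) :=
  ⟨(hS.integrable_inner hq.1 hp.1.1).add
    ((integrable_frob_of_memLp_top hq.2.1 (memLp_top_slope hϰ hp)).const_mul _),
    hS.integrable_inner (hv₀.comp_snd T) hp.1.1⟩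

lemma payoff_eq_sub (hS : S.Assumptions) (hϰ : IsWeight T ϰ) {v₀ : Torus d → Vec n}
    (hv₀ : InOrlicz S.K volume v₀) (hp : p ∈ S.Admissible T)
    {q : (ℝ × Torus d → Vec n) × (ℝ × Torus d → Mat N)} (hq : q ∈ S.SubClass T) :
    payoff T ϰ v₀ q.1 q.2 p.1 p.2 =
      payoff T ϰ 0 q.1 q.2 p.1 p.2 - ∫ z, inner ℝ (v₀ z.2) (p.1 z) ∂stMeasure T d := by
  obtain ⟨h1, h2⟩ := integrable_payoff hS hϰ hv₀ hp hq
  rw [payoff, payoff]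
  simp only [Pi.zero_apply, sub_zero]
  rw [← integral_sub h1 h2]
  refine integral_congr_ae (Eventually.of_forall fun z => ?_)
  dsimp only
  rw [inner_sub_left]
  ring

end System


/-! ### The dual pair attached to a strong solution -/

namespace System

variable {d n N : ℕ} {S : System d n N} {T : ℝ} {ϰ : ℝ → ℝ} {v₀ : Torus d → Vec n}
  {v : ℝ × Torus d → Vec n}

lemma IsWeakLstar.weighted (hT : 0 < T) (hϰ : IsWeight T ϰ) {G : ℝ × Torus d → Mat N}
    (hG : S.IsWeakLstar T (fun z => S.sharp (v z)) G) :
    S.IsWeakLstar T (S.weightedSharp T ϰ v) fun z => bigWeight T ϰ z.1 • G z := by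
  have hcont : ContinuousOn (fun z : ℝ × Torus d => bigWeight T ϰ z.1) (Ioo 0 T ×ˢ univ) :=
    (hϰ.continuousOn hT).comp continuousOn_fst fun z hz => ⟨hz.1.1.le, hz.1.2.le⟩
  refine hG.time_mul hT (bigWeight T ϰ) (fun _ => rfl) (fun _ => rfl) ?_ fun l m => ?_
  · exact hG.1.continuousOn_smul (isOpen_strip T d).isLocallyClosed hcont
  · exact (hG.2.1 l m).continuousOn_smul (isOpen_strip T d).isLocallyClosed hcont

/-- The pair `(∂ₜ(Ϙ v^#), L*(Ϙ v^#))` attached to a strong solution, with its properties. -/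
structure IsDualPair (S : System d n N) (T : ℝ) (ϰ : ℝ → ℝ) (v₀ : Torus d → Vec n)
    (v : ℝ × Torus d → Vec n) (E : ℝ × Torus d → Vec n) (B : ℝ × Torus d → Mat N) : Prop where
  datum : InOrlicz S.K volume v₀
  weak : S.IsWeakSolution T v₀ v
  admissible : (E, B) ∈ S.Admissible T
  sharp_eq : ∀ᵐ z ∂stMeasure T d, S.sharp (v z) = backward T ϰ (fun s => E (s, z.2)) z.1
  initial : ∀ᵐ x, S.sharp (v₀ x) = backward T ϰ (fun s => E (s, x)) 0
  equation : ∀ᵐ z ∂stMeasure T d, ∀ k,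
    E z k + ϰ z.1 * S.sharp (v z) k + frob (B z) (S.dF k (v z)) = 0
  conservative : ∫ z, frob (S.F (v z)) (B z) ∂stMeasure T d = 0

/-- Formulated for arbitrary versions of the weak derivatives: these are unique almost everywhere,
so each version inherits the integrability in the definition of a strong solution. The equation is
the original one multiplied by `Ϙ`. -/
lemma IsStrongSolution.isDualPair (hS : S.Assumptions) (hT : 0 < T) (hϰ : IsWeight T ϰ)
    (hv : S.IsStrongSolution T ϰ v₀ v) {E : ℝ × Torus d → Vec n} {B : ℝ × Torus d → Mat N}
    (hE : IsWeakDt T (S.weightedSharp T ϰ v) E) (hB : S.IsWeakLstar T (S.weightedSharp T ϰ v) B) :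
    S.IsDualPair T ϰ v₀ v E B := by
  obtain ⟨E', hE', hEo'⟩ := hv.dt_class
  obtain ⟨W, G, hW, hG, hGb, heq⟩ := hv.equation
  have hvK := hv.weak.1
  have hEo : InOrlicz S.Kstar (stMeasure T d) E := hEo'.congr (hE'.ae_unique hT hE)
  have hEi := hS.integrable_of_inOrlicz_Kstar hEo
  have hBG := hB.ae_unique hT (hG.weighted hT hϰ)
  have hBm : ∀ l m, MemLp (fun z => B z l m) ⊤ (stMeasure T d) := fun l m => by
    refine (hGb l m).ae_eq ?_
    filter_upwards [hBG] with z hz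
    rw [hz]
    rfl
  have hrep := hS.sharp_ae_eq_backward hT hϰ hvK hE hEi
  obtain ⟨ha1, ha2⟩ := hS.integrable_weightedSharp hT hϰ hvK
  refine ⟨hv.datum, hv.weak, ⟨⟨hEo, hBm, hB.2.2.1⟩, ?_⟩, hrep,
    hS.sharp_initial_ae_eq hT hϰ hvK hE hEi hv.datum hv.initial, ?_, ?_⟩
  · exact S.constraint_of_weak hT ha1 hEi (fun l m => (hBm l m).integrable le_top)
      (hE.ae_eq hT ha1 hEi ha2) hB
  · filter_upwards [heq, hS.dt_sharp_ae_eq hT hϰ hvK hE hEi hW, hBG, ae_mem_stMeasure T d]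
      with z h1 h2 h3 h4 k
    have hq := (hϰ.bigWeight_pos hT ⟨h4.1.le, h4.2⟩).ne'
    have h5 := h1 k
    rw [hS.gradient_Kstar_sharp, h2] at h5
    simp only [PiLp.smul_apply, PiLp.add_apply, smul_eq_mul] at h5
    rw [h3, frob_smul_left]
    field_simp at h5
    linarith
  · rw [← hS.integral_frob_F_eq_zero hT hϰ (hS.integrable_of_inOrlicz_Kstar (hS.inOrlicz_sharp hvK))
      (hS.inOrlicz_sharp hvK).2 hG hGb]
    refine integral_congr_ae ?_
    filter_upwards [hBG] with z hz
    rw [hz]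

/-! ### The energy identity -/

lemma integral_stMeasure_fst (hT : 0 < T) (f : ℝ → ℝ) :
    ∫ z, f z.1 ∂stMeasure T d = ∫ t in 0..T, f t := by
  rw [stMeasure, ← setIntegral_Ioo_eq hT]
  have := integral_prod_mul (μ := volume.restrict (Ioo 0 T)) (ν := (volume : Measure (Torus d)))
    f (fun _ => (1 : ℝ))
  simpa using this

lemma _root_.DualConsistency.IsWeight.integrable_mul (hϰ : IsWeight T ϰ) (hT : 0 < T)
    {f : ℝ × Torus d → ℝ} (hf : Integrable f (stMeasure T d)) :
    Integrable (fun z => ϰ z.1 * f z) (stMeasure T d) := by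
  obtain ⟨c, C, hc, hC, hb, -⟩ := hϰ.bounds hT
  refine (hf.norm.const_mul C).mono' ((hϰ.aestronglyMeasurable d).mul hf.1) ?_
  filter_upwards [ae_mem_stMeasure T d] with z hz
  have h1 := hb z.1 ⟨hz.1.le, hz.2.le⟩
  rw [norm_mul, Real.norm_of_nonneg (hc.le.trans h1.1)]
  exact mul_le_mul_of_nonneg_right h1.2 (norm_nonneg _)

namespace IsDualPair

variable {E : ℝ × Torus d → Vec n} {B : ℝ × Torus d → Mat N}

lemma integral_energy (h : S.IsDualPair T ϰ v₀ v E B) (hS : S.Assumptions) (hT : 0 < T)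
    (hϰ : IsWeight T ϰ) :
    ∫ z, (inner ℝ (v z) (E z) + ϰ z.1 * S.K (v z)) ∂stMeasure T d =
      -(bigWeight T ϰ 0 * ∫ x, S.Kstar (S.sharp (v₀ x))) := by
  have hvK := h.weak.1
  have hEi := hS.integrable_of_inOrlicz_Kstar h.admissible.1.1
  have hfi : Integrable (fun z => inner ℝ (v z) (E z) + ϰ z.1 * S.K (v z)) (stMeasure T d) :=
    (hS.integrable_inner hvK h.admissible.1.1).add (hϰ.integrable_mul hT hvK.2)
  have hki := (hS.inOrlicz_sharp hvK).2
  rw [← integral_const_mul, ← integral_neg]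
  have hfi' := hfi
  rw [stMeasure] at hfi' ⊢
  rw [integral_prod_symm _ hfi']
  refine integral_congr_ae ?_
  filter_upwards [ae_space_ae_time h.sharp_eq, h.initial, ae_intervalIntegrable_slice hT hEi,
    hfi.prod_left_ae, hki.prod_left_ae] with x hx h0 hex hf hk
  have hy : ∀ᵐ t, t ∈ Ioo 0 T → v (t, x) = gradient S.Kstar (backward T ϰ (fun s => E (s, x)) t) := by
    filter_upwards [hx] with t ht hm
    rw [← ht hm, hS.gradient_Kstar_sharp]
  have e1 : (fun t => inner ℝ (v (t, x)) (E (t, x)) + ϰ t * S.K (v (t, x)))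
      =ᵐ[volume.restrict (Ioo 0 T)]
      fun t => inner ℝ (gradient S.Kstar (backward T ϰ (fun s => E (s, x)) t)) (E (t, x)) +
        ϰ t * S.K (gradient S.Kstar (backward T ϰ (fun s => E (s, x)) t)) := by
    rw [EventuallyEq, ae_restrict_iff' measurableSet_Ioo]
    filter_upwards [hy] with t ht hm
    rw [← ht hm]
  have e2 : (fun t => S.Kstar (S.sharp (v (t, x)))) =ᵐ[volume.restrict (Ioo 0 T)]
      fun t => S.Kstar (backward T ϰ (fun s => E (s, x)) t) := by
    rw [EventuallyEq, ae_restrict_iff' measurableSet_Ioo]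
    filter_upwards [hx] with t ht hm
    rw [← ht hm]
  rw [h0, ← hS.integral_energy hϰ hT hex (hf.congr e1) (hk.congr e2)]
  exact integral_congr_ae e1

/-- The datum does not depend on time, and the backward formula at `0` says `∫₀ᵀ E dt = -Ϙ(0) v₀^#`.
-/
lemma integral_datum (h : S.IsDualPair T ϰ v₀ v E B) (hS : S.Assumptions) (hT : 0 < T)
    (hϰ : IsWeight T ϰ) :
    ∫ z, inner ℝ (v₀ z.2) (E z) ∂stMeasure T d =
      -(bigWeight T ϰ 0 * ∫ x, inner ℝ (v₀ x) (S.sharp (v₀ x))) := by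
  have hEi := hS.integrable_of_inOrlicz_Kstar h.admissible.1.1
  have hi : Integrable (fun z : ℝ × Torus d => inner ℝ (v₀ z.2) (E z)) (stMeasure T d) :=
    hS.integrable_inner (h.datum.comp_snd T) h.admissible.1.1
  rw [← integral_const_mul, ← integral_neg]
  rw [stMeasure] at hi ⊢
  rw [integral_prod_symm _ hi]
  refine integral_congr_ae ?_
  filter_upwards [h.initial, ae_intervalIntegrable_slice hT hEi, hEi.prod_left_ae] with x h0 hex hi'
  have hq := (hϰ.bigWeight_pos hT ⟨le_rfl, hT⟩).ne'
  rw [h0, backward, inner_neg_right, inner_smul_right, mul_neg, neg_neg, mul_inv_cancel_left₀ hq,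
    integral_inner hi', setIntegral_Ioo_eq hT]

/-- The energy balance of a strong solution. -/
lemma integral_weight_mul_K (h : S.IsDualPair T ϰ v₀ v E B) (hS : S.Assumptions) (hT : 0 < T)
    (hϰ : IsWeight T ϰ) :
    ∫ z, ϰ z.1 * S.K (v z) ∂stMeasure T d = bigWeight T ϰ 0 * ∫ x, S.K (v₀ x) := by
  have hvK := h.weak.1
  have h1 := h.integral_energy hS hT hϰ
  have h2 := h.integral_datum hS hT hϰ
  -- The solution is tested with its own dual pair. By conservativity the flux term drops out, which
  -- equates `∫ v·E` with `∫ v₀·E`.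
  have h3 := h.weak.2 _ h.admissible
  have i1 := hS.integrable_inner hvK h.admissible.1.1
  have i2 : Integrable (fun z : ℝ × Torus d => inner ℝ (v₀ z.2) (E z)) (stMeasure T d) :=
    hS.integrable_inner (h.datum.comp_snd T) h.admissible.1.1
  have i3 := Admissible.integrable_frob_F hS hT hvK h.admissible
  have i4 : Integrable (fun x => inner ℝ (v₀ x) (S.sharp (v₀ x))) volume :=
    hS.integrable_inner h.datum (hS.inOrlicz_sharp h.datum)
  simp only [inner_sub_left] at h3
  have i12 : Integrable (fun z : ℝ × Torus d => inner ℝ (v z) (E z) - inner ℝ (v₀ z.2) (E z))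
      (stMeasure T d) := i1.sub i2
  rw [integral_add i12 i3, integral_sub i1 i2, h.conservative] at h3
  rw [integral_add i1 (hϰ.integrable_mul hT hvK.2)] at h1
  have h4 : ∫ x, S.Kstar (S.sharp (v₀ x)) =
      (∫ x, inner ℝ (v₀ x) (S.sharp (v₀ x))) - ∫ x, S.K (v₀ x) := by
    rw [← integral_sub i4 h.datum.2]
    exact integral_congr_ae (Eventually.of_forall fun x =>
      hS.K_nFunction.legendre_gradient hS.differentiable_K (v₀ x))
  rw [h4] at h1
  rw [mul_sub] at h1
  linarith

/-- Along a strong solution the payoff does not depend on the admissible pair. -/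
lemma payoff_eq (h : S.IsDualPair T ϰ v₀ v E B) (hS : S.Assumptions) (hT : 0 < T)
    (hϰ : IsWeight T ϰ) {p : (ℝ × Torus d → Vec n) × (ℝ × Torus d → Mat N)}
    (hp : p ∈ S.Admissible T) :
    payoff T ϰ v₀ v (fun z => S.F (v z)) p.1 p.2 = bigWeight T ϰ 0 * S.K₀ v₀ := by
  have hvK := h.weak.1
  have h3 := h.weak.2 _ hp
  have i1 : Integrable (fun z => inner ℝ (v z - v₀ z.2) (p.1 z) + frob (S.F (v z)) (p.2 z))
      (stMeasure T d) := by
    refine Integrable.add ?_ (Admissible.integrable_frob_F hS hT hvK hp)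
    simp only [inner_sub_left]
    exact (hS.integrable_inner hvK hp.1.1).sub (hS.integrable_inner (h.datum.comp_snd T) hp.1.1)
  have i2 := hϰ.integrable_mul hT hvK.2
  have i3 : Integrable (fun z : ℝ × Torus d => ϰ z.1 * (1 / 2 * (S.F 0).trace)) (stMeasure T d) :=
    hϰ.integrable_mul hT (integrable_const _)
  -- The payoff density is the density of the weak formulation, whose integral is zero, plus the
  -- weighted entropy and the contribution of `F(0)`.
  have e1 : ∀ z, inner ℝ (v z - v₀ z.2) (p.1 z) +
      1 / 2 * frob (S.F (v z)) (ϰ z.1 • (1 : Mat N) + (2 : ℝ) • p.2 z) =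
      (inner ℝ (v z - v₀ z.2) (p.1 z) + frob (S.F (v z)) (p.2 z)) +
        (ϰ z.1 * S.K (v z) + ϰ z.1 * (1 / 2 * (S.F 0).trace)) := fun z => by
    rw [frob_add_right, frob_smul_right, frob_smul_right, frob_one_right, Assumptions.trace_F]
    ring
  rw [payoff]
  simp only [e1]
  have i23 : Integrable (fun z => ϰ z.1 * S.K (v z) + ϰ z.1 * (1 / 2 * (S.F 0).trace))
    (stMeasure T d) := i2.add i3
  rw [integral_add i1 i23, h3, integral_add i2 i3, h.integral_weight_mul_K hS hT hϰ,
    integral_mul_const, integral_stMeasure_fst hT, K₀]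
  simp only [Assumptions.trace_F (S := S) (v₀ _)]
  rw [integral_add (h.datum.2.const_mul 2) (integrable_const _), integral_const_mul]
  simp only [integral_const, probReal_univ, smul_eq_mul, one_mul, bigWeight]
  ring

/-! ### Optimality -/

lemma hasFDerivAt_objective (hS : S.Assumptions) (w e : Vec n) (Q : Mat N) :
    ∃ f' : Vec n →L[ℝ] ℝ, HasFDerivAt (fun y => inner ℝ y e + 1 / 2 * frob (S.F y) Q) f' w ∧
      ∀ k, f' (EuclideanSpace.single k 1) = e k + 1 / 2 * frob (S.dF k w) Q := by
  have hd : ∀ l m, HasFDerivAt (fun y => S.F y l m) (fderiv ℝ (fun y => S.F y l m) w) w :=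
    fun l m => (((hS.F_smooth l m).differentiable (by simp)) w).hasFDerivAt
  have h1 : HasFDerivAt (fun y => frob (S.F y) Q)
      (∑ l, ∑ m, Q l m • fderiv ℝ (fun y => S.F y l m) w) w := by
    simp only [frob]
    exact HasFDerivAt.fun_sum fun l _ => HasFDerivAt.fun_sum fun m _ => (hd l m).mul_const (Q l m)
  have h2 : HasFDerivAt (fun y : Vec n => inner ℝ y e) (innerSL ℝ e) w := by
    refine (innerSL ℝ e).hasFDerivAt.congr_of_eventuallyEq (Eventually.of_forall fun y => ?_)
    exact real_inner_comm _ _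
  refine ⟨_, h2.add (h1.const_mul (1 / 2)), fun k => ?_⟩
  simp only [add_apply, smul_apply, sum_apply, innerSL_apply_apply, smul_eq_mul, frob, dF, Matrix.of_apply]
  congr 1
  · simp [PiLp.inner_apply]
  · congr 1
    exact Finset.sum_congr rfl fun l _ => Finset.sum_congr rfl fun m _ => mul_comm _ _

lemma frob_dF_one (hS : S.Assumptions) (k : Fin n) (w : Vec n) :
    frob (S.dF k w) 1 = 2 * S.sharp w k := by
  have h1 : S.sharp w k = fderiv ℝ S.K w (EuclideanSpace.single k 1) := by
    rw [← inner_gradient, EuclideanSpace.inner_single_right, one_mul]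
    rfl
  have h2 : HasFDerivAt S.K ((1 / 2 : ℝ) • ∑ l, fderiv ℝ (fun y => S.F y l l) w) w := by
    have h3 : S.K = fun y => 1 / 2 * ((∑ l, S.F y l l) - (S.F 0).trace) := by
      ext y
      simp [K, Matrix.trace]
    rw [h3]
    refine ((HasFDerivAt.fun_sum fun l _ => ?_).sub_const _).const_mul _
    exact (((hS.F_smooth l l).differentiable (by simp)) w).hasFDerivAt
  rw [h1, h2.fderiv, frob_one_right]
  simp [Matrix.trace, dF]

/-- Pointwise optimality of the strong solution. -/
lemma objective_le (hS : S.Assumptions) {w e : Vec n} {B : Mat N} {c : ℝ}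
    (hQ : c • (1 : Mat N) + (2 : ℝ) • B ∈ S.Lam)
    (hpos : (c • (1 : Mat N) + (2 : ℝ) • B).PosSemidef)
    (he : ∀ k, e k + c * S.sharp w k + frob B (S.dF k w) = 0) {y : Vec n} {M : Mat N}
    (hM : S.LamNonneg (M - S.F y)) :
    inner ℝ w e + 1 / 2 * frob (S.F w) (c • (1 : Mat N) + (2 : ℝ) • B) ≤
      inner ℝ y e + 1 / 2 * frob M (c • (1 : Mat N) + (2 : ℝ) • B) := by
  set Q := c • (1 : Mat N) + (2 : ℝ) • B with hQdef
  obtain ⟨f', hf', hk⟩ := hasFDerivAt_objective hS w e Q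
  -- Stationarity at `w` is the equation, because `∂_k F : I = 2 w^#_k`.
  have hzero : f' = 0 := by
    have h1 : ∀ k, f' (EuclideanSpace.single k 1) = 0 := fun k => by
      rw [hk, hQdef, frob_add_right, frob_smul_right, frob_smul_right, frob_dF_one hS]
      have := he k
      rw [frob_comm] at this
      linarith
    ext y
    rw [← (EuclideanSpace.basisFun (Fin n) ℝ).sum_repr y]
    simp [h1]
  -- Here the positivity condition enters: convexity of the flux is available only against
  -- nonnegative definite elements of `Λ`.
  have hconv : ConvexOn ℝ univ fun y : Vec n => inner ℝ y e + 1 / 2 * frob (S.F y) Q := by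
    refine ConvexOn.add ?_ ((hS.lam_convex Q hQ hpos).smul (by norm_num : (0 : ℝ) ≤ 1 / 2))
    have h2 : (fun y : Vec n => inner ℝ y e) = fun y => (innerSL ℝ e) y := by
      ext y
      exact real_inner_comm _ _
    rw [h2]
    exact (innerSL ℝ e).toLinearMap.convexOn convex_univ
  have h3 := tangent_le_of_convexOn hconv hf' y
  rw [hzero] at h3
  simp only [zero_apply, add_zero] at h3
  have h4 := hM.2 Q hQ hpos
  rw [frob_sub_left] at h4
  linarith

/-- The pointwise optimality of the solution, integrated. The solution enters as the subsolution
with `M = π_Λ F(v)`, whose payoff is already known. -/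
lemma le_payoff (h : S.IsDualPair T ϰ v₀ v E B) (hS : S.Assumptions) (hT : 0 < T)
    (hϰ : IsWeight T ϰ) (hf : (E, B) ∈ S.Feasible T ϰ)
    {q : (ℝ × Torus d → Vec n) × (ℝ × Torus d → Mat N)} (hq : q ∈ S.SubClass T) :
    bigWeight T ϰ 0 * S.K₀ v₀ ≤ payoff T ϰ v₀ q.1 q.2 E B := by
  have hvq := hS.projLam_F_mem_subClass h.weak.1
  rw [← h.payoff_eq hS hT hϰ hf.1, ← payoff_projLam hT hf.1,
    payoff_eq_sub hS hϰ h.datum hf.1 hvq, payoff_eq_sub hS hϰ h.datum hf.1 hq]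
  refine sub_le_sub_right ?_ _
  rw [payoff, payoff]
  simp only [Pi.zero_apply, sub_zero]
  refine integral_mono_ae (integrable_payoff hS hϰ h.datum hf.1 hvq).1
    (integrable_payoff hS hϰ h.datum hf.1 hq).1 ?_
  filter_upwards [Admissible.ae_mem_Lam hT hf.1, hf.2, h.equation, hq.2.2] with z h1 h2 h3 h4
  have hQ := slope_mem_Lam (ϰ := ϰ z.1) h1
  rw [frob_projLam_of_mem _ hQ]
  exact objective_le hS hQ h2 h3 h4

/-- Weak duality: the solution is a competitor in the infimum, and its payoff is the same for every
admissible pair. No positivity of the pair is needed. -/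
lemma dualObjective_le (h : S.IsDualPair T ϰ v₀ v E B) (hS : S.Assumptions) (hT : 0 < T)
    (hϰ : IsWeight T ϰ) {p : (ℝ × Torus d → Vec n) × (ℝ × Torus d → Mat N)}
    (hp : p ∈ S.Admissible T) :
    S.dualObjective T ϰ v₀ p ≤ ((bigWeight T ϰ 0 * S.K₀ v₀ : ℝ) : EReal) := by
  have hvq := hS.projLam_F_mem_subClass h.weak.1
  have h1 : S.kFunctional T ϰ p.1 p.2 ≤
      ((payoff T ϰ 0 v (fun z => S.projLam (S.F (v z))) p.1 p.2 : ℝ) : EReal) :=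
    iInf₂_le_of_le _ hvq le_rfl
  refine (add_le_add le_rfl h1).trans (le_of_eq ?_)
  rw [← EReal.coe_add, EReal.coe_eq_coe_iff, ← h.payoff_eq hS hT hϰ hp, ← payoff_projLam hT hp,
    payoff_eq_sub hS hϰ h.datum hp hvq]
  ring

lemma dualObjective_eq (h : S.IsDualPair T ϰ v₀ v E B) (hS : S.Assumptions) (hT : 0 < T)
    (hϰ : IsWeight T ϰ) (hf : (E, B) ∈ S.Feasible T ϰ) :
    S.dualObjective T ϰ v₀ (E, B) = ((bigWeight T ϰ 0 * S.K₀ v₀ : ℝ) : EReal) := by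
  refine le_antisymm (h.dualObjective_le hS hT hϰ hf.1) ?_
  have h1 : ((bigWeight T ϰ 0 * S.K₀ v₀ + ∫ z, inner ℝ (v₀ z.2) (E z) ∂stMeasure T d : ℝ) : EReal) ≤
      S.kFunctional T ϰ E B := by
    refine le_iInf₂ fun q hq => ?_
    rw [EReal.coe_le_coe_iff]
    have h2 := h.le_payoff hS hT hϰ hf hq
    rw [payoff_eq_sub hS hϰ h.datum hf.1 hq] at h2
    linarith
  refine le_trans (le_of_eq ?_) (add_le_add le_rfl h1)
  rw [← EReal.coe_add, EReal.coe_eq_coe_iff]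
  ring

end IsDualPair

/-! ### Comparison of the four optimal values -/

lemma dualSubValue_le_dualValue (hS : S.Assumptions) (hT : 0 < T) :
    S.dualSubValue T ϰ v₀ ≤ S.dualValue T ϰ v₀ := by
  refine iSup₂_mono fun p hp => le_iInf₂ fun w hw => ?_
  refine iInf₂_le_of_le _ (hS.projLam_F_mem_subClass hw) (le_of_eq ?_)
  rw [payoff_projLam hT hp]

lemma primalSubValue_le_primalValue (hS : S.Assumptions) (hT : 0 < T) :
    S.primalSubValue T ϰ v₀ ≤ S.primalValue T ϰ v₀ := by
  refine le_iInf₂ fun w hw => iInf₂_le_of_le _ (hS.projLam_F_mem_subClass hw) ?_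
  refine iSup₂_mono fun p hp => le_of_eq ?_
  rw [payoff_projLam hT hp]

lemma iSup₂_iInf₂_le_iInf₂_iSup₂ {α β : Type*} (s : Set α) (t : Set β) (f : α → β → EReal) :
    ⨆ a ∈ s, ⨅ b ∈ t, f a b ≤ ⨅ b ∈ t, ⨆ a ∈ s, f a b :=
  iSup₂_le fun a ha => le_iInf₂ fun b hb =>
    (iInf₂_le b hb).trans (le_iSup₂ (f := fun a (_ : a ∈ s) => f a b) a ha)

/-- Consistency of the dual formulation for strong solutions. -/
theorem IsStrongSolution.consistent (hS : S.Assumptions) (hT : 0 < T) (hϰ : IsWeight T ϰ)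
    (hv : S.IsStrongSolution T ϰ v₀ v) (hpos : S.WeightedPositivity T ϰ v) :
    S.Consistent T ϰ v₀ v := by
  obtain ⟨G, hG, hGpos⟩ := hpos
  have feas : ∀ {E : ℝ × Torus d → Vec n} {B : ℝ × Torus d → Mat N},
      IsWeakDt T (S.weightedSharp T ϰ v) E → S.IsWeakLstar T (S.weightedSharp T ϰ v) B →
      (E, B) ∈ S.Feasible T ϰ := fun {E B} hE hB => by
    refine ⟨(hv.isDualPair hS hT hϰ hE hB).admissible, ?_⟩
    filter_upwards [hGpos, hB.ae_unique hT (hG.weighted hT hϰ)] with z h1 h2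
    rw [h2, smul_smul]
    rwa [neg_smul, sub_neg_eq_add] at h1
  obtain ⟨E₀, hE₀, -⟩ := hv.dt_class
  have hB₀ := hG.weighted hT hϰ
  have hD := hv.isDualPair hS hT hϰ hE₀ hB₀
  have hf₀ := feas hE₀ hB₀
  set c : EReal := ((bigWeight T ϰ 0 * S.K₀ v₀ : ℝ) : EReal) with hc
  have c1 : c ≤ S.dualSubValue T ϰ v₀ :=
    le_iSup₂_of_le _ hf₀.1 (le_iInf₂ fun q hq => EReal.coe_le_coe_iff.2 (hD.le_payoff hS hT hϰ hf₀ hq))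
  have c2 : S.primalValue T ϰ v₀ ≤ c :=
    iInf₂_le_of_le _ hv.weak.1 (iSup₂_le fun p hp =>
      EReal.coe_le_coe_iff.2 (hD.payoff_eq hS hT hϰ hp).le)
  have c3 := dualSubValue_le_dualValue (ϰ := ϰ) (v₀ := v₀) hS hT
  have c4 := primalSubValue_le_primalValue (ϰ := ϰ) (v₀ := v₀) hS hT
  have c5 : S.dualValue T ϰ v₀ ≤ S.primalValue T ϰ v₀ := iSup₂_iInf₂_le_iInf₂_iSup₂ _ _ _
  have c6 : S.dualSubValue T ϰ v₀ ≤ S.primalSubValue T ϰ v₀ := iSup₂_iInf₂_le_iInf₂_iSup₂ _ _ _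
  -- The chain `c ≤ 𝓙~ ≤ 𝓙 ≤ 𝓘 ≤ c` closes; inserting `𝓘~` between `𝓙~` and `𝓘` settles the
  -- remaining value.
  have hdual : S.dualSubValue T ϰ v₀ = c := le_antisymm ((c3.trans c5).trans c2) c1
  refine ⟨le_antisymm c2 (c1.trans (c3.trans c5)), le_antisymm (c5.trans c2) (c1.trans c3),
    le_antisymm (c4.trans c2) (c1.trans c6), hdual, ⟨E₀, _, hE₀, hB₀⟩, fun E B hE hB => ?_⟩
  have hD' := hv.isDualPair hS hT hϰ hE hB
  have hf := feas hE hB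
  have hval := hD'.dualObjective_eq hS hT hϰ hf
  refine ⟨hf.1.1, hf, fun p hp => ?_, hval.trans hdual.symm, ?_⟩
  · rw [mem_ofPred_eq, hval]
    exact hD'.dualObjective_le hS hT hϰ hp.1
  · filter_upwards [hD'.sharp_eq] with z hz
    rw [← hS.gradient_Kstar_sharp (v z), hz, backward, intervalIntegral.integral_neg, smul_neg]

end System


/-! ### Restriction to a shorter time interval -/

section Restrict

variable {d n : ℕ} {T T₁ : ℝ}

lemma stMeasure_mono (h : T₁ ≤ T) : stMeasure T₁ d ≤ stMeasure T d := by
  rw [stMeasure_eq, stMeasure_eq]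
  exact Measure.restrict_mono (prod_mono (Ioo_subset_Ioo_right h) le_rfl) le_rfl

lemma stMeasure_eq_restrict (h : T₁ ≤ T) :
    stMeasure T₁ d = (stMeasure T d).restrict {z | z.1 < T₁} := by
  have hm : MeasurableSet {z : ℝ × Torus d | z.1 < T₁} := measurableSet_lt (by fun_prop) (by fun_prop)
  rw [stMeasure_eq, stMeasure_eq, Measure.restrict_restrict hm]
  congr 1
  ext z
  simp only [mem_prod, mem_Ioo, mem_univ, and_true, mem_inter_iff, mem_ofPred_eq]
  constructor
  · rintro ⟨h1, h2⟩
    exact ⟨h2, h1, h2.trans_le h⟩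
  · rintro ⟨h1, h2, -⟩
    exact ⟨h2, h1⟩

lemma integral_stMeasure_eq (h : T₁ ≤ T) {f : ℝ × Torus d → ℝ}
    (hf : ∀ z, z.1 ∉ Ioo 0 T₁ → f z = 0) : ∫ z, f z ∂stMeasure T₁ d = ∫ z, f z ∂stMeasure T d := by
  rw [stMeasure_eq, stMeasure_eq]
  symm
  exact setIntegral_eq_of_subset_of_forall_sdiff_eq_zero
    (measurableSet_Ioo.prod MeasurableSet.univ) (prod_mono (Ioo_subset_Ioo_right h) le_rfl)
    fun z hz => hf z fun hz' => hz.2 ⟨hz', mem_univ _⟩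

lemma CompactIn.mono {V : Type*} [Zero V] (h : T₁ ≤ T) {φ : ℝ × Torus d → V}
    (hφ : CompactIn T₁ φ) : CompactIn T φ :=
  ⟨hφ.1, hφ.2.trans (prod_mono (Ioo_subset_Ioo_right h) le_rfl)⟩

lemma CompactIn.comp {V V' : Type*} [Zero V] [Zero V'] {φ : ℝ × Torus d → V}
    (hφ : CompactIn T φ) {ψ : ℝ × Torus d → V'} (h : ∀ z, φ z = 0 → ψ z = 0) : CompactIn T ψ := by
  have hsub : Function.support ψ ⊆ Function.support φ := fun z hz h0 => hz (h z h0)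
  exact ⟨hφ.1.mono hsub, (closure_mono hsub).trans hφ.2⟩

lemma CompactIn.eq_zero {V : Type*} [Zero V] {φ : ℝ × Torus d → V} (hφ : CompactIn T φ)
    {z : ℝ × Torus d} (hz : z.1 ∉ Ioo 0 T) : φ z = 0 :=
  image_eq_zero_of_notMem_tsupport fun h => hz (hφ.2 h).1

lemma CompactIn.dtVec_eq_zero {φ : ℝ × Torus d → Vec n} (hφ : CompactIn T φ)
    {z : ℝ × Torus d} (hz : z.1 ∉ Ioo 0 T) : dtVec φ z = 0 := by
  have h1 : φ =ᶠ[𝓝 z] 0 := notMem_tsupport_iff_eventuallyEq.1 fun h => hz (hφ.2 h).1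
  have h2 : Tendsto (fun s : ℝ => (s, z.2)) (𝓝 z.1) (𝓝 z) :=
    (Continuous.prodMk_left z.2).tendsto z.1
  have h3 : (fun s => φ (s, z.2)) =ᶠ[𝓝 z.1] fun _ => 0 := h2.eventually h1
  rw [dtVec, h3.deriv_eq, deriv_const]

lemma IsWeakDt.restrict (h : T₁ ≤ T) {u w : ℝ × Torus d → Vec n} (hu : IsWeakDt T u w) :
    IsWeakDt T₁ u w := by
  have hs : Ioo 0 T₁ ×ˢ (univ : Set (Torus d)) ⊆ Ioo 0 T ×ˢ univ :=
    prod_mono (Ioo_subset_Ioo_right h) le_rfl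
  refine ⟨hu.1.mono_set hs, hu.2.1.mono_set hs, fun φ hφ hc => ?_⟩
  rw [integral_stMeasure_eq h fun z hz => by rw [hc.dtVec_eq_zero hz, inner_zero_right],
    integral_stMeasure_eq h fun z hz => by rw [hc.eq_zero hz, inner_zero_right]]
  exact hu.2.2 φ hφ (hc.mono h)

lemma integrable_inner_of_compactIn {u φ : ℝ × Torus d → Vec n}
    (hu : LocallyIntegrableOn u (Ioo 0 T ×ˢ univ) volume) (hφ : Continuous φ)
    (hc : CompactIn T φ) : Integrable (fun z => inner ℝ (u z) (φ z)) (stMeasure T d) := by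
  simp only [inner_eq_sum]
  refine integrable_finsetSum _ fun i _ => ?_
  exact integrable_mul_of_compactIn (φ := fun z => φ z i) (hu.vec_apply i) (by fun_prop)
    (hc.comp fun z hz => by simp [hz])

/-- The product rule for weak time derivatives and smooth functions of time. -/
lemma IsWeakDt.smul {u w : ℝ × Torus d → Vec n} (hu : IsWeakDt T u w) {q q' : ℝ → ℝ}
    (hq : ContDiff ℝ ∞ q) (hq' : ∀ t, HasDerivAt q (q' t) t) :
    IsWeakDt T (fun z => q z.1 • u z) fun z => q z.1 • w z + q' z.1 • u z := by
  have hqd : q' = deriv q := funext fun t => (hq' t).deriv.symm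
  have hqc' : Continuous q' := by
    rw [hqd]
    exact hq.continuous_deriv (by simp)
  have hmul : ∀ {r : ℝ → ℝ} {f : ℝ × Torus d → Vec n}, Continuous r →
      LocallyIntegrableOn f (Ioo 0 T ×ˢ univ) volume →
      LocallyIntegrableOn (fun z => r z.1 • f z) (Ioo 0 T ×ˢ univ) volume := fun hr hf =>
    hf.continuousOn_smul (isOpen_strip T d).isLocallyClosed (hr.comp continuous_fst).continuousOn
  refine ⟨hmul hq.continuous hu.1, (hmul hq.continuous hu.2.1).add (hmul hqc' hu.1),
    fun φ hφ hc => ?_⟩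
  have hcψ : CompactIn T fun z => q z.1 • φ z := hc.comp fun z hz => by rw [hz, smul_zero]
  have hd : ∀ z, dtVec (fun z => q z.1 • φ z) z = q z.1 • dtVec φ z + q' z.1 • φ z := fun z => by
    have h1 : DifferentiableAt ℝ (fun s => φ (s, z.2)) z.1 :=
      (hφ.contDiff_time z.2).differentiable (by simp) _
    exact ((hq' z.1).smul h1.hasDerivAt).deriv
  have h1 := hu.2.2 _ ((smoothTX_time hq).smul hφ) hcψ
  have hφc := hφ.continuous
  have i2 : Integrable (fun z => inner ℝ (u z) (q' z.1 • φ z)) (stMeasure T d) :=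
    integrable_inner_of_compactIn hu.1 ((hqc'.comp continuous_fst).smul hφc)
      (hc.comp fun z hz => by rw [hz, smul_zero])
  have i1 : Integrable (fun z => inner ℝ (u z) (q z.1 • dtVec φ z)) (stMeasure T d) := by
    have hdc : CompactIn T (dtVec φ) := by
      have hsub : Function.support (dtVec φ) ⊆ tsupport φ := fun z hz => by
        by_contra hn
        have h1 : φ =ᶠ[𝓝 z] 0 := notMem_tsupport_iff_eventuallyEq.1 hn
        have h2 : Tendsto (fun s : ℝ => (s, z.2)) (𝓝 z.1) (𝓝 z) :=
          (Continuous.prodMk_left z.2).tendsto z.1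
        have h3 : (fun s => φ (s, z.2)) =ᶠ[𝓝 z.1] fun _ => 0 := h2.eventually h1
        exact hz (by rw [dtVec, h3.deriv_eq, deriv_const])
      exact ⟨hc.1.mono' hsub, (closure_minimal hsub (isClosed_tsupport _)).trans hc.2⟩
    have hdφ : Continuous (dtVec φ) := by
      have : SmoothTX (dtVec φ) := by
        rw [smoothTX_vec_iff]
        intro i
        simp only [System.SmoothTX.dtVec_apply hφ]
        exact (smoothTX_vec_iff.1 hφ i).deriv_time
      exact this.continuous
    exact integrable_inner_of_compactIn hu.1 ((hq.continuous.comp continuous_fst).smul hdφ)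
      (hdc.comp fun z hz => by rw [hz, smul_zero])
  have i3 : Integrable (fun z => inner ℝ (w z) (q z.1 • φ z)) (stMeasure T d) :=
    integrable_inner_of_compactIn hu.2.1 ((hq.continuous.comp continuous_fst).smul hφc) hcψ
  simp only [hd, inner_add_right] at h1
  rw [integral_add i1 i2] at h1
  have e1 : ∀ z, inner ℝ (q z.1 • w z + q' z.1 • u z) (φ z) =
      inner ℝ (w z) (q z.1 • φ z) + inner ℝ (u z) (q' z.1 • φ z) := fun z => by
    rw [inner_add_left, real_inner_smul_left, real_inner_smul_left, real_inner_smul_right,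
      real_inner_smul_right]
  have e2 : ∀ z, inner ℝ (q z.1 • u z) (dtVec φ z) = inner ℝ (u z) (q z.1 • dtVec φ z) :=
    fun z => by rw [real_inner_smul_left, real_inner_smul_right]
  simp only [e1, e2]
  rw [integral_add i3 i2]
  linarith

end Restrict

namespace System

variable {d n N : ℕ} {S : System d n N} {T T₁ : ℝ} {ϰ : ℝ → ℝ} {v₀ : Torus d → Vec n}
  {v : ℝ × Torus d → Vec n}

lemma IsWeakLstar.restrict (h : T₁ ≤ T) {u : ℝ × Torus d → Vec n} {G : ℝ × Torus d → Mat N}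
    (hG : S.IsWeakLstar T u G) : S.IsWeakLstar T₁ u G := by
  have hs : Ioo 0 T₁ ×ˢ (univ : Set (Torus d)) ⊆ Ioo 0 T ×ˢ univ :=
    prod_mono (Ioo_subset_Ioo_right h) le_rfl
  refine ⟨hG.1.mono_set hs, fun l m => (hG.2.1 l m).mono_set hs,
    ae_mono (stMeasure_mono h) hG.2.2.1, fun Ψ hΨ hc => ?_⟩
  rw [integral_stMeasure_eq h fun z hz => ?_, integral_stMeasure_eq h fun z hz => ?_]
  · exact hG.2.2.2 Ψ hΨ (hc.mono h)
  · rw [hc.eq_zero hz]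
    simp [frob]
  · have h1 : (fun y => Ψ (z.1, y)) = 0 := by
      ext1 y
      exact hc.eq_zero (z := (z.1, y)) hz
    have h2 := S.L_zero z.2
    rw [h1, show (0 : Torus d → Mat N) = fun _ => 0 from rfl, h2, inner_zero_right]

/-- Extension of admissible pairs by zero. -/
lemma Admissible.extend (hS : S.Assumptions) (h : T₁ ≤ T)
    {p : (ℝ × Torus d → Vec n) × (ℝ × Torus d → Mat N)} (hp : p ∈ S.Admissible T₁) :
    ({z | z.1 < T₁}.indicator p.1, {z | z.1 < T₁}.indicator p.2) ∈ S.Admissible T := by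
  set A : Set (ℝ × Torus d) := {z | z.1 < T₁} with hA
  have hm : MeasurableSet A := measurableSet_lt (by fun_prop) (by fun_prop)
  obtain ⟨⟨hE, hB, hs⟩, hc⟩ := hp
  rw [stMeasure_eq_restrict h] at hE hB hs
  refine ⟨⟨⟨(aestronglyMeasurable_indicator_iff hm).2 hE.1, ?_⟩, fun l m => ?_, ?_⟩, fun Ψ hΨ h0 => ?_⟩
  · refine ((integrable_indicator_iff hm).2 hE.2).congr (Eventually.of_forall fun z => ?_)
    by_cases hz : z ∈ A
    · simp [hz]
    · simp only [hz, not_false_eq_true, indicator_of_notMem]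
      exact hS.K_nFunction.legendre_zero.symm
  · refine ((memLp_indicator_iff_restrict hm).2 (hB l m)).ae_eq (Eventually.of_forall fun z => ?_)
    by_cases hz : z ∈ A <;> simp [hz]
  · rw [ae_restrict_iff' hm] at hs
    filter_upwards [hs] with z hz
    by_cases hz' : z ∈ A
    · simpa [hz'] using hz hz'
    · simp [hz']
  -- Test fields for the shorter interval are not required to vanish at `T₁`, so every test field on
  -- `[0,T]` may be used there. This is why extension by zero creates no jump term.
  · rw [← hc Ψ hΨ h0, stMeasure_eq_restrict h, ← integral_indicator hm]
    refine integral_congr_ae (Eventually.of_forall fun z => ?_)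
    by_cases hz : z ∈ A <;> simp [hz, frob_zero_left]

lemma IsWeakSolution.restrict (hS : S.Assumptions) (h : T₁ ≤ T) (hv : S.IsWeakSolution T v₀ v) :
    S.IsWeakSolution T₁ v₀ v := by
  have hle := stMeasure_mono (d := d) h
  refine ⟨⟨hv.1.1.mono_measure hle, hv.1.2.mono_measure hle⟩, fun p hp => ?_⟩
  have hm : MeasurableSet {z : ℝ × Torus d | z.1 < T₁} := measurableSet_lt (by fun_prop) (by fun_prop)
  rw [← hv.2 _ (Admissible.extend hS h hp), stMeasure_eq_restrict h, ← integral_indicator hm]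
  refine integral_congr_ae (Eventually.of_forall fun z => ?_)
  by_cases hz : z.1 < T₁ <;> simp [hz, frob_comm _ (0 : Mat N), frob_zero_left]

/-! ### Exponential weights -/

lemma isWeight_exp (T γ : ℝ) : IsWeight T fun t => Real.exp (-γ * t) := by
  have hc : Continuous fun t : ℝ => Real.exp (-γ * t) := by fun_prop
  refine ⟨hc.aemeasurable, ?_⟩
  obtain ⟨C, hC⟩ := isCompact_Icc.exists_bound_of_continuousOn (s := Icc 0 T) hc.continuousOn
  refine ⟨Real.exp (-(|γ| * |T|)), C, Real.exp_pos _, fun t ht => ⟨?_, ?_⟩⟩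
  · apply Real.exp_le_exp.2
    have h1 : |γ * t| ≤ |γ| * |T| := by
      rw [abs_mul]
      refine mul_le_mul_of_nonneg_left ?_ (abs_nonneg _)
      rw [abs_of_nonneg ht.1]
      exact ht.2.trans (le_abs_self _)
    have h2 := le_abs_self (γ * t)
    linarith
  · exact (le_abs_self _).trans (hC t ht)

lemma bigWeight_exp (T : ℝ) {γ : ℝ} (hγ : γ ≠ 0) (t : ℝ) :
    bigWeight T (fun t => Real.exp (-γ * t)) t = (Real.exp (-γ * t) - Real.exp (-γ * T)) / γ := by
  have h1 : ∀ s ∈ uIcc t T, HasDerivAt (fun s => -(Real.exp (-γ * s) / γ)) (Real.exp (-γ * s)) s := by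
    intro s _
    refine ((((hasDerivAt_id s).const_mul (-γ)).exp.div_const γ).neg).congr_deriv ?_
    simp only [id]
    field_simp
  have hc : Continuous fun t : ℝ => Real.exp (-γ * t) := by fun_prop
  rw [bigWeight, intervalIntegral.integral_eq_sub_of_hasDerivAt h1 (hc.intervalIntegrable _ _)]
  ring

/-- Up to a time strictly before `T` the weight `Ϙ` is bounded away from zero, so the bound on `Ϙ G`
is a bound on `G`. -/
lemma IsWeakLstar.memLp_top_restrict (hT : 0 < T) (hϰ : IsWeight T ϰ) (hT₁ : T₁ ∈ Ico 0 T)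
    {G : ℝ × Torus d → Mat N} {l m : Fin N}
    (hG : MemLp (fun z => bigWeight T ϰ z.1 * G z l m) ⊤ (stMeasure T d)) :
    MemLp (fun z => G z l m) ⊤ (stMeasure T₁ d) := by
  obtain ⟨R, hR⟩ := (hϰ.inv_absolutelyContinuous hT hT₁).exists_bound
  have h1 := hG.mono_measure (stMeasure_mono hT₁.2.le)
  have hm : AEStronglyMeasurable (fun z : ℝ × Torus d => (bigWeight T ϰ z.1)⁻¹) (stMeasure T₁ d) :=
    ((hϰ.bigWeight_aestronglyMeasurable hT d).inv₀).mono_measure (stMeasure_mono hT₁.2.le)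
  have h2 : MemLp (fun z : ℝ × Torus d => (bigWeight T ϰ z.1)⁻¹) ⊤ (stMeasure T₁ d) := by
    refine MemLp.of_bound hm R ?_
    filter_upwards [ae_mem_stMeasure T₁ d] with z hz
    exact hR z.1 (by rw [uIcc_of_le hT₁.1]; exact ⟨hz.1.le, hz.2.le⟩)
  refine (h1.mul h2 (r := ⊤)).ae_eq ?_
  filter_upwards [ae_mem_stMeasure T₁ d] with z hz
  have hq := (hϰ.bigWeight_pos hT ⟨hz.1.le, hz.2.trans hT₁.2⟩).ne'
  simp only [Pi.mul_apply]
  rw [inv_mul_cancel_left₀ hq]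

/-- A strong solution remains one on a shorter interval, with exponential weights. -/
lemma IsStrongSolution.restrict_exp (hS : S.Assumptions) (hT : 0 < T) (hϰ : IsWeight T ϰ)
    (hv : S.IsStrongSolution T ϰ v₀ v) (h0 : 0 < T₁) (h1 : T₁ < T) {γ : ℝ} (hγ : 0 < γ) :
    S.IsStrongSolution T₁ (fun t => Real.exp (-γ * t)) v₀ v := by
  have hle := stMeasure_mono (d := d) h1.le
  have hT₁ : T₁ ∈ Ico 0 T := ⟨h0.le, h1⟩
  set ϰ₁ : ℝ → ℝ := fun t => Real.exp (-γ * t) with hϰ₁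
  have hw₁ : IsWeight T₁ ϰ₁ := isWeight_exp T₁ γ
  obtain ⟨E, hE, hEo⟩ := hv.dt_class
  obtain ⟨W, G, hW, hG, hGb, heq⟩ := hv.equation
  have hvK := hv.weak.1
  have hEi := hS.integrable_of_inOrlicz_Kstar hEo
  have huo := hS.inOrlicz_sharp hvK
  have hq₁ : bigWeight T₁ ϰ₁ = fun t => (Real.exp (-γ * t) - Real.exp (-γ * T₁)) / γ :=
    funext (bigWeight_exp T₁ hγ.ne')
  -- The exponential primitive is smooth, so the weak product rule applies directly to the new
  -- weight.
  have hq₁s : ContDiff ℝ ∞ (bigWeight T₁ ϰ₁) := by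
    rw [hq₁]
    fun_prop
  have hq₁d : ∀ t, HasDerivAt (bigWeight T₁ ϰ₁) (-ϰ₁ t) t := by
    intro t
    rw [hq₁]
    refine ((((hasDerivAt_id t).const_mul (-γ)).exp.sub_const _).div_const γ).congr_deriv ?_
    simp only [id, hϰ₁]
    field_simp
  refine ⟨hv.datum, hv.weak.restrict hS h1.le, ⟨_, (hW.restrict h1.le).smul hq₁s hq₁d, ?_⟩,
    ⟨W, G, hW.restrict h1.le, hG.restrict h1.le, fun l m => ?_, ae_mono hle heq⟩, hv.initial⟩
  · obtain ⟨R, hR⟩ := (hϰ.inv_absolutelyContinuous hT hT₁).exists_bound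
    obtain ⟨c, C, hc, hC, hϰb, -⟩ := hϰ.bounds hT
    obtain ⟨c₁, C₁, -, hC₁, hϰ₁b, hq₁b⟩ := hw₁.bounds h0
    have hR0 : 0 ≤ R := (norm_nonneg _).trans (hR 0 left_mem_uIcc)
    -- The constant exceeds both coefficients in the expansion below, which expresses the new time
    -- derivative through `E` and `v^#`, both of finite `K*`-modular.
    obtain ⟨D, hD, hK⟩ := Delta2.exists_lincomb_le hS.convex_Kstar hS.Kstar_nonneg
      hS.K_nFunction.legendre_even hS.Kstar_delta2 (C₁ * T₁ * R * (1 + C) + C₁)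
    have key : ∀ᵐ z ∂stMeasure T₁ d, bigWeight T₁ ϰ₁ z.1 • W z + -ϰ₁ z.1 • S.sharp (v z) =
        (bigWeight T₁ ϰ₁ z.1 * (bigWeight T ϰ z.1)⁻¹) • E z +
        (bigWeight T₁ ϰ₁ z.1 * (bigWeight T ϰ z.1)⁻¹ * ϰ z.1 - ϰ₁ z.1) • S.sharp (v z) := by
      filter_upwards [ae_mono hle (hS.dt_sharp_ae_eq hT hϰ hvK hE hEi hW)] with z hz
      rw [hz]
      module
    have hmq : AEStronglyMeasurable (fun z : ℝ × Torus d =>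
        bigWeight T₁ ϰ₁ z.1 * (bigWeight T ϰ z.1)⁻¹) (stMeasure T₁ d) :=
      (hw₁.bigWeight_aestronglyMeasurable h0 d).mul
        ((hϰ.bigWeight_aestronglyMeasurable hT d).inv₀.mono_measure hle)
    have hmE : AEStronglyMeasurable (fun z =>
        (bigWeight T₁ ϰ₁ z.1 * (bigWeight T ϰ z.1)⁻¹) • E z +
        (bigWeight T₁ ϰ₁ z.1 * (bigWeight T ϰ z.1)⁻¹ * ϰ z.1 - ϰ₁ z.1) • S.sharp (v z))
        (stMeasure T₁ d) :=
      (hmq.smul (hEo.1.mono_measure hle)).add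
        (((hmq.mul ((hϰ.aestronglyMeasurable d).mono_measure hle)).sub
          (hw₁.aestronglyMeasurable d)).smul (huo.1.mono_measure hle))
    refine InOrlicz.congr ⟨hmE, ?_⟩ (key.mono fun z hz => hz.symm)
    refine ((((hEo.2.mono_measure hle).add (huo.2.mono_measure hle)).add
      (integrable_const 1)).const_mul D).mono' (hS.continuous_Kstar.comp_aestronglyMeasurable hmE) ?_
    filter_upwards [ae_mem_stMeasure T₁ d] with z hz
    rw [Real.norm_of_nonneg (hS.Kstar_nonneg _)]
    have b1 : |(bigWeight T ϰ z.1)⁻¹| ≤ R :=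
      hR z.1 (by rw [uIcc_of_le h0.le]; exact ⟨hz.1.le, hz.2.le⟩)
    have b2 : |bigWeight T₁ ϰ₁ z.1| ≤ C₁ * T₁ := by
      rw [abs_of_pos (hw₁.bigWeight_pos h0 ⟨hz.1.le, hz.2⟩)]
      refine (hq₁b z.1 ⟨hz.1.le, hz.2.le⟩).2.trans ?_
      exact mul_le_mul_of_nonneg_left (by linarith [hz.1]) hC₁.le
    have b3 : |ϰ z.1| ≤ C := by
      have := hϰb z.1 ⟨hz.1.le, (hz.2.trans h1).le⟩
      rw [abs_of_nonneg (by linarith)]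
      exact this.2
    have b4 : |ϰ₁ z.1| ≤ C₁ := by
      rw [abs_of_pos (Real.exp_pos _)]
      exact (hϰ₁b z.1 ⟨hz.1.le, hz.2.le⟩).2
    have b5 : |bigWeight T₁ ϰ₁ z.1 * (bigWeight T ϰ z.1)⁻¹| ≤ C₁ * T₁ * R := by
      rw [abs_mul]
      exact mul_le_mul b2 b1 (abs_nonneg _) (by positivity)
    have b6 : |bigWeight T₁ ϰ₁ z.1 * (bigWeight T ϰ z.1)⁻¹ * ϰ z.1| ≤ C₁ * T₁ * R * C := by
      rw [abs_mul]
      exact mul_le_mul b5 b3 (abs_nonneg _) (by positivity)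
    have b7 : 0 ≤ C₁ * T₁ * R * C := by positivity
    have b8 : 0 ≤ C₁ * T₁ * R := by positivity
    refine hK _ _ ?_ ?_ _ _
    · linarith
    · refine (abs_sub _ _).trans ?_
      linarith
  · have h2 := IsWeakLstar.memLp_top_restrict hT hϰ hT₁ (hGb l m)
    obtain ⟨c₁, C₁, -, hC₁, -, hq₁b⟩ := hw₁.bounds h0
    have h3 : MemLp (fun z : ℝ × Torus d => bigWeight T₁ ϰ₁ z.1) ⊤ (stMeasure T₁ d) := by
      refine MemLp.of_bound (hw₁.bigWeight_aestronglyMeasurable h0 d) (C₁ * T₁) ?_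
      filter_upwards [ae_mem_stMeasure T₁ d] with z hz
      rw [Real.norm_of_nonneg (hw₁.bigWeight_pos h0 ⟨hz.1.le, hz.2⟩).le]
      refine (hq₁b z.1 ⟨hz.1.le, hz.2.le⟩).2.trans ?_
      exact mul_le_mul_of_nonneg_left (by linarith [hz.1]) hC₁.le
    exact h2.mul h3

/-- For large exponential weights a strong solution satisfies the positivity condition. -/
lemma IsStrongSolution.exists_weightedPositivity (hT : 0 < T) (hϰ : IsWeight T ϰ)
    (hv : S.IsStrongSolution T ϰ v₀ v) (h0 : 0 < T₁) (h1 : T₁ < T) :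
    ∃ γ₀ : ℝ, 0 < γ₀ ∧ ∀ γ, γ₀ ≤ γ → S.WeightedPositivity T₁ (fun t => Real.exp (-γ * t)) v := by
  obtain ⟨W, G, hW, hG, hGb, heq⟩ := hv.equation
  have hbd : ∀ l m, ∃ C, ∀ᵐ z ∂stMeasure T₁ d, |G z l m| ≤ C := fun l m =>
    exists_ae_abs_le_of_memLp_top (IsWeakLstar.memLp_top_restrict hT hϰ ⟨h0.le, h1⟩ (hGb l m))
  choose C hC using hbd
  have hC' : ∀ᵐ z ∂stMeasure T₁ d, ∀ l m, |G z l m| ≤ C l m :=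
    ae_all_iff.2 fun l => ae_all_iff.2 fun m => hC l m
  -- For nonnegative definiteness `2 Ϙ ∑ |G l m| ≤ ϰ` is enough. Since `Ϙ γ ≤ ϰ` for the exponential
  -- weight, it suffices that `γ ≥ 2 ∑ |C l m|`; the summand `1` keeps `γ` positive.
  refine ⟨2 * (∑ l, ∑ m, |C l m|) + 1, by positivity, fun γ hγ => ⟨G, hG.restrict h1.le, ?_⟩⟩
  have hsum : 0 ≤ ∑ l, ∑ m, |C l m| := by positivity
  have hγ0 : 0 < γ := by linarith
  filter_upwards [hC', (hG.restrict h1.le).2.2.1, ae_mem_stMeasure T₁ d] with z hz hs hm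
  have hq := (isWeight_exp T₁ γ).bigWeight_pos h0 ⟨hm.1.le, hm.2⟩
  rw [neg_smul, sub_neg_eq_add]
  refine posSemidef_of_sum_abs_le (hs.smul _) ?_
  set q := bigWeight T₁ (fun t => Real.exp (-γ * t)) z.1 with hqdef
  have hq1 : q * γ ≤ Real.exp (-γ * z.1) := by
    rw [hqdef, bigWeight_exp T₁ hγ0.ne', div_mul_cancel₀ _ hγ0.ne']
    linarith [Real.exp_pos (-γ * T₁)]
  calc ∑ l, ∑ m, |((2 * q) • G z) l m| ≤ ∑ l, ∑ m, 2 * q * |C l m| := by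
        refine Finset.sum_le_sum fun l _ => Finset.sum_le_sum fun m _ => ?_
        rw [Matrix.smul_apply, smul_eq_mul, abs_mul, abs_of_pos (by positivity : 0 < 2 * q)]
        exact mul_le_mul_of_nonneg_left ((hz l m).trans (le_abs_self _)) (by positivity)
    _ = q * (2 * ∑ l, ∑ m, |C l m|) := by
        simp only [← Finset.mul_sum]
        ring
    _ ≤ q * γ := mul_le_mul_of_nonneg_left (by linarith) hq.le
    _ ≤ Real.exp (-γ * z.1) := hq1

end System

end DualConsistency

end

open DualConsistency
theorem mainTheorem2 {d n N : ℕ} (S : System d n N) (hS : S.Assumptions)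
    (T : ℝ) (hT : 0 < T) (ϰ : ℝ → ℝ) (hϰ : IsWeight T ϰ)
    (v₀ : Torus d → Vec n) (hv₀ : InOrlicz S.K MeasureTheory.volume v₀)
    (v : ℝ × Torus d → Vec n) (hv : S.IsStrongSolution T ϰ v₀ v) :
    (S.WeightedPositivity T ϰ v → S.Consistent T ϰ v₀ v) ∧
    ∀ T₁ : ℝ, 0 < T₁ → T₁ < T → ∃ γ₀ : ℝ, 0 < γ₀ ∧ ∀ γ : ℝ, γ₀ ≤ γ →
      S.IsStrongSolution T₁ (fun t => Real.exp (-γ * t)) v₀ v ∧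
      S.WeightedPositivity T₁ (fun t => Real.exp (-γ * t)) v ∧
      S.Consistent T₁ (fun t => Real.exp (-γ * t)) v₀ v := by
  refine ⟨hv.consistent hS hT hϰ, fun T₁ h0 h1 => ?_⟩
  obtain ⟨γ₀, hγ₀, hpos⟩ := hv.exists_weightedPositivity hT hϰ h0 h1
  refine ⟨γ₀, hγ₀, fun γ hγ => ?_⟩
  have hs := hv.restrict_exp hS hT hϰ h0 h1 (hγ₀.trans_le hγ)
  exact ⟨hs, hpos γ hγ, hs.consistent hS h0 (System.isWeight_exp T₁ γ) (hpos γ hγ)⟩
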